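/- Let $\Omega\subset\mathbb C^n$ be a smooth bounded pseudoconvex domain (a bounded connected open set with a smooth defining function, whose Levi form is positive semidefinite on the complex tangent space at every boundary point), let $\rho$ be a defining function for $\Omega$, let $1\le q\le n$, and let $C$ be a real constant. Here a defining function for $\Omega$ is a real-valued function that is $C^\infty$ on a neighborhood $U$ of $\overline\Omega$, with $\Omega=\{z\in U: \rho(z)<0\}$ and $\nabla\rho\neq 0$ on $b\Omega$. A $(0,q)$-form is written $u=\sum'_{|J|=q}u_J\,d\bar z_J$, the sum being over increasing tuples and $u_J$ being extended skew-symmetrically to all tuples $J$; $\|u\|^2=\sum'_J\int_\Omega|u_J|^2$, and $\|u\|_{-1}^2=\sum'_J\|u_J\|_{W^{-1}(\Omega)}^2$, where $W^{-1}(\Omega)$ is the dual of $W^1_0(\Omega)$; $\overline\partial^*$ is the Hilbert space adjoint of the maximal ($L^2$, distributional) operator $\overline\partial$ on $\Omega$. For a real function $r$, smooth near $\overline\Omega$, and $(0,q)$-forms $v,u$ put $$H_{r,q}(v,\overline u)=\sum_{|K|=q-1}^{\prime}\ \sum_{j,k=1}^n\frac{\partial^2 r}{\partial z_j\partial\overline{z_k}}\,v_{jK}\,\overline{u_{kK}}.$$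 For a family $\{\rho_\varepsilon\}_{\varepsilon>0}$ of defining functions for $\Omega$ consider the following conditions. (i) $1/C<|\nabla\rho_\varepsilon|<C$ on $b\Omega$, for all $\varepsilon>0$. (ii) For every $\varepsilon>0$ there is a constant $C_\varepsilon$ such that for all $u\in C^\infty_{(0,q)}(\overline\Omega)\cap\mathrm{dom}(\overline\partial^*)$ $$\Big\|\sum_{|K|=q-1}^{\prime}\Big(\sum_{j,k=1}^n\frac{\partial^2\rho_\varepsilon}{\partial z_j\partial\overline{z_k}}\frac{\partial\rho}{\partial\overline{z_j}}\overline{u_{kK}}\Big)d\overline{z_K}\Big\|^2\le\varepsilon\big(\|\overline\partial u\|^2+\|\overline\partial^*u\|^2\big)+C_\varepsilon\|u\|_{-1}^2 .$$ (iii) For every $\varepsilon>0$ there is a constant $\widetilde C_\varepsilon$ such that for all $u\in C^\infty_{(0,q)}(\overline\Omega)\cap\mathrm{dom}(\overline\partial^*)$ $$\sup_{\beta\in C^\infty_{(0,q-1)}(\overline\Omega),\ \|\beta\|\le1}\Big|\int_\Omega H_{\rho_\varepsilon,q}(\overline\partial\rho\wedge\beta,\overline u)\Big|^2\le\varepsilon\big(\|\overline\partial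 u\|^2+\|\overline\partial^*u\|^2\big)+\widetilde C_\varepsilon\|u\|_{-1}^2 .$$ Then, modulo rescaling, a family $\{\rho_\varepsilon\}$ satisfies (i) and (ii) if and only if it satisfies (i) and (iii). Precisely, there is a constant $c>0$ such that for every family $\{\rho_\varepsilon\}_{\varepsilon>0}$ of defining functions for $\Omega$: if $\{\rho_\varepsilon\}$ satisfies (i) and (ii), then the rescaled family $\{\rho_{c\varepsilon}\}_{\varepsilon>0}$ satisfies (i) and (iii) (with the same $C$); and if $\{\rho_\varepsilon\}$ satisfies (i) and (iii), then $\{\rho_{c\varepsilon}\}_{\varepsilon>0}$ satisfies (i) and (ii). -/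

import Mathlib

open scoped ContDiff ComplexConjugate

noncomputable section

namespace DbarNeumann

/-- The space `ℂⁿ`, carrying Lebesgue measure as `volume`. -/
abbrev Cn (n : ℕ) : Type := Fin n → ℂ

/-- The real partial derivative `∂f/∂x_j`, where `z_j = x_j + i y_j`. -/
def dx {n : ℕ} {F : Type*} [NormedAddCommGroup F] [NormedSpace ℝ F]
    (j : Fin n) (f : Cn n → F) (z : Cn n) : F :=
  fderiv ℝ f z (Pi.single j 1)

/-- The real partial derivative `∂f/∂y_j`, where `z_j = x_j + i y_j`. -/
def dy {n : ℕ} {F : Type*} [NormedAddCommGroup F] [NormedSpace ℝ F]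
    (j : Fin n) (f : Cn n → F) (z : Cn n) : F :=
  fderiv ℝ f z (Pi.single j Complex.I)

/-- The Wirtinger derivative `∂f/∂z_j = (∂f/∂x_j - i ∂f/∂y_j) / 2`. -/
def dz {n : ℕ} (j : Fin n) (f : Cn n → ℂ) (z : Cn n) : ℂ :=
  (1 / 2) * (dx j f z - Complex.I * dy j f z)

/-- The Wirtinger derivative `∂f/∂z̄_j = (∂f/∂x_j + i ∂f/∂y_j) / 2`. -/
def dzbar {n : ℕ} (j : Fin n) (f : Cn n → ℂ) (z : Cn n) : ℂ :=
  (1 / 2) * (dx j f z + Complex.I * dy j f z)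

/-- A real function viewed as a complex-valued one. -/
def toC {n : ℕ} (ρ : Cn n → ℝ) : Cn n → ℂ := fun z => (ρ z : ℂ)

/-- The entry `∂²ρ/∂z_j∂z̄_k` of the complex Hessian. -/
def hess {n : ℕ} (ρ : Cn n → ℝ) (j k : Fin n) (z : Cn n) : ℂ :=
  dz j (dzbar k (toC ρ)) z

/-- The Euclidean length `|∇ρ|` of the real gradient. -/
def gradNorm {n : ℕ} (ρ : Cn n → ℝ) (z : Cn n) : ℝ :=
  Real.sqrt (∑ j, ((dx j ρ z) ^ 2 + (dy j ρ z) ^ 2))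

/-! ### Domains -/

/-- `ρ` is a (smooth) defining function for `Ω`: it is smooth on an open neighbourhood `U` of the
closure, `Ω` is the part of `U` where `ρ < 0`, and the gradient does not vanish on the boundary. -/
def IsDefiningFunction {n : ℕ} (Ω : Set (Cn n)) (ρ : Cn n → ℝ) : Prop :=
  ∃ U : Set (Cn n), IsOpen U ∧ closure Ω ⊆ U ∧ ContDiffOn ℝ ∞ ρ U ∧
    Ω = {z ∈ U | ρ z < 0} ∧ ∀ z ∈ frontier Ω, gradNorm ρ z ≠ 0

/-- The Levi form of `ρ` is positive semidefinite on the complex tangent space at every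
boundary point of `Ω`. -/
def LeviNonneg {n : ℕ} (Ω : Set (Cn n)) (ρ : Cn n → ℝ) : Prop :=
  ∀ z ∈ frontier Ω, ∀ w : Fin n → ℂ, ∑ j, dz j (toC ρ) z * w j = 0 →
    0 ≤ (∑ j, ∑ k, hess ρ j k z * w j * conj (w k)).re

/-- A smooth bounded pseudoconvex domain in `ℂⁿ`. (If one defining function has nonnegative Levi
form, then so has every other one.) -/
structure IsSmoothBddPseudoconvexDomain {n : ℕ} (Ω : Set (Cn n)) : Prop where
  isOpen : IsOpen Ω
  connected : IsConnected Ω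
  bounded : Bornology.IsBounded Ω
  smooth : ∃ r : Cn n → ℝ, IsDefiningFunction Ω r
  pseudoconvex : ∀ r : Cn n → ℝ, IsDefiningFunction Ω r → LeviNonneg Ω r

/-! ### Forms of type `(0,q)` -/

/-- Coefficients `u_J`, for all `q`-tuples `J` of indices. -/
abbrev Coeffs (n q : ℕ) : Type := (Fin q → Fin n) → Cn n → ℂ

/-- The coefficients are skew-symmetric in the indices, so that `u` is the `(0,q)`-form
`∑' u_J dz̄_J`, the sum being over increasing tuples. -/
def IsForm {n q : ℕ} (u : Coeffs n q) : Prop :=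
  ∀ (σ : Equiv.Perm (Fin q)) (J : Fin q → Fin n) (z : Cn n),
    u (J ∘ σ) z = ((Equiv.Perm.sign σ : ℤ) : ℂ) * u J z

open Classical in
/-- The increasing `q`-tuples. -/
def incr (n q : ℕ) : Finset (Fin q → Fin n) := Finset.univ.filter (fun J => StrictMono J)

/-- The coefficient tuple `jK`. -/
def consIdx {n m : ℕ} (j : Fin n) (K : Fin m → Fin n) : Fin (m + 1) → Fin n := Fin.cons j K

/-- The tuple `J` with its entry in position `s` omitted. -/
def dropIdx {n q : ℕ} (J : Fin (q + 1) → Fin n) (s : Fin (q + 1)) : Fin q → Fin n :=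
  fun i => J (s.succAbove i)

/-- `f ∈ C^∞(Ω̄)`: on the closure of `Ω`, `f` agrees with a smooth function on `ℂⁿ`. -/
def SmoothUpTo {n : ℕ} (Ω : Set (Cn n)) (f : Cn n → ℂ) : Prop :=
  ∃ g : Cn n → ℂ, ContDiff ℝ ∞ g ∧ Set.EqOn f g (closure Ω)

/-- `u ∈ C^∞_{(0,q)}(Ω̄)`. -/
def IsSmoothForm {n q : ℕ} (Ω : Set (Cn n)) (u : Coeffs n q) : Prop :=
  IsForm u ∧ ∀ J, SmoothUpTo Ω (u J)

/-- `u ∈ L²_{(0,q)}(Ω)`. -/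
def IsL2Form {n q : ℕ} (Ω : Set (Cn n)) (u : Coeffs n q) : Prop :=
  IsForm u ∧ ∀ J, MeasureTheory.MemLp (u J) 2 (MeasureTheory.volume.restrict Ω)

/-- The squared `L²` norm `‖u‖²`. -/
def normSq {n q : ℕ} (Ω : Set (Cn n)) (u : Coeffs n q) : ℝ :=
  ∑ J ∈ incr n q, ∫ z in Ω, ‖u J z‖ ^ 2

/-- The `L²` inner product `(u, v)`. -/
def innerL2 {n q : ℕ} (Ω : Set (Cn n)) (u v : Coeffs n q) : ℂ :=
  ∑ J ∈ incr n q, ∫ z in Ω, u J z * conj (v J z)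

/-- Smooth functions with compact support in `Ω`. -/
def IsTest {n : ℕ} (Ω : Set (Cn n)) (φ : Cn n → ℂ) : Prop :=
  ContDiff ℝ ∞ φ ∧ HasCompactSupport φ ∧ tsupport φ ⊆ Ω

/-- The squared Sobolev norm `‖φ‖₁²` of a function. -/
def sobOneSq {n : ℕ} (Ω : Set (Cn n)) (φ : Cn n → ℂ) : ℝ :=
  (∫ z in Ω, ‖φ z‖ ^ 2) +
    ∑ j, ((∫ z in Ω, ‖dx j φ z‖ ^ 2) + ∫ z in Ω, ‖dy j φ z‖ ^ 2)

/-- The norm of a square integrable function in `W^{-1}(Ω)`, the dual space of `W^1_0(Ω)`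
(the test functions are dense in the latter). -/
def sobNegOne {n : ℕ} (Ω : Set (Cn n)) (f : Cn n → ℂ) : ℝ :=
  sSup {r : ℝ | ∃ φ : Cn n → ℂ, IsTest Ω φ ∧ sobOneSq Ω φ ≤ 1 ∧ r = ‖∫ z in Ω, f z * φ z‖}

/-- The squared norm `‖u‖²_{-1}` of a form in `W^{-1}_{(0,q)}(Ω)`. -/
def negOneSq {n q : ℕ} (Ω : Set (Cn n)) (u : Coeffs n q) : ℝ :=
  ∑ J ∈ incr n q, (sobNegOne Ω (u J)) ^ 2

/-! ### The operators `∂̄` and `∂̄*` -/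

/-- The coefficients of `∂̄u`, for a differentiable form `u`. -/
def dbar {n q : ℕ} (u : Coeffs n q) : Coeffs n (q + 1) :=
  fun J z => ∑ s : Fin (q + 1), (-1) ^ (s : ℕ) * dzbar (J s) (u (dropIdx J s)) z

/-- `v ∈ dom(∂̄)` and `∂̄v = f`: both forms are square integrable, and `∂̄v = f` on `Ω` in the sense
of distributions. -/
def HasWeakDbar {n q : ℕ} (Ω : Set (Cn n)) (v : Coeffs n q) (f : Coeffs n (q + 1)) : Prop :=
  IsL2Form Ω v ∧ IsL2Form Ω f ∧
    ∀ J : Fin (q + 1) → Fin n, ∀ φ : Cn n → ℂ, IsTest Ω φ →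
      ∫ z in Ω, ∑ s : Fin (q + 1), (-1) ^ (s : ℕ) * v (dropIdx J s) z * dzbar (J s) φ z =
        - ∫ z in Ω, f J z * φ z

/-- `u ∈ dom(∂̄*)` and `∂̄*u = g`, where `∂̄*` is the Hilbert space adjoint of the (maximally
defined) operator `∂̄` from `L²_{(0,q)}(Ω)` to `L²_{(0,q+1)}(Ω)`. -/
def HasDbarStar {n q : ℕ} (Ω : Set (Cn n)) (u : Coeffs n (q + 1)) (g : Coeffs n q) : Prop :=
  IsL2Form Ω u ∧ IsL2Form Ω g ∧
    ∀ (v : Coeffs n q) (f : Coeffs n (q + 1)), HasWeakDbar Ω v f →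
      innerL2 Ω u f = innerL2 Ω g v

/-! ### The conditions -/

/-- The coefficients of `∂̄ρ ∧ β`. -/
def dbarWedge {n q : ℕ} (ρ : Cn n → ℝ) (β : Coeffs n q) : Coeffs n (q + 1) :=
  fun J z => ∑ s : Fin (q + 1), (-1) ^ (s : ℕ) * dzbar (J s) (toC ρ) z * β (dropIdx J s) z

/-- The sesquilinear form `H_{r,m+1}(v, ū)` on `(0,m+1)`-forms, at the point `z`. -/
def Hform {n m : ℕ} (r : Cn n → ℝ) (v u : Coeffs n (m + 1)) (z : Cn n) : ℂ :=
  ∑ K ∈ incr n m, ∑ j, ∑ k, hess r j k z * v (consIdx j K) z * conj (u (consIdx k K) z)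

/-- The coefficients of the `(0,m)`-form
`∑'_K (∑_{j,k} ∂²r/∂z_j∂z̄_k · ∂ρ/∂z̄_j · conj u_{kK}) dz̄_K`. -/
def mixedForm {n m : ℕ} (ρ r : Cn n → ℝ) (u : Coeffs n (m + 1)) : Coeffs n m :=
  fun K z => ∑ j, ∑ k, hess r j k z * dzbar j (toC ρ) z * conj (u (consIdx k K) z)

/-- The gradient of `r` is pinched between `1/C` and `C` on the boundary. -/
def CondI {n : ℕ} (Ω : Set (Cn n)) (C : ℝ) (r : Cn n → ℝ) : Prop :=
  ∀ z ∈ frontier Ω, 1 / C < gradNorm r z ∧ gradNorm r z < C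

/-- The estimate for `‖mixedForm‖²`, on `(0,m+1)`-forms, with the factor `ε`. -/
def CondII {n : ℕ} (Ω : Set (Cn n)) (ρ : Cn n → ℝ) (m : ℕ) (ε : ℝ) (r : Cn n → ℝ) : Prop :=
  ∃ Cε : ℝ, ∀ (u : Coeffs n (m + 1)) (g : Coeffs n m), IsSmoothForm Ω u → HasDbarStar Ω u g →
    normSq Ω (mixedForm ρ r u) ≤ ε * (normSq Ω (dbar u) + normSq Ω g) + Cε * negOneSq Ω u

/-- The estimate for `sup_β |∫ H_{r,m+1}(∂̄ρ ∧ β, ū)|²`, on `(0,m+1)`-forms, with the factor `ε`.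
The supremum is taken in the extended reals, over the smooth `(0,m)`-forms with `‖β‖ ≤ 1`. -/
def CondIII {n : ℕ} (Ω : Set (Cn n)) (ρ : Cn n → ℝ) (m : ℕ) (ε : ℝ) (r : Cn n → ℝ) : Prop :=
  ∃ Cε : ℝ, ∀ (u : Coeffs n (m + 1)) (g : Coeffs n m), IsSmoothForm Ω u → HasDbarStar Ω u g →
    (⨆ β : {β : Coeffs n m // IsSmoothForm Ω β ∧ normSq Ω β ≤ 1},
      ((‖∫ z in Ω, Hform r (dbarWedge ρ β.1) u z‖ ^ 2 : ℝ) : EReal)) ≤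
    ((ε * (normSq Ω (dbar u) + normSq Ω g) + Cε * negOneSq Ω u : ℝ) : EReal)

end DbarNeumann

end

noncomputable section

namespace DbarNeumann

/-! ### Skew-symmetric coefficient families -/

/-! Write `Q(u) = ‖∂̄u‖² + ‖∂̄*u‖²`. Expanding the wedge product gives `(∂̄ρ ∧ β)_{jK} = (∂ρ/∂z̄_j)
β_K - (∂̄ρ ∧ β_{j·})_K`. Paired with `u` through the complex Hessian, the first term is exactly the
pairing of the form in (ii) with `β`. In the second term `∂̄ρ ∧` is moved to the other side, where
it becomes contraction with `∂ρ`; what remains involves only the normal part `N_K = ∑_l (∂ρ/∂z_l)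
u_{lK}` (`Hform_eq_mixedPairing_add`; for `q = 1` there is no second term). The supremum of the
first pairing over `‖β‖ ≤ 1` is the norm in (ii), so (ii) and (iii) differ by an error bounded by a
constant times `‖N‖²`. That constant depends on the Hessian of `ρ_ε` and may blow up, so what is
needed is a compactness estimate `‖N‖² ≤ δ Q(u) + C_δ ‖u‖_{-1}²` for every `δ > 0`
(`exists_normalPart_estimate`).

For `u` in the domain of `∂̄*`, `N` vanishes on the boundary (`normalPart_eq_zero`). Write `‖N_K‖²`
as a sum of integrals of `u_{lK}` against `f = (∂ρ/∂z_l) conj N_K`. As `f` vanishes on the boundary,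
each integral is at most a constant times `‖u_{lK}‖_{-1} ‖f‖_1` (`exists_norm_integral_mul_le`).
Vanishing on the boundary also makes the `L²` norms of `∂f` and `∂̄f` equal
(`sum_integral_dz_eq_dzbar`), so only `∂f` matters. Because of the conjugate on `N`, `∂f` sees only
barred derivatives of `u`, and on a pseudoconvex domain these are bounded by `Q(u)`
(`exists_basic_estimate`, a Morrey-Kohn-Hörmander identity with multiplier `A - |z|²`).

No surface measure is used. Boundary integrals are replaced by averages over thin strips `-κρ ∈ [1,
2]`, which suffices to turn a sign on the boundary into a sign of the integrated divergence
(`integral_div_nonneg`).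

Each implication uses `|a|² ≤ 2|b|² + 2|a - b|²` once, with `ε/4` spent on each of the two terms;
this gives `c = 1/4`. Algebra on forms is done with sums over all tuples, which are `q!` times the
sums over increasing ones. -/

/-- Skew-symmetry of a family of numbers indexed by tuples. -/
def Skew {n q : ℕ} (U : (Fin q → Fin n) → ℂ) : Prop :=
  ∀ (σ : Equiv.Perm (Fin q)) (J : Fin q → Fin n),
    U (J ∘ σ) = ((Equiv.Perm.sign σ : ℤ) : ℂ) * U J

theorem IsForm.skew {n q : ℕ} {u : Coeffs n q} (hu : IsForm u) (z : Cn n) :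
    Skew (fun J => u J z) := fun σ J => hu σ J z

theorem isForm_of_skew {n q : ℕ} {u : Coeffs n q} (hu : ∀ z, Skew (fun J => u J z)) :
    IsForm u := fun σ J z => hu z σ J

theorem Skew.eq_zero {n q : ℕ} {U : (Fin q → Fin n) → ℂ} (hU : Skew U) {J : Fin q → Fin n}
    (hJ : ¬ Function.Injective J) : U J = 0 := by
  simp only [Function.Injective, not_forall] at hJ
  obtain ⟨a, b, hab, hne⟩ := hJ
  have h := hU (Equiv.swap a b) J
  have hc : J ∘ (Equiv.swap a b) = J := by
    funext i
    simp only [Function.comp_apply, Equiv.swap_apply_def]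
    split_ifs with h1 h2
    · rw [h1, hab]
    · rw [h2, hab]
    · rfl
  rw [hc, Equiv.Perm.sign_swap hne] at h
  push_cast at h
  linear_combination h / 2

theorem norm_sign {q : ℕ} (σ : Equiv.Perm (Fin q)) :
    ‖((Equiv.Perm.sign σ : ℤ) : ℂ)‖ = 1 := by
  rcases Int.units_eq_one_or (Equiv.Perm.sign σ) with h | h <;> simp [h]

theorem consIdx_dropIdx_comp {n q : ℕ} (J : Fin (q + 1) → Fin n) (s : Fin (q + 1)) :
    consIdx (J s) (dropIdx J s) ∘ (Fin.cycleRange s) = J := by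
  funext i
  refine Fin.succAboveCases s ?_ (fun j => ?_) i
  · simp [consIdx]
  · simp [consIdx, dropIdx, Fin.cycleRange_succAbove]

/-- The cycle that brings position `s` to the front has sign `(-1)^s`. -/
theorem Skew.eq_consIdx_dropIdx {n q : ℕ} {U : (Fin (q + 1) → Fin n) → ℂ} (hU : Skew U)
    (J : Fin (q + 1) → Fin n) (s : Fin (q + 1)) :
    U J = (-1) ^ (s : ℕ) * U (consIdx (J s) (dropIdx J s)) := by
  have h := hU (Fin.cycleRange s) (consIdx (J s) (dropIdx J s))
  rw [consIdx_dropIdx_comp, Fin.sign_cycleRange] at h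
  simpa using h

theorem Skew.consIdx {n q : ℕ} {U : (Fin (q + 1) → Fin n) → ℂ} (hU : Skew U) (j : Fin n) :
    Skew (fun K => U (consIdx j K)) := by
  intro σ K
  -- The permutation of `Fin (q + 1)` that fixes `0` and acts as `σ` on the tail has the sign of
  -- `σ`.
  have h := hU (Equiv.Perm.decomposeFin.symm (0, σ)) (DbarNeumann.consIdx j K)
  have hc : DbarNeumann.consIdx j K ∘ (Equiv.Perm.decomposeFin.symm (0, σ)) =
      DbarNeumann.consIdx j (K ∘ σ) := by
    funext i
    refine Fin.cases ?_ (fun i => ?_) i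
    · simp [DbarNeumann.consIdx]
    · simp [DbarNeumann.consIdx]
  rw [hc, Equiv.Perm.decomposeFin.symm_sign] at h
  simpa using h

theorem sum_dropIdx {n q : ℕ} {M : Type*} [AddCommMonoid M]
    (F : Fin n → (Fin q → Fin n) → M) (s : Fin (q + 1)) :
    ∑ J : Fin (q + 1) → Fin n, F (J s) (dropIdx J s) = ∑ j, ∑ L, F j L := by
  rw [← Finset.sum_product', Finset.univ_product_univ]
  refine (Fintype.sum_equiv (Fin.insertNthEquiv (fun _ => Fin n) s) _ _ ?_).symm
  rintro ⟨j, L⟩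
  have hd : dropIdx (s.insertNth j L : Fin (q + 1) → Fin n) s = L := by
    funext i
    simp [dropIdx]
  simp [Fin.insertNthEquiv, hd]

theorem sum_consIdx {n q : ℕ} {M : Type*} [AddCommMonoid M] (F : (Fin (q + 1) → Fin n) → M) :
    ∑ J : Fin (q + 1) → Fin n, F J = ∑ j, ∑ L, F (consIdx j L) := by
  rw [← sum_dropIdx (fun j L => F (consIdx j L)) 0]
  refine Finset.sum_congr rfl fun J _ => ?_
  congr 1
  have := consIdx_dropIdx_comp J 0
  simpa [Fin.cycleRange_zero] using this.symm

/-- The coefficients of `∑_j dz̄_j ∧ G_j`. -/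
def wedge {n q : ℕ} (G : Fin n → (Fin q → Fin n) → ℂ) (J : Fin (q + 1) → Fin n) : ℂ :=
  ∑ s : Fin (q + 1), (-1) ^ (s : ℕ) * G (J s) (dropIdx J s)

/-- Adjointness of wedging and contraction. Bringing entry `s` of `U` to the front costs `(-1)^s`,
which cancels the sign in `wedge`, so all `q + 1` positions contribute the same sum. -/
theorem sum_skew_mul_wedge {n q : ℕ} {U : (Fin (q + 1) → Fin n) → ℂ} (hU : Skew U)
    (G : Fin n → (Fin q → Fin n) → ℂ) :
    ∑ J, U J * wedge G J = (q + 1) * ∑ j, ∑ L, U (consIdx j L) * G j L := by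
  have h : ∀ s : Fin (q + 1), ∑ J, U J * ((-1) ^ (s : ℕ) * G (J s) (dropIdx J s)) =
      ∑ j, ∑ L, U (consIdx j L) * G j L := by
    intro s
    rw [← sum_dropIdx (fun j L => U (consIdx j L) * G j L) s]
    refine Finset.sum_congr rfl fun J _ => ?_
    conv_lhs => rw [hU.eq_consIdx_dropIdx J s]
    have : ((-1 : ℂ) ^ (s : ℕ)) * (-1) ^ (s : ℕ) = 1 := by
      rw [← mul_pow]; simp
    linear_combination (U (consIdx (J s) (dropIdx J s)) * G (J s) (dropIdx J s)) * this
  simp only [wedge, Finset.mul_sum]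
  rw [Finset.sum_comm]
  simp only [h, Finset.sum_const, Finset.card_univ, Fintype.card_fin, nsmul_eq_mul, ← Finset.mul_sum]
  push_cast
  ring

/-- Deleting position `t` from the source and `σ t` from the target leaves a permutation `τ` of the
remaining entries. This is the sign bookkeeping behind the skew-symmetry of `wedge`. -/
theorem exists_perm_succAbove {q : ℕ} (σ : Equiv.Perm (Fin (q + 1))) (t : Fin (q + 1)) :
    ∃ τ : Equiv.Perm (Fin q), (∀ i, σ (t.succAbove i) = (σ t).succAbove (τ i)) ∧
      ((Equiv.Perm.sign σ : ℤ) : ℂ) * (-1) ^ ((σ t : Fin (q + 1)) : ℕ) =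
        (-1) ^ (t : ℕ) * ((Equiv.Perm.sign τ : ℤ) : ℂ) := by
  -- Composing with the two cycles turns `t ↦ σ t` into `0 ↦ 0`, so `π` comes from a permutation of
  -- the tail.
  set π : Equiv.Perm (Fin (q + 1)) := (Fin.cycleRange (σ t)) * σ * (Fin.cycleRange t)⁻¹ with hπ
  obtain ⟨⟨p, τ⟩, hpτ⟩ := Equiv.Perm.decomposeFin.symm.surjective π
  have h0 : π 0 = 0 := by
    simp [hπ]
  have hp : p = 0 := by
    rw [← hpτ] at h0
    simpa using h0
  subst hp
  refine ⟨τ, fun i => ?_, ?_⟩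
  · have h1 : π i.succ = (τ i).succ := by rw [← hpτ]; simp
    have h2 : (Fin.cycleRange t)⁻¹ i.succ = t.succAbove i := Fin.cycleRange_symm_succ t i
    have h3 : Fin.cycleRange (σ t) (σ (t.succAbove i)) = (τ i).succ := by
      rw [← h1, ← h2]; simp [hπ]
    rw [← Fin.cycleRange_succAbove (σ t) (τ i)] at h3
    exact (Fin.cycleRange (σ t)).injective h3
  · have hs : Equiv.Perm.sign π = Equiv.Perm.sign τ := by
      rw [← hpτ, Equiv.Perm.decomposeFin.symm_sign]; simp
    rw [← hs, hπ]
    simp only [Equiv.Perm.sign_mul, Equiv.Perm.sign_inv, Fin.sign_cycleRange]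
    push_cast
    have : ((-1 : ℂ) ^ (t : ℕ)) * (-1) ^ (t : ℕ) = 1 := by
      rw [← mul_pow]; simp
    linear_combination -(((Equiv.Perm.sign σ : ℤ) : ℂ) * (-1) ^ ((σ t : Fin (q + 1)) : ℕ)) * this

theorem skew_wedge {n q : ℕ} {G : Fin n → (Fin q → Fin n) → ℂ} (hG : ∀ j, Skew (G j)) :
    Skew (wedge G) := by
  intro σ J
  simp only [wedge, Finset.mul_sum]
  rw [← Equiv.sum_comp σ (fun s => ((Equiv.Perm.sign σ : ℤ) : ℂ) *
    ((-1) ^ (s : ℕ) * G (J s) (dropIdx J s)))]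
  refine Finset.sum_congr rfl fun t _ => ?_
  obtain ⟨τ, h1, h2⟩ := exists_perm_succAbove σ t
  have hd : dropIdx (J ∘ σ) t = dropIdx J (σ t) ∘ τ := by
    funext i
    simp [dropIdx, h1]
  rw [hd, hG, Function.comp_apply]
  linear_combination (-G (J (σ t)) (dropIdx J (σ t))) * h2

theorem dropIdx_consIdx_zero {n q : ℕ} (j : Fin n) (L : Fin q → Fin n) :
    dropIdx (consIdx j L) 0 = L := by
  funext i; simp [dropIdx, consIdx]

theorem dropIdx_consIdx_succ {n q : ℕ} (j : Fin n) (L : Fin (q + 1) → Fin n) (t : Fin (q + 1)) :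
    dropIdx (consIdx j L) t.succ = consIdx j (dropIdx L t) := by
  funext i
  refine Fin.cases ?_ (fun i => ?_) i
  · simp [dropIdx, consIdx]
  · simp [dropIdx, consIdx]

/-- The term `s = 0` removes `j` itself; every later term keeps `j` in front and has its position
shifted by one, hence the minus sign. -/
theorem wedge_consIdx {n q : ℕ} (G : Fin n → (Fin (q + 1) → Fin n) → ℂ) (j : Fin n)
    (L : Fin (q + 1) → Fin n) :
    wedge G (consIdx j L) = G j L - wedge (fun k K => G k (consIdx j K)) L := by
  rw [wedge, Fin.sum_univ_succ, dropIdx_consIdx_zero, wedge, sub_eq_add_neg, ← Finset.sum_neg_distrib]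
  congr 1
  · simp [consIdx]
  · refine Finset.sum_congr rfl fun t _ => ?_
    rw [dropIdx_consIdx_succ]
    simp only [Fin.val_succ, consIdx, Fin.cons_succ]
    ring

theorem wedge_zero {n : ℕ} (G : Fin n → (Fin 0 → Fin n) → ℂ) (j : Fin n) (L : Fin 0 → Fin n) :
    wedge G (consIdx j L) = G j L := by
  rw [wedge, Fin.sum_univ_one, dropIdx_consIdx_zero]
  simp [consIdx]

theorem conj_wedge {n q : ℕ} (G : Fin n → (Fin q → Fin n) → ℂ) (J : Fin (q + 1) → Fin n) :
    conj (wedge G J) = wedge (fun j L => conj (G j L)) J := by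
  simp [wedge, map_sum]

theorem Skew.conj {n q : ℕ} {U : (Fin q → Fin n) → ℂ} (hU : Skew U) :
    Skew (fun J => conj (U J)) := by
  intro σ J
  simp only [hU σ J, map_mul, map_intCast]

/-- Adjointness is used twice: once to unfold one factor, and once more for the part of `wedge D
(consIdx j L)` in which `j` stays in front. With `D j L = ∂u_L/∂z̄_j` this writes `|∂̄u|²` as the
full barred gradient minus the cross terms of the Kohn-Morrey identity. -/
theorem sum_wedge_mul_conj {n m : ℕ} {D : Fin n → (Fin (m + 1) → Fin n) → ℂ}
    (hD : ∀ j, Skew (D j)) :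
    ∑ J, wedge D J * conj (wedge D J) = (m + 2) * (∑ j, ∑ L, D j L * conj (D j L) -
      (m + 1) * ∑ K, ∑ j, ∑ k, D j (consIdx k K) * conj (D k (consIdx j K))) := by
  have h1 : ∑ J, wedge D J * conj (wedge D J) =
      ∑ J, conj (wedge D J) * wedge D J := by simp only [mul_comm]
  rw [h1, sum_skew_mul_wedge (skew_wedge hD).conj]
  have h2 : ∀ j, ∑ L, conj (wedge D (consIdx j L)) * D j L = ∑ L, D j L * conj (D j L) -
      (m + 1) * ∑ k, ∑ K, D j (consIdx k K) * conj (D k (consIdx j K)) := by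
    intro j
    rw [← sum_skew_mul_wedge (hD j) (fun k K => conj (D k (consIdx j K))), ← Finset.sum_sub_distrib]
    refine Finset.sum_congr rfl fun L _ => ?_
    rw [wedge_consIdx, map_sub, conj_wedge]
    ring
  have h3 : ∑ K, ∑ j, ∑ k, D j (consIdx k K) * conj (D k (consIdx j K)) =
      ∑ j, ∑ k, ∑ K, D j (consIdx k K) * conj (D k (consIdx j K)) := by
    rw [Finset.sum_comm]
    exact Finset.sum_congr rfl fun j _ => Finset.sum_comm
  rw [Finset.sum_congr rfl fun j _ => h2 j, h3, Finset.sum_sub_distrib, ← Finset.mul_sum]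
  push_cast
  ring

/-- An injective tuple is, in exactly one way, an increasing tuple followed by a permutation; the
permutation is found by sorting. -/
theorem sum_eq_factorial_sum_incr {n q : ℕ} {M : Type*} [AddCommMonoid M]
    {F : (Fin q → Fin n) → M} (hF : ∀ (σ : Equiv.Perm (Fin q)) J, F (J ∘ σ) = F J)
    (h0 : ∀ J, ¬ Function.Injective J → F J = 0) :
    ∑ J, F J = q.factorial • ∑ J ∈ incr n q, F J := by
  classical
  have h1 : ∑ J, F J = ∑ J with Function.Injective J, F J := by
    rw [Finset.sum_filter]
    refine Finset.sum_congr rfl fun J _ => ?_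
    split_ifs with h
    · rfl
    · exact h0 J h
  have h2 : ∑ p ∈ incr n q ×ˢ (Finset.univ : Finset (Equiv.Perm (Fin q))), F (p.1 ∘ p.2) =
      ∑ J with Function.Injective J, F J := by
    refine Finset.sum_bij (fun p _ => p.1 ∘ p.2) ?_ ?_ ?_ (fun _ _ => rfl)
    · rintro ⟨J, σ⟩ h
      simp only [incr, Finset.mem_product, Finset.mem_filter, Finset.mem_univ, true_and,
        and_true] at h ⊢
      exact h.injective.comp σ.injective
    · rintro ⟨J, σ⟩ h ⟨J', σ'⟩ h' he
      simp only [incr, Finset.mem_product, Finset.mem_filter, Finset.mem_univ, true_and,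
        and_true] at h h' he
      have hJ : J = J' := by
        refine (StrictMono.range_inj h h').1 ?_
        rw [← EquivLike.range_comp J σ, ← EquivLike.range_comp J' σ', he]
      subst hJ
      simp only [Prod.mk.injEq, true_and]
      ext i
      exact congrArg _ (h.injective (congrFun he i))
    · intro J hJ
      simp only [Finset.mem_filter, Finset.mem_univ, true_and] at hJ
      refine ⟨(J ∘ Tuple.sort J, (Tuple.sort J)⁻¹), ?_, ?_⟩
      · simp only [incr, Finset.mem_product, Finset.mem_filter, Finset.mem_univ, true_and, and_true]
        exact (Tuple.monotone_sort J).strictMono_of_injective (hJ.comp (Tuple.sort J).injective)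
      · funext i
        simp
  rw [h1, ← h2, Finset.sum_product]
  simp only [hF, Finset.sum_const, Finset.card_univ, Fintype.card_perm, Fintype.card_fin]
  rw [← Finset.sum_nsmul]

/-! ### Wirtinger calculus -/

section Wirtinger

variable {n : ℕ} {f g : Cn n → ℂ} {z : Cn n} (j k : Fin n)

theorem dz_congr (h : f =ᶠ[nhds z] g) : dz j f z = dz j g z := by
  simp only [dz, dx, dy, h.fderiv_eq]

theorem dzbar_congr (h : f =ᶠ[nhds z] g) : dzbar j f z = dzbar j g z := by
  simp only [dzbar, dx, dy, h.fderiv_eq]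

theorem dz_const (c : ℂ) : dz j (fun _ => c) z = 0 := by
  simp [dz, dx, dy]

theorem dzbar_const (c : ℂ) : dzbar j (fun _ => c) z = 0 := by
  simp [dzbar, dx, dy]

theorem dz_add (hf : DifferentiableAt ℝ f z) (hg : DifferentiableAt ℝ g z) :
    dz j (fun w => f w + g w) z = dz j f z + dz j g z := by
  simp only [dz, dx, dy, fderiv_fun_add hf hg, add_apply]; ring

theorem dzbar_add (hf : DifferentiableAt ℝ f z) (hg : DifferentiableAt ℝ g z) :
    dzbar j (fun w => f w + g w) z = dzbar j f z + dzbar j g z := by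
  simp only [dzbar, dx, dy, fderiv_fun_add hf hg, add_apply]; ring

theorem dz_neg : dz j (fun w => - f w) z = - dz j f z := by
  simp only [dz, dx, dy, fderiv_fun_neg, neg_apply]; ring

theorem dzbar_neg : dzbar j (fun w => - f w) z = - dzbar j f z := by
  simp only [dzbar, dx, dy, fderiv_fun_neg, neg_apply]; ring

theorem dz_sub (hf : DifferentiableAt ℝ f z) (hg : DifferentiableAt ℝ g z) :
    dz j (fun w => f w - g w) z = dz j f z - dz j g z := by
  simp only [dz, dx, dy, fderiv_fun_sub hf hg, sub_apply]; ring

theorem dzbar_sub (hf : DifferentiableAt ℝ f z) (hg : DifferentiableAt ℝ g z) :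
    dzbar j (fun w => f w - g w) z = dzbar j f z - dzbar j g z := by
  simp only [dzbar, dx, dy, fderiv_fun_sub hf hg, sub_apply]; ring

theorem dz_mul (hf : DifferentiableAt ℝ f z) (hg : DifferentiableAt ℝ g z) :
    dz j (fun w => f w * g w) z = dz j f z * g z + f z * dz j g z := by
  simp only [dz, dx, dy, fderiv_fun_mul hf hg, add_apply,
    smul_apply, smul_eq_mul]; ring

theorem dzbar_mul (hf : DifferentiableAt ℝ f z) (hg : DifferentiableAt ℝ g z) :
    dzbar j (fun w => f w * g w) z = dzbar j f z * g z + f z * dzbar j g z := by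
  simp only [dzbar, dx, dy, fderiv_fun_mul hf hg, add_apply,
    smul_apply, smul_eq_mul]; ring

theorem dz_sum {ι : Type*} (s : Finset ι) {F : ι → Cn n → ℂ}
    (hF : ∀ i ∈ s, DifferentiableAt ℝ (F i) z) :
    dz j (fun w => ∑ i ∈ s, F i w) z = ∑ i ∈ s, dz j (F i) z := by
  simp only [dz, dx, dy, fderiv_fun_sum hF, sum_apply]
  rw [Finset.mul_sum, ← Finset.sum_sub_distrib, Finset.mul_sum]

theorem dzbar_sum {ι : Type*} (s : Finset ι) {F : ι → Cn n → ℂ}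
    (hF : ∀ i ∈ s, DifferentiableAt ℝ (F i) z) :
    dzbar j (fun w => ∑ i ∈ s, F i w) z = ∑ i ∈ s, dzbar j (F i) z := by
  simp only [dzbar, dx, dy, fderiv_fun_sum hF, sum_apply]
  rw [Finset.mul_sum, ← Finset.sum_add_distrib, Finset.mul_sum]

theorem conj_half : conj (1 / 2 : ℂ) = 1 / 2 := by
  rw [map_div₀, map_one, map_ofNat]

theorem fderiv_conj (hf : DifferentiableAt ℝ f z) (v : Cn n) :
    fderiv ℝ (fun w => conj (f w)) z v = conj (fderiv ℝ f z v) := by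
  have h := (Complex.conjCLE.toContinuousLinearMap.hasFDerivAt (x := f z)).comp z hf.hasFDerivAt
  have h2 : HasFDerivAt (fun w => conj (f w))
    (Complex.conjCLE.toContinuousLinearMap.comp (fderiv ℝ f z)) z := h
  rw [h2.fderiv]
  simp

theorem dz_conj (hf : DifferentiableAt ℝ f z) :
    dz j (fun w => conj (f w)) z = conj (dzbar j f z) := by
  simp only [dz, dzbar, dx, dy, fderiv_conj hf, map_mul, map_add, Complex.conj_I, conj_half]
  ring

theorem dzbar_conj (hf : DifferentiableAt ℝ f z) :
    dzbar j (fun w => conj (f w)) z = conj (dz j f z) := by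
  simp only [dz, dzbar, dx, dy, fderiv_conj hf, map_mul, map_sub, Complex.conj_I, conj_half]
  ring

theorem fderiv_coord (i : Fin n) (v : Cn n) : fderiv ℝ (fun w : Cn n => w i) z v = v i := by
  have h : HasFDerivAt (fun w : Cn n => w i)
    (ContinuousLinearMap.proj (R := ℝ) (φ := fun _ : Fin n => ℂ) i) z :=
    (ContinuousLinearMap.proj (R := ℝ) (φ := fun _ : Fin n => ℂ) i).hasFDerivAt
  rw [h.fderiv]; rfl

theorem dz_coord : dz j (fun w : Cn n => w k) z = if k = j then 1 else 0 := by
  simp only [dz, dx, dy, fderiv_coord, Pi.single_apply]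
  split_ifs
  · rw [Complex.I_mul_I]; norm_num
  · simp

theorem dzbar_coord : dzbar j (fun w : Cn n => w k) z = 0 := by
  simp only [dzbar, dx, dy, fderiv_coord, Pi.single_apply]
  split_ifs
  · rw [Complex.I_mul_I]; norm_num
  · simp

theorem ContDiff.differentiableAt_of_smooth {E F : Type*} [NormedAddCommGroup E] [NormedSpace ℝ E]
    [NormedAddCommGroup F] [NormedSpace ℝ F] {h : E → F} (hh : ContDiff ℝ ∞ h) (x : E) :
    DifferentiableAt ℝ h x := (hh.differentiable (by simp)) x

theorem contDiff_fderiv_apply {F : Type*} [NormedAddCommGroup F] [NormedSpace ℝ F] {f : Cn n → F}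
    (hf : ContDiff ℝ ∞ f) (v : Cn n) :
    ContDiff ℝ ∞ (fun w => fderiv ℝ f w v) :=
  (hf.fderiv_right (m := ∞) (by simp)).clm_apply contDiff_const

theorem contDiff_dz (hf : ContDiff ℝ ∞ f) : ContDiff ℝ ∞ (dz j f) := by
  have h1 := contDiff_fderiv_apply hf (Pi.single j 1)
  have h2 := contDiff_fderiv_apply hf (Pi.single j Complex.I)
  exact contDiff_const.mul (h1.sub (contDiff_const.mul h2))

theorem contDiff_dzbar (hf : ContDiff ℝ ∞ f) : ContDiff ℝ ∞ (dzbar j f) := by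
  have h1 := contDiff_fderiv_apply hf (Pi.single j 1)
  have h2 := contDiff_fderiv_apply hf (Pi.single j Complex.I)
  exact contDiff_const.mul (h1.add (contDiff_const.mul h2))

theorem contDiff_conj (hf : ContDiff ℝ ∞ f) : ContDiff ℝ ∞ (fun w => conj (f w)) :=
  Complex.conjCLE.contDiff.comp hf

theorem contDiff_toC {ρ : Cn n → ℝ} (h : ContDiff ℝ ∞ ρ) : ContDiff ℝ ∞ (toC ρ) :=
  Complex.ofRealCLM.contDiff.comp h

theorem contDiff_coord (i : Fin n) : ContDiff ℝ ∞ (fun w : Cn n => w i) :=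
  contDiff_apply ℝ ℂ i

theorem contDiff_hess {ρ : Cn n → ℝ} (h : ContDiff ℝ ∞ ρ) : ContDiff ℝ ∞ (hess ρ j k) :=
  contDiff_dz _ (contDiff_dzbar _ (contDiff_toC h))

theorem fderiv_fderiv_apply (hf : ContDiff ℝ ∞ f) (v w : Cn n) :
    fderiv ℝ (fun y => fderiv ℝ f y v) z w = fderiv ℝ (fderiv ℝ f) z w v := by
  have h1 : DifferentiableAt ℝ (fderiv ℝ f) z :=
    ContDiff.differentiableAt_of_smooth (hf.fderiv_right (m := ∞) (by simp)) z
  have h2 : HasFDerivAt (fun y => fderiv ℝ f y v)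
      ((ContinuousLinearMap.apply ℝ ℂ v).comp (fderiv ℝ (fderiv ℝ f) z)) z :=
    ((ContinuousLinearMap.apply ℝ ℂ v).hasFDerivAt).comp z h1.hasFDerivAt
  rw [h2.fderiv]; rfl

theorem dz_dzbar_comm (hf : ContDiff ℝ ∞ f) : dz j (dzbar k f) z = dzbar k (dz j f) z := by
  have hs : IsSymmSndFDerivAt ℝ f z := by
    refine hf.contDiffAt.isSymmSndFDerivAt ?_
    rw [minSmoothness_of_isRCLikeNormedField]
    exact WithTop.coe_le_coe.2 le_top
  have hd : ∀ v : Cn n, DifferentiableAt ℝ (fun y => fderiv ℝ f y v) z := fun v =>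
    ContDiff.differentiableAt_of_smooth (contDiff_fderiv_apply hf v) z
  have key1 : ∀ w, fderiv ℝ (dzbar k f) z w = (1 / 2) * (fderiv ℝ (fderiv ℝ f) z w (Pi.single k 1)
      + Complex.I * fderiv ℝ (fderiv ℝ f) z w (Pi.single k Complex.I)) := by
    intro w
    have h : HasFDerivAt (dzbar k f) _ z := (((hd (Pi.single k 1)).hasFDerivAt.add
      ((hd (Pi.single k Complex.I)).hasFDerivAt.const_mul Complex.I)).const_mul (1 / 2 : ℂ))
    rw [h.fderiv]
    simp [fderiv_fderiv_apply hf]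
    ring
  have key2 : ∀ w, fderiv ℝ (dz j f) z w = (1 / 2) * (fderiv ℝ (fderiv ℝ f) z w (Pi.single j 1)
      - Complex.I * fderiv ℝ (fderiv ℝ f) z w (Pi.single j Complex.I)) := by
    intro w
    have h : HasFDerivAt (dz j f) _ z := (((hd (Pi.single j 1)).hasFDerivAt.sub
      ((hd (Pi.single j Complex.I)).hasFDerivAt.const_mul Complex.I)).const_mul (1 / 2 : ℂ))
    rw [h.fderiv]
    simp [fderiv_fderiv_apply hf]
  simp only [dz, dzbar, dx, dy] at key1 key2 ⊢
  rw [key1, key1, key2, key2, hs.eq (Pi.single j 1) (Pi.single k 1),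
    hs.eq (Pi.single j 1) (Pi.single k Complex.I),
    hs.eq (Pi.single j Complex.I) (Pi.single k Complex.I),
    hs.eq (Pi.single j Complex.I) (Pi.single k 1)]
  ring

variable {ρ : Cn n → ℝ}

theorem fderiv_toC (h : DifferentiableAt ℝ ρ z) (v : Cn n) :
    fderiv ℝ (toC ρ) z v = (fderiv ℝ ρ z v : ℂ) := by
  have h2 : HasFDerivAt (toC ρ) (Complex.ofRealCLM.comp (fderiv ℝ ρ z)) z :=
    (Complex.ofRealCLM.hasFDerivAt (x := ρ z)).comp z h.hasFDerivAt
  rw [h2.fderiv]; simp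

theorem dz_toC (h : DifferentiableAt ℝ ρ z) :
    dz j (toC ρ) z = (1 / 2) * (((dx j ρ z : ℝ) : ℂ) - Complex.I * ((dy j ρ z : ℝ) : ℂ)) := by
  simp only [dz, dx, dy, fderiv_toC h]

theorem dzbar_toC (h : DifferentiableAt ℝ ρ z) : dzbar j (toC ρ) z = conj (dz j (toC ρ) z) := by
  rw [dz_toC j h]
  simp only [dzbar, dx, dy, fderiv_toC h, map_mul, map_sub, Complex.conj_I, conj_half,
    Complex.conj_ofReal]
  ring

theorem sum_norm_dz_sq (h : DifferentiableAt ℝ ρ z) :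
    ∑ i, ‖dz i (toC ρ) z‖ ^ 2 = (1 / 4) * gradNorm ρ z ^ 2 := by
  rw [gradNorm, Real.sq_sqrt (Finset.sum_nonneg fun _ _ => by positivity), Finset.mul_sum]
  refine Finset.sum_congr rfl fun i _ => ?_
  rw [dz_toC i h, ← Complex.normSq_eq_norm_sq, Complex.normSq_apply]
  simp
  ring

theorem dz_comp_real {h : ℝ → ℝ} {h' : ℝ} (hh : HasDerivAt h h' (ρ z))
    (hρ : DifferentiableAt ℝ ρ z) :
    dz j (fun w => ((h (ρ w) : ℝ) : ℂ)) z = h' * dz j (toC ρ) z := by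
  have h1 : HasFDerivAt (fun w => h (ρ w)) (h' • fderiv ℝ ρ z) z :=
    hh.comp_hasFDerivAt z hρ.hasFDerivAt
  have h2 := dz_toC j h1.differentiableAt
  rw [dz_toC j hρ]
  change dz j (toC fun w => h (ρ w)) z = _
  rw [h2]
  simp only [dx, dy, h1.fderiv]
  simp; ring

theorem dzbar_comp_real {h : ℝ → ℝ} {h' : ℝ} (hh : HasDerivAt h h' (ρ z))
    (hρ : DifferentiableAt ℝ ρ z) :
    dzbar j (fun w => ((h (ρ w) : ℝ) : ℂ)) z = h' * dzbar j (toC ρ) z := by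
  have h1 : HasFDerivAt (fun w => h (ρ w)) (h' • fderiv ℝ ρ z) z :=
    hh.comp_hasFDerivAt z hρ.hasFDerivAt
  rw [dzbar_toC j hρ]
  change dzbar j (toC fun w => h (ρ w)) z = _
  rw [dzbar_toC j h1.differentiableAt]
  have := dz_comp_real j hh hρ
  change dz j (toC fun w => h (ρ w)) z = _ at this
  rw [this]
  simp

theorem dx_eq (j : Fin n) : dx j f z = dz j f z + dzbar j f z := by
  simp only [dz, dzbar]; ring

theorem dy_eq (j : Fin n) : dy j f z = Complex.I * (dz j f z - dzbar j f z) := by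
  simp only [dz, dzbar]
  linear_combination (dy j f z) * Complex.I_mul_I

end Wirtinger

open MeasureTheory Filter Topology

/-- `Ω` is bounded and open, and `ρ` is a defining function for `Ω` that is smooth on all
of `ℂⁿ`. -/
structure IsGlobalDefining {n : ℕ} (Ω : Set (Cn n)) (ρ : Cn n → ℝ) : Prop where
  isOpen : IsOpen Ω
  bounded : Bornology.IsBounded Ω
  smooth : ContDiff ℝ ∞ ρ
  neg : ∀ z ∈ Ω, ρ z < 0
  zero : ∀ z ∈ frontier Ω, ρ z = 0
  grad : ∀ z ∈ frontier Ω, 0 < ∑ j, ‖dz j (toC ρ) z‖ ^ 2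
  loc : ∀ p ∈ frontier Ω, ∀ᶠ z in 𝓝 p, ρ z < 0 → z ∈ Ω

/-! ### Integration over a bounded open set -/

theorem integrableOn_of_continuous {n : ℕ} {E : Type*} [NormedAddCommGroup E] {Ω : Set (Cn n)}
    (hb : Bornology.IsBounded Ω)
    {f : Cn n → E} (hf : Continuous f) : IntegrableOn f Ω :=
  (hf.continuousOn.integrableOn_compact hb.isCompact_closure).mono_set subset_closure

theorem integrableOn_mul_of_continuous {n : ℕ} {Ω : Set (Cn n)} (hb : Bornology.IsBounded Ω)
    {f h : Cn n → ℂ} (hf : Continuous f) (hh : Continuous h) :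
    IntegrableOn (fun z => f z * h z) Ω :=
  integrableOn_of_continuous hb (hf.mul hh)

theorem isFiniteMeasure_restrict {n : ℕ} {Ω : Set (Cn n)}
    (hb : Bornology.IsBounded Ω) : IsFiniteMeasure (volume.restrict Ω) :=
  ⟨by rw [Measure.restrict_apply_univ]; exact hb.measure_lt_top⟩

theorem exists_bound_of_continuous {n : ℕ} {E : Type*} [NormedAddCommGroup E] {Ω : Set (Cn n)}
    (hb : Bornology.IsBounded Ω) {f : Cn n → E} (hf : Continuous f) :
    ∃ M : ℝ, 0 < M ∧ ∀ z ∈ closure Ω, ‖f z‖ ≤ M := by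
  obtain ⟨M, hM⟩ := hb.isCompact_closure.exists_bound_of_continuousOn hf.continuousOn
  exact ⟨max M 1, by positivity, fun z hz => (hM z hz).trans (le_max_left _ _)⟩

theorem memLp_of_continuous {n : ℕ} {Ω : Set (Cn n)} (hb : Bornology.IsBounded Ω)
    (hΩ : IsOpen Ω) {f : Cn n → ℂ} (hf : Continuous f) : MemLp f 2 (volume.restrict Ω) := by
  have := isFiniteMeasure_restrict hb
  obtain ⟨M, -, hM⟩ := exists_bound_of_continuous hb hf
  refine MemLp.of_bound hf.aestronglyMeasurable M ?_
  exact (ae_restrict_iff' hΩ.measurableSet).2 (ae_of_all _ fun z hz => hM z (subset_closure hz))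

theorem integral_fderiv_eq_zero {n : ℕ} {φ : Cn n → ℂ} (hφ : ContDiff ℝ ∞ φ)
    (hc : HasCompactSupport φ) (v : Cn n) : ∫ z, fderiv ℝ φ z v = 0 := by
  have hd : Continuous (fun z => fderiv ℝ φ z v) := (contDiff_fderiv_apply hφ v).continuous
  have hcd : HasCompactSupport (fun z => fderiv ℝ φ z v) := hc.fderiv_apply ℝ v
  -- Integration by parts against the constant function `1`.
  have h := integral_mul_fderiv_eq_neg_fderiv_mul_of_integrable (μ := (volume : Measure (Cn n)))
    (f := fun _ => (1 : ℂ)) (g := φ) (v := v) (by simp)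
    (by simpa using hd.integrable_of_hasCompactSupport hcd)
    (by simpa using hφ.continuous.integrable_of_hasCompactSupport hc)
    (fun _ _ => differentiableAt_const _)
    (fun x _ => ContDiff.differentiableAt_of_smooth hφ x)
  simpa using h

theorem setIntegral_fderiv_eq_zero {n : ℕ} {Ω : Set (Cn n)} {φ : Cn n → ℂ} (hφ : IsTest Ω φ)
    (v : Cn n) : ∫ z in Ω, fderiv ℝ φ z v = 0 := by
  rw [setIntegral_eq_integral_of_forall_compl_eq_zero, integral_fderiv_eq_zero hφ.1 hφ.2.1]
  intro z hz
  have : z ∉ tsupport φ := fun h => hz (hφ.2.2 h)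
  rw [fderiv_of_notMem_tsupport ℝ this]
  simp

theorem integrableOn_fderiv {n : ℕ} {Ω : Set (Cn n)} {φ : Cn n → ℂ} (hφ : IsTest Ω φ)
    (v : Cn n) : IntegrableOn (fun z => fderiv ℝ φ z v) Ω :=
  ((contDiff_fderiv_apply hφ.1 v).continuous.integrable_of_hasCompactSupport
    (hφ.2.1.fderiv_apply ℝ v)).integrableOn

theorem setIntegral_dz_eq_zero {n : ℕ} {Ω : Set (Cn n)} {φ : Cn n → ℂ} (hφ : IsTest Ω φ)
    (j : Fin n) : ∫ z in Ω, dz j φ z = 0 := by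
  simp only [dz, dx, dy]
  rw [integral_const_mul, integral_sub (integrableOn_fderiv hφ _)
    ((integrableOn_fderiv hφ _).const_mul _), integral_const_mul,
    setIntegral_fderiv_eq_zero hφ, setIntegral_fderiv_eq_zero hφ]
  simp

theorem setIntegral_dzbar_eq_zero {n : ℕ} {Ω : Set (Cn n)} {φ : Cn n → ℂ} (hφ : IsTest Ω φ)
    (j : Fin n) : ∫ z in Ω, dzbar j φ z = 0 := by
  simp only [dzbar, dx, dy]
  rw [integral_const_mul, integral_add (integrableOn_fderiv hφ _)
    ((integrableOn_fderiv hφ _).const_mul _), integral_const_mul,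
    setIntegral_fderiv_eq_zero hφ, setIntegral_fderiv_eq_zero hφ]
  simp

theorem IsTest.mul_right {n : ℕ} {Ω : Set (Cn n)} {φ F : Cn n → ℂ} (hφ : IsTest Ω φ)
    (hF : ContDiff ℝ ∞ F) : IsTest Ω (fun z => φ z * F z) :=
  ⟨hφ.1.mul hF, hφ.2.1.mul_right, (tsupport_mul_subset_left).trans hφ.2.2⟩

/-! ### Extension by zero -/

/-- A smooth function that vanishes near the boundary gives a test function after extension
by zero. -/
theorem isTest_indicator {n : ℕ} {Ω : Set (Cn n)} (hΩ : IsOpen Ω) (hb : Bornology.IsBounded Ω)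
    {F : Cn n → ℂ} (hF : ContDiff ℝ ∞ F) (h0 : ∀ p ∈ frontier Ω, ∀ᶠ z in 𝓝 p, F z = 0) :
    IsTest Ω (Ω.indicator F) := by
  have hz : ∀ p ∉ Ω, Ω.indicator F =ᶠ[𝓝 p] fun _ => 0 := by
    intro p hp
    by_cases hpc : p ∈ closure Ω
    · have : p ∈ frontier Ω := by rw [hΩ.frontier_eq]; exact ⟨hpc, hp⟩
      filter_upwards [h0 p this] with z hz
      simp [hz]
    · filter_upwards [isClosed_closure.isOpen_compl.mem_nhds hpc] with z hz
      exact Set.indicator_of_notMem (fun h => hz (subset_closure h)) _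
  have hsub : tsupport (Ω.indicator F) ⊆ Ω := by
    intro p hp
    by_contra hpΩ
    exact (notMem_tsupport_iff_eventuallyEq.2 (hz p hpΩ)) hp
  refine ⟨contDiff_iff_contDiffAt.2 fun p => ?_, ?_, hsub⟩
  · by_cases hp : p ∈ Ω
    · refine hF.contDiffAt.congr_of_eventuallyEq ?_
      filter_upwards [hΩ.mem_nhds hp] with z hz
      exact Set.indicator_of_mem hz _
    · exact contDiffAt_const.congr_of_eventuallyEq (hz p hp)
  · exact Metric.isCompact_of_isClosed_isBounded (isClosed_tsupport _) (hb.subset hsub)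

/-! ### Cutoff functions -/

/-- A smooth increasing function that vanishes on `(-∞, 1]` and equals `1` on `[2, ∞)`. -/
def step (t : ℝ) : ℝ := Real.smoothTransition (t - 1)

theorem contDiff_step : ContDiff ℝ ∞ step :=
  Real.smoothTransition.contDiff.comp (contDiff_id.sub contDiff_const)

theorem step_of_le {t : ℝ} (h : t ≤ 1) : step t = 0 :=
  Real.smoothTransition.zero_of_nonpos (by linarith)

theorem step_of_ge {t : ℝ} (h : 2 ≤ t) : step t = 1 :=
  Real.smoothTransition.one_of_one_le (by linarith)

theorem step_nonneg (t : ℝ) : 0 ≤ step t := Real.smoothTransition.nonneg _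

theorem step_le_one (t : ℝ) : step t ≤ 1 := Real.smoothTransition.le_one _

theorem step_monotone : Monotone step := fun _ _ h =>
  Real.smoothTransition.monotone (by linarith)

theorem hasDerivAt_step (t : ℝ) : HasDerivAt step (deriv step t) t :=
  (ContDiff.differentiableAt_of_smooth contDiff_step t).hasDerivAt

theorem continuous_deriv_step : Continuous (deriv step) :=
  contDiff_step.continuous_deriv (by simp)

theorem deriv_step_nonneg (t : ℝ) : 0 ≤ deriv step t := step_monotone.deriv_nonneg

theorem deriv_step_of_gt {t : ℝ} (h : 2 < t) : deriv step t = 0 := by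
  have : step =ᶠ[𝓝 t] fun _ => 1 := by
    filter_upwards [lt_mem_nhds h] with s hs using step_of_ge hs.le
  rw [this.deriv_eq, deriv_const]

/-- The quantity `t h'(t)` is invariant under scaling of the argument, so this bound controls the
derivatives of `step (κ|f|²) f` uniformly in `κ`. -/
theorem exists_bound_deriv_step : ∃ B : ℝ, 0 < B ∧ ∀ t, 0 ≤ t → t * deriv step t ≤ B := by
  obtain ⟨B, hB⟩ := (isCompact_Icc (a := (0 : ℝ)) (b := 2)).exists_bound_of_continuousOn
    (continuous_id.mul continuous_deriv_step).continuousOn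
  refine ⟨max B 1, by positivity, fun t ht => ?_⟩
  by_cases h : t ≤ 2
  · exact ((le_abs_self _).trans (hB t ⟨ht, h⟩)).trans (le_max_left _ _)
  · rw [deriv_step_of_gt (not_le.1 h), mul_zero]; positivity

/-- A cutoff function of `Ω`, equal to `1` where `κ ρ ≤ -2`. -/
def cutoff {n : ℕ} (Ω : Set (Cn n)) (ρ : Cn n → ℝ) (κ : ℕ) : Cn n → ℂ :=
  Ω.indicator (fun z => ((step (-κ * ρ z) : ℝ) : ℂ))

/-! ### The divergence theorem through averages over boundary strips -/

section Divergence

variable {n : ℕ} {Ω : Set (Cn n)} {ρ : Cn n → ℝ}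

theorem isTest_cutoff (H : IsGlobalDefining Ω ρ) (κ : ℕ) : IsTest Ω (cutoff Ω ρ κ) := by
  refine isTest_indicator H.isOpen H.bounded
    (contDiff_toC (contDiff_step.comp (contDiff_const.mul H.smooth))) fun p hp => ?_
  have hc : ContinuousAt (fun z => -(κ : ℝ) * ρ z) p :=
    (continuous_const.mul H.smooth.continuous).continuousAt
  have : (fun z => -(κ : ℝ) * ρ z) p < 1 := by simp [H.zero p hp]
  filter_upwards [hc.eventually_lt_const this] with z hz
  rw [step_of_le hz.le]; simp

theorem cutoff_eq (H : IsGlobalDefining Ω ρ) (κ : ℕ) {z : Cn n} (hz : z ∈ Ω) :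
    cutoff Ω ρ κ =ᶠ[𝓝 z] fun w => ((step (-κ * ρ w) : ℝ) : ℂ) := by
  filter_upwards [H.isOpen.mem_nhds hz] with w hw
  exact Set.indicator_of_mem hw _

theorem dz_cutoff (H : IsGlobalDefining Ω ρ) (κ : ℕ) (j : Fin n) {z : Cn n} (hz : z ∈ Ω) :
    dz j (cutoff Ω ρ κ) z = -((κ * deriv step (-κ * ρ z) : ℝ) : ℂ) * dz j (toC ρ) z := by
  rw [dz_congr j (cutoff_eq H κ hz)]
  have h : HasDerivAt (fun t => step (-κ * t)) (deriv step (-κ * ρ z) * (-κ)) (ρ z) := by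
    have := (hasDerivAt_step (-κ * ρ z)).comp (ρ z) ((hasDerivAt_id (ρ z)).const_mul (-(κ : ℝ)))
    simpa [Function.comp_def] using this
  rw [dz_comp_real j h (ContDiff.differentiableAt_of_smooth H.smooth z)]
  push_cast; ring

theorem dzbar_cutoff (H : IsGlobalDefining Ω ρ) (κ : ℕ) (j : Fin n) {z : Cn n} (hz : z ∈ Ω) :
    dzbar j (cutoff Ω ρ κ) z = -((κ * deriv step (-κ * ρ z) : ℝ) : ℂ) * dzbar j (toC ρ) z := by
  rw [dzbar_congr j (cutoff_eq H κ hz)]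
  have h : HasDerivAt (fun t => step (-κ * t)) (deriv step (-κ * ρ z) * (-κ)) (ρ z) := by
    have := (hasDerivAt_step (-κ * ρ z)).comp (ρ z) ((hasDerivAt_id (ρ z)).const_mul (-(κ : ℝ)))
    simpa [Function.comp_def] using this
  rw [dzbar_comp_real j h (ContDiff.differentiableAt_of_smooth H.smooth z)]
  push_cast; ring

theorem norm_cutoff_le (κ : ℕ) (z : Cn n) : ‖cutoff Ω ρ κ z‖ ≤ 1 := by
  by_cases hz : z ∈ Ω
  · rw [cutoff, Set.indicator_of_mem hz, Complex.norm_real,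
      Real.norm_of_nonneg (step_nonneg _)]
    exact step_le_one _
  · simp [cutoff, hz]

theorem tendsto_cutoff (H : IsGlobalDefining Ω ρ) {z : Cn n} (hz : z ∈ Ω) :
    Tendsto (fun κ => cutoff Ω ρ κ z) atTop (𝓝 1) := by
  refine tendsto_const_nhds.congr' ?_
  obtain ⟨N, hN⟩ := exists_nat_gt (2 / (-ρ z))
  have hneg := H.neg z hz
  filter_upwards [eventually_ge_atTop N] with κ hκ
  rw [cutoff, Set.indicator_of_mem hz, step_of_ge]
  · simp
  · have h1 : (N : ℝ) ≤ κ := by exact_mod_cast hκ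
    have h2 : 2 / (-ρ z) < κ := hN.trans_le h1
    rw [div_lt_iff₀ (by linarith)] at h2
    linarith

theorem tendsto_integral_cutoff_mul (H : IsGlobalDefining Ω ρ) {f : Cn n → ℂ}
    (hf : IntegrableOn f Ω) :
    Tendsto (fun κ => ∫ z in Ω, cutoff Ω ρ κ z * f z) atTop (𝓝 (∫ z in Ω, f z)) := by
  refine tendsto_integral_of_dominated_convergence (fun z => ‖f z‖) (fun κ => ?_) hf.norm
    (fun κ => ae_of_all _ fun z => ?_) ?_
  · exact (isTest_cutoff H κ).1.continuous.aestronglyMeasurable.mul hf.aestronglyMeasurable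
  · rw [norm_mul]
    exact mul_le_of_le_one_left (norm_nonneg _) (norm_cutoff_le κ z)
  · refine (ae_restrict_iff' H.isOpen.measurableSet).2 (ae_of_all _ fun z hz => ?_)
    simpa using (tendsto_cutoff H hz).mul_const (f z)

/-- The weights `κ h'(-κ ρ)`. -/
def stripWeight (ρ : Cn n → ℝ) (κ : ℕ) (z : Cn n) : ℝ := κ * deriv step (-κ * ρ z)

theorem stripWeight_nonneg (κ : ℕ) (z : Cn n) : 0 ≤ stripWeight ρ κ z :=
  mul_nonneg (Nat.cast_nonneg _) (deriv_step_nonneg _)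

theorem continuous_stripWeight (H : IsGlobalDefining Ω ρ) (κ : ℕ) :
    Continuous (stripWeight ρ κ) :=
  continuous_const.mul (continuous_deriv_step.comp (continuous_const.mul H.smooth.continuous))

variable {F G : Fin n → Cn n → ℂ}

/-- The cut-off field has compact support in `Ω`, so its divergence integrates to zero. The
derivatives that fall on the cutoff give the flux density, averaged with the weight `κ h'(-κρ)`. -/
theorem integral_cutoff_mul_div (H : IsGlobalDefining Ω ρ) (hF : ∀ j, ContDiff ℝ ∞ (F j))
    (hG : ∀ j, ContDiff ℝ ∞ (G j)) (κ : ℕ) :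
    ∫ z in Ω, cutoff Ω ρ κ z * ∑ j, (dz j (F j) z + dzbar j (G j) z) =
      ∫ z in Ω, (stripWeight ρ κ z : ℂ) *
        ∑ j, (dz j (toC ρ) z * F j z + dzbar j (toC ρ) z * G j z) := by
  have hχ := isTest_cutoff H κ
  have h0 : ∫ z in Ω, ∑ j, (dz j (fun w => cutoff Ω ρ κ w * F j w) z +
      dzbar j (fun w => cutoff Ω ρ κ w * G j w) z) = 0 := by
    have hi1 : ∀ j, IntegrableOn (dz j (fun w => cutoff Ω ρ κ w * F j w)) Ω := fun j =>
      integrableOn_of_continuous H.bounded (contDiff_dz j (hχ.1.mul (hF j))).continuous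
    have hi2 : ∀ j, IntegrableOn (dzbar j (fun w => cutoff Ω ρ κ w * G j w)) Ω := fun j =>
      integrableOn_of_continuous H.bounded (contDiff_dzbar j (hχ.1.mul (hG j))).continuous
    have hi : ∀ j ∈ Finset.univ, Integrable (fun z => dz j (fun w => cutoff Ω ρ κ w * F j w) z +
      dzbar j (fun w => cutoff Ω ρ κ w * G j w) z) (volume.restrict Ω) :=
      fun j _ => (hi1 j).add (hi2 j)
    rw [integral_finsetSum _ hi]
    refine Finset.sum_eq_zero fun j _ => ?_
    rw [integral_add (hi1 j) (hi2 j), setIntegral_dz_eq_zero (hχ.mul_right (hF j)),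
      setIntegral_dzbar_eq_zero (hχ.mul_right (hG j)), add_zero]
  rw [← sub_eq_zero, ← integral_sub, ← h0]
  · refine setIntegral_congr_fun H.isOpen.measurableSet fun z hz => ?_
    have hd := ContDiff.differentiableAt_of_smooth hχ.1 z
    simp only [stripWeight]
    rw [Finset.mul_sum, Finset.mul_sum, ← Finset.sum_sub_distrib]
    refine Finset.sum_congr rfl fun j _ => ?_
    rw [dz_mul j hd (ContDiff.differentiableAt_of_smooth (hF j) z),
      dzbar_mul j hd (ContDiff.differentiableAt_of_smooth (hG j) z),
      dz_cutoff H κ j hz, dzbar_cutoff H κ j hz]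
    ring
  · exact integrableOn_of_continuous H.bounded (hχ.1.continuous.mul
      (continuous_finsetSum _ fun j _ => (contDiff_dz j (hF j)).continuous.add
        (contDiff_dzbar j (hG j)).continuous))
  · exact integrableOn_of_continuous H.bounded
      ((Complex.continuous_ofReal.comp (continuous_stripWeight H κ)).mul
      (continuous_finsetSum _ fun j _ =>
        (((contDiff_dz j (contDiff_toC H.smooth)).continuous.mul (hF j).continuous).add
        ((contDiff_dzbar j (contDiff_toC H.smooth)).continuous.mul (hG j).continuous))))

/-- The strip averages on the left play the role of the boundary integral in the divergence theorem.
-/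
theorem tendsto_integral_stripWeight (H : IsGlobalDefining Ω ρ) (hF : ∀ j, ContDiff ℝ ∞ (F j))
    (hG : ∀ j, ContDiff ℝ ∞ (G j)) :
    Tendsto (fun κ => ∫ z in Ω, stripWeight ρ κ z *
        (∑ j, (dz j (toC ρ) z * F j z + dzbar j (toC ρ) z * G j z)).re) atTop
      (𝓝 (∫ z in Ω, ∑ j, (dz j (F j) z + dzbar j (G j) z)).re) := by
  have hi : IntegrableOn (fun z => ∑ j, (dz j (F j) z + dzbar j (G j) z)) Ω :=
    integrableOn_of_continuous H.bounded (continuous_finsetSum _ fun j _ =>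
      (contDiff_dz j (hF j)).continuous.add (contDiff_dzbar j (hG j)).continuous)
  have h := tendsto_integral_cutoff_mul H hi
  simp only [integral_cutoff_mul_div H hF hG] at h
  refine ((Complex.continuous_re.tendsto _).comp h).congr fun κ => ?_
  have hc : IntegrableOn (fun z => (stripWeight ρ κ z : ℂ) *
        ∑ j, (dz j (toC ρ) z * F j z + dzbar j (toC ρ) z * G j z)) Ω := 
    integrableOn_of_continuous H.bounded
      ((Complex.continuous_ofReal.comp (continuous_stripWeight H κ)).mul
      (continuous_finsetSum _ fun j _ =>
        (((contDiff_dz j (contDiff_toC H.smooth)).continuous.mul (hF j).continuous).add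
        ((contDiff_dzbar j (contDiff_toC H.smooth)).continuous.mul (hG j).continuous))))
  have := integral_re hc
  simp only [Function.comp_apply]
  refine Eq.trans this.symm ?_
  simp

/-- The field with components `F = 0`, `G_j = ∂ρ/∂z_j` has flux density `∑_j |∂ρ/∂z_j|²`; its strip
averages converge, hence are bounded. So the weights have uniformly bounded mass near the boundary.
-/
theorem exists_bound_integral_stripWeight (H : IsGlobalDefining Ω ρ) :
    ∃ M : ℝ, ∀ κ, ∫ z in Ω, stripWeight ρ κ z * ∑ j, ‖dz j (toC ρ) z‖ ^ 2 ≤ M := by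
  have h := tendsto_integral_stripWeight H (F := fun _ _ => 0) (G := fun j => dz j (toC ρ))
    (fun _ => contDiff_const) (fun j => contDiff_dz j (contDiff_toC H.smooth))
  obtain ⟨M, hM⟩ := h.bddAbove_range
  refine ⟨M, fun κ => ?_⟩
  refine le_trans (le_of_eq ?_) (hM ⟨κ, rfl⟩)
  refine integral_congr_ae (ae_of_all _ fun z => ?_)
  simp only
  congr 1
  rw [Complex.re_sum]
  refine Finset.sum_congr rfl fun j _ => ?_
  rw [dzbar_toC j (ContDiff.differentiableAt_of_smooth H.smooth z), mul_zero, zero_add,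
    Complex.conj_mul', ← Complex.ofReal_pow, Complex.ofReal_re]

theorem stripWeight_eq_zero {κ : ℕ} {z : Cn n} (h : 2 < -κ * ρ z) : stripWeight ρ κ z = 0 := by
  rw [stripWeight, deriv_step_of_gt h, mul_zero]

/-- Away from `V`, `ρ` is bounded above by a negative number by compactness, so there `-κρ > 2` for
large `κ` and the weight is zero. -/
theorem eventually_of_stripWeight_ne_zero (H : IsGlobalDefining Ω ρ) {V : Set (Cn n)}
    (hV : IsOpen V) (hfV : frontier Ω ⊆ V) :
    ∀ᶠ κ : ℕ in atTop, ∀ z ∈ Ω, stripWeight ρ κ z ≠ 0 → z ∈ V := by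
  have hK : IsCompact (closure Ω \ V) := H.bounded.isCompact_closure.diff hV
  have hsub : closure Ω \ V ⊆ Ω := by
    intro z hz
    by_contra hzΩ
    exact hz.2 (hfV (by rw [H.isOpen.frontier_eq]; exact ⟨hz.1, hzΩ⟩))
  rcases (closure Ω \ V).eq_empty_or_nonempty with he | hne
  · refine Eventually.of_forall fun κ z hz _ => ?_
    by_contra hzV
    have : z ∈ closure Ω \ V := ⟨subset_closure hz, hzV⟩
    rw [he] at this; exact this
  · obtain ⟨p, hp, hmax⟩ := hK.exists_isMaxOn hne H.smooth.continuous.continuousOn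
    have hneg := H.neg p (hsub hp)
    obtain ⟨N, hN⟩ := exists_nat_gt (2 / (-ρ p))
    filter_upwards [eventually_ge_atTop N] with κ hκ z hz hw
    by_contra hzV
    have h1 : ρ z ≤ ρ p := hmax (show z ∈ closure Ω \ V from ⟨subset_closure hz, hzV⟩)
    refine hw (stripWeight_eq_zero ?_)
    have h2 : (N : ℝ) ≤ κ := by exact_mod_cast hκ
    have h3 : 2 / (-ρ p) < κ := hN.trans_le h2
    rw [div_lt_iff₀ (by linarith)] at h3
    nlinarith [Nat.cast_nonneg (α := ℝ) κ]

/-- The divergence theorem as an inequality: if a vector field points out of `Ω` along the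
boundary, then its divergence has nonnegative integral. -/
theorem integral_div_nonneg (H : IsGlobalDefining Ω ρ) (hF : ∀ j, ContDiff ℝ ∞ (F j))
    (hG : ∀ j, ContDiff ℝ ∞ (G j))
    (hb : ∀ z ∈ frontier Ω, 0 ≤ (∑ j, (dz j (toC ρ) z * F j z + dzbar j (toC ρ) z * G j z)).re) :
    0 ≤ (∫ z in Ω, ∑ j, (dz j (F j) z + dzbar j (G j) z)).re := by
  obtain ⟨M, hM⟩ := exists_bound_integral_stripWeight H
  set S : Cn n → ℝ := fun z => ∑ j, ‖dz j (toC ρ) z‖ ^ 2 with hS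
  set P : Cn n → ℝ := fun z =>
    (∑ j, (dz j (toC ρ) z * F j z + dzbar j (toC ρ) z * G j z)).re with hP
  have hScont : Continuous S := continuous_finsetSum _ fun j _ =>
      (contDiff_dz j (contDiff_toC H.smooth)).continuous.norm.pow 2
  have hPcont : Continuous P := Complex.continuous_re.comp (continuous_finsetSum _ fun j _ =>
        (((contDiff_dz j (contDiff_toC H.smooth)).continuous.mul (hF j).continuous).add
        ((contDiff_dzbar j (contDiff_toC H.smooth)).continuous.mul (hG j).continuous)))
  -- A flux `P ≥ 0` on the boundary need not stay nonnegative nearby, but `P > -ηS` persists on a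
  -- neighbourhood because `S > 0` on the boundary. The loss is at most `ηM`, and `η → 0` at the
  -- end.
  have key : ∀ η : ℝ, 0 < η → -(η * M) ≤
      (∫ z in Ω, ∑ j, (dz j (F j) z + dzbar j (G j) z)).re := by
    intro η hη
    have hV : IsOpen {z | -(η * S z) < P z} :=
      isOpen_lt (continuous_const.mul hScont).neg hPcont
    have hfV : frontier Ω ⊆ {z | -(η * S z) < P z} := fun z hz => by
      have h1 := hb z hz
      have h2 := mul_pos hη (H.grad z hz)
      exact lt_of_lt_of_le (neg_lt_zero.2 h2) h1
    refine ge_of_tendsto (tendsto_integral_stripWeight H hF hG) ?_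
    filter_upwards [eventually_of_stripWeight_ne_zero H hV hfV] with κ hκ
    have h1 : ∫ z in Ω, -(η * (stripWeight ρ κ z * S z)) ≤ ∫ z in Ω, stripWeight ρ κ z * P z := by
      refine setIntegral_mono_on ?_ ?_ H.isOpen.measurableSet fun z hz => ?_
      · exact integrableOn_of_continuous H.bounded
          (continuous_const.mul ((continuous_stripWeight H κ).mul hScont)).neg
      · exact integrableOn_of_continuous H.bounded ((continuous_stripWeight H κ).mul hPcont)
      · by_cases hw : stripWeight ρ κ z = 0
        · simp [hw]
        · have := mul_le_mul_of_nonneg_left (le_of_lt (hκ z hz hw)) (stripWeight_nonneg (ρ := ρ) κ z)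
          linarith
    refine le_trans ?_ h1
    rw [integral_neg, integral_const_mul]
    exact neg_le_neg (mul_le_mul_of_nonneg_left (hM κ) hη.le)
  have hlim : Tendsto (fun η : ℝ => -(η * M)) (𝓝[>] 0) (𝓝 (-(0 * M))) :=
    ((continuous_id.mul continuous_const).neg.tendsto 0).mono_left nhdsWithin_le_nhds
  rw [zero_mul, neg_zero] at hlim
  exact le_of_tendsto hlim (eventually_mem_nhdsWithin.mono fun η hη => key η hη)

/-- The divergence theorem for vector fields that are tangential along the boundary. -/
theorem integral_div_eq_zero (H : IsGlobalDefining Ω ρ) (hF : ∀ j, ContDiff ℝ ∞ (F j))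
    (hG : ∀ j, ContDiff ℝ ∞ (G j))
    (hb : ∀ z ∈ frontier Ω, ∑ j, (dz j (toC ρ) z * F j z + dzbar j (toC ρ) z * G j z) = 0) :
    (∫ z in Ω, ∑ j, (dz j (F j) z + dzbar j (G j) z)).re = 0 := by
  refine le_antisymm ?_ (integral_div_nonneg H hF hG fun z hz => by rw [hb z hz]; simp)
  have h := integral_div_nonneg H (F := fun j z => -F j z) (G := fun j z => -G j z)
    (fun j => (hF j).neg) (fun j => (hG j).neg) (fun z hz => by
      have : ∑ j, (dz j (toC ρ) z * -F j z + dzbar j (toC ρ) z * -G j z) =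
          -∑ j, (dz j (toC ρ) z * F j z + dzbar j (toC ρ) z * G j z) := by
        rw [← Finset.sum_neg_distrib]; exact Finset.sum_congr rfl fun j _ => by ring
      rw [this, hb z hz]; simp)
  have h2 : ∀ z, ∑ j, (dz j (fun w => -F j w) z + dzbar j (fun w => -G j w) z) =
      -∑ j, (dz j (F j) z + dzbar j (G j) z) := fun z => by
    rw [← Finset.sum_neg_distrib]
    exact Finset.sum_congr rfl fun j _ => by rw [dz_neg, dzbar_neg]; ring
  simp only [h2, integral_neg, Complex.neg_re] at h
  linarith

end Divergence

/-! ### The adjoint of `∂̄` on smooth forms -/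

/-- The formal divergence `∑_j ∂u_{jK}/∂z_j`, which is minus the formal adjoint of `∂̄`. -/
def divForm {n m : ℕ} (u : Coeffs n (m + 1)) : Coeffs n m :=
  fun K z => ∑ j, dz j (u (consIdx j K)) z

section Adjoint

variable {n m : ℕ} {Ω : Set (Cn n)} {ρ : Cn n → ℝ}

theorem dbar_eq_wedge {q : ℕ} (v : Coeffs n q) (J : Fin (q + 1) → Fin n) (z : Cn n) :
    dbar v J z = wedge (fun j L => dzbar j (v L) z) J := rfl

theorem IsForm.dzbar_skew {q : ℕ} {v : Coeffs n q} (hv : IsForm v)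
    (hs : ∀ J, ContDiff ℝ ∞ (v J)) (j : Fin n) (z : Cn n) : Skew (fun J => dzbar j (v J) z) := by
  intro σ J
  have h : v (J ∘ σ) = fun w => ((Equiv.Perm.sign σ : ℤ) : ℂ) * v J w := funext (hv σ J)
  simp only [h]
  rw [dzbar_mul j (differentiableAt_const _) (ContDiff.differentiableAt_of_smooth (hs J) z),
    dzbar_const, zero_mul, zero_add]

theorem IsForm.dz_skew {q : ℕ} {v : Coeffs n q} (hv : IsForm v)
    (hs : ∀ J, ContDiff ℝ ∞ (v J)) (j : Fin n) (z : Cn n) : Skew (fun J => dz j (v J) z) := by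
  intro σ J
  have h : v (J ∘ σ) = fun w => ((Equiv.Perm.sign σ : ℤ) : ℂ) * v J w := funext (hv σ J)
  simp only [h]
  rw [dz_mul j (differentiableAt_const _) (ContDiff.differentiableAt_of_smooth (hs J) z),
    dz_const, zero_mul, zero_add]

theorem Skew.sum {q : ℕ} {ι : Type*} {s : Finset ι} {U : ι → (Fin q → Fin n) → ℂ}
    (hU : ∀ i ∈ s, Skew (U i)) : Skew (fun J => ∑ i ∈ s, U i J) := by
  intro σ J
  simp only
  rw [Finset.mul_sum]
  exact Finset.sum_congr rfl fun i hi => hU i hi σ J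

theorem Skew.const_mul {q : ℕ} {U : (Fin q → Fin n) → ℂ} (hU : Skew U) (c : ℂ) :
    Skew (fun J => c * U J) := by
  intro σ J
  simp only [hU σ J]; ring

theorem IsForm.divForm {u : Coeffs n (m + 1)} (hu : IsForm u)
    (hs : ∀ J, ContDiff ℝ ∞ (u J)) : IsForm (divForm u) :=
  isForm_of_skew fun z => Skew.sum fun j _ => (hu.dz_skew hs j z).consIdx j

theorem contDiff_divForm {u : Coeffs n (m + 1)} (hs : ∀ J, ContDiff ℝ ∞ (u J))
    (K : Fin m → Fin n) : ContDiff ℝ ∞ (divForm u K) :=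
  ContDiff.sum fun j _ => contDiff_dz j (hs _)

theorem contDiff_dbar {q : ℕ} {v : Coeffs n q} (hs : ∀ J, ContDiff ℝ ∞ (v J))
    (J : Fin (q + 1) → Fin n) : ContDiff ℝ ∞ (dbar v J) :=
  ContDiff.sum fun _ _ => contDiff_const.mul (contDiff_dzbar _ (hs _))

theorem IsForm.dbar {q : ℕ} {v : Coeffs n q} (hv : IsForm v)
    (hs : ∀ J, ContDiff ℝ ∞ (v J)) : IsForm (dbar v) :=
  isForm_of_skew fun z => skew_wedge fun j => hv.dzbar_skew hs j z

theorem hasWeakDbar_of_contDiff (hb : Bornology.IsBounded Ω) (hΩ : IsOpen Ω) {q : ℕ}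
    {v : Coeffs n q} (hv : IsForm v) (hs : ∀ J, ContDiff ℝ ∞ (v J)) :
    HasWeakDbar Ω v (dbar v) := by
  refine ⟨⟨hv, fun J => memLp_of_continuous hb hΩ (hs J).continuous⟩,
    ⟨hv.dbar hs, fun J => memLp_of_continuous hb hΩ (contDiff_dbar hs J).continuous⟩, ?_⟩
  intro J φ hφ
  rw [← sub_eq_zero, sub_neg_eq_add, ← integral_add]
  · have h : ∀ z, ∑ s : Fin (q + 1), (-1) ^ (s : ℕ) * v (dropIdx J s) z * dzbar (J s) φ z +
        DbarNeumann.dbar v J z * φ z = ∑ s : Fin (q + 1), (-1) ^ (s : ℕ) *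
          dzbar (J s) (fun w => φ w * v (dropIdx J s) w) z := by
      intro z
      rw [DbarNeumann.dbar, Finset.sum_mul, ← Finset.sum_add_distrib]
      refine Finset.sum_congr rfl fun s _ => ?_
      rw [dzbar_mul _ (ContDiff.differentiableAt_of_smooth hφ.1 z)
        (ContDiff.differentiableAt_of_smooth (hs _) z)]
      ring
    simp only [h]
    rw [integral_finsetSum]
    · refine Finset.sum_eq_zero fun s _ => ?_
      rw [integral_const_mul, setIntegral_dzbar_eq_zero (hφ.mul_right (hs _)), mul_zero]
    · intro s _
      exact integrableOn_of_continuous hb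
        (continuous_const.mul (contDiff_dzbar _ (hφ.1.mul (hs _))).continuous)
  · exact integrableOn_of_continuous hb (continuous_finsetSum _ fun s _ =>
      (continuous_const.mul (hs _).continuous).mul (contDiff_dzbar _ hφ.1).continuous)
  · exact integrableOn_of_continuous hb ((contDiff_dbar hs J).continuous.mul hφ.1.continuous)

theorem sign_mul_self {q : ℕ} (σ : Equiv.Perm (Fin q)) :
    ((Equiv.Perm.sign σ : ℤ) : ℂ) * ((Equiv.Perm.sign σ : ℤ) : ℂ) = 1 := by
  rcases Int.units_eq_one_or (Equiv.Perm.sign σ) with h | h <;> simp [h]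

theorem factorial_mul_innerL2 {q : ℕ} {u v : Coeffs n q} (hu : IsForm u) (hv : IsForm v) :
    (q.factorial : ℂ) * innerL2 Ω u v = ∑ J, ∫ z in Ω, u J z * conj (v J z) := by
  rw [innerL2, ← nsmul_eq_mul, ← sum_eq_factorial_sum_incr]
  · intro σ J
    refine integral_congr_ae (ae_of_all _ fun z => ?_)
    simp only [hu σ J z, hv σ J z, map_mul, map_intCast]
    linear_combination (u J z * conj (v J z)) * sign_mul_self σ
  · intro J hJ
    simp [(hu.skew _).eq_zero hJ]

theorem factorial_mul_normSq {q : ℕ} {u : Coeffs n q} (hu : IsForm u) :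
    (q.factorial : ℝ) * normSq Ω u = ∑ J, ∫ z in Ω, ‖u J z‖ ^ 2 := by
  rw [normSq, ← nsmul_eq_mul, ← sum_eq_factorial_sum_incr]
  · intro σ J
    refine integral_congr_ae (ae_of_all _ fun z => ?_)
    simp only [hu σ J z, norm_mul, norm_sign, one_mul]
  · intro J hJ
    simp [(hu.skew _).eq_zero hJ]

/-- Integration by parts with the total divergence kept as an integral over `Ω`: it stands for the
boundary term and vanishes only under the boundary condition. -/
theorem factorial_mul_innerL2_dbar (hb : Bornology.IsBounded Ω)
    {u : Coeffs n (m + 1)} {v : Coeffs n m} (hu : IsForm u)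
    (hus : ∀ J, ContDiff ℝ ∞ (u J)) (hv : IsForm v) (hvs : ∀ J, ContDiff ℝ ∞ (v J)) :
    (m.factorial : ℂ) * innerL2 Ω u (dbar v) =
      (∫ z in Ω, ∑ j, ∑ K, dz j (fun w => u (consIdx j K) w * conj (v K w)) z) -
        ∑ K, ∫ z in Ω, divForm u K z * conj (v K z) := by
  have hcu : ∀ J, Continuous (u J) := fun J => (hus J).continuous
  have hcv : ∀ J, Continuous fun z => conj (v J z) := fun J => (contDiff_conj (hvs J)).continuous
  have h1 : (((m + 1).factorial : ℕ) : ℂ) * innerL2 Ω u (dbar v) =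
      ((m : ℂ) + 1) * ∫ z in Ω, ∑ j, ∑ K, u (consIdx j K) z * conj (dzbar j (v K) z) := by
    rw [factorial_mul_innerL2 hu (hv.dbar hvs), ← integral_finsetSum, ← integral_const_mul]
    · refine integral_congr_ae (ae_of_all _ fun z => ?_)
      simp only [dbar_eq_wedge, conj_wedge]
      exact sum_skew_mul_wedge (hu.skew z) _
    · intro J _
      exact integrableOn_of_continuous hb ((hcu J).mul
        (contDiff_conj (contDiff_dbar hvs J)).continuous)
  have h2 : (m.factorial : ℂ) * innerL2 Ω u (dbar v) =
      ∫ z in Ω, ∑ j, ∑ K, u (consIdx j K) z * conj (dzbar j (v K) z) := by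
    have h0 : (m : ℂ) + 1 ≠ 0 := Nat.cast_add_one_ne_zero m
    refine mul_left_cancel₀ h0 ?_
    rw [← h1, Nat.factorial_succ]; push_cast; ring
  rw [h2, ← integral_finsetSum, ← integral_sub]
  · refine integral_congr_ae (ae_of_all _ fun z => ?_)
    simp only [divForm, Finset.sum_mul]
    rw [Finset.sum_comm]
    nth_rewrite 2 [Finset.sum_comm]
    rw [← Finset.sum_sub_distrib]
    refine Finset.sum_congr rfl fun K _ => ?_
    rw [← Finset.sum_sub_distrib]
    refine Finset.sum_congr rfl fun j _ => ?_
    rw [dz_mul j (ContDiff.differentiableAt_of_smooth (hus _) z)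
      (ContDiff.differentiableAt_of_smooth (contDiff_conj (hvs _)) z),
      dz_conj j (ContDiff.differentiableAt_of_smooth (hvs _) z)]
    ring
  · exact integrableOn_of_continuous hb (continuous_finsetSum _ fun j _ =>
      continuous_finsetSum _ fun K _ =>
        (contDiff_dz j ((hus _).mul (contDiff_conj (hvs _)))).continuous)
  · exact integrableOn_of_continuous hb (continuous_finsetSum _ fun K _ =>
      (contDiff_divForm hus K).continuous.mul (hcv K))
  · intro K _
    exact integrableOn_of_continuous hb ((contDiff_divForm hus K).continuous.mul (hcv K))

theorem integrableOn_mul_of_memLp (hb : Bornology.IsBounded Ω) {f h : Cn n → ℂ}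
    (hf : MemLp f 2 (volume.restrict Ω)) (hΩ : IsOpen Ω) (hh : Continuous h) :
    IntegrableOn (fun z => f z * h z) Ω :=
  hf.integrable_mul (memLp_of_continuous hb hΩ hh)

theorem integral_div_eq_of_hasDbarStar (hb : Bornology.IsBounded Ω) (hΩ : IsOpen Ω)
    {u : Coeffs n (m + 1)} {g v : Coeffs n m} (hu : IsForm u)
    (hus : ∀ J, ContDiff ℝ ∞ (u J)) (hg : HasDbarStar Ω u g) (hv : IsForm v)
    (hvs : ∀ J, ContDiff ℝ ∞ (v J)) :
    ∫ z in Ω, ∑ j, ∑ K, dz j (fun w => u (consIdx j K) w * conj (v K w)) z =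
      ∑ K, ∫ z in Ω, (g K z + divForm u K z) * conj (v K z) := by
  have h1 := factorial_mul_innerL2_dbar hb hu hus hv hvs
  rw [hg.2.2 v (dbar v) (hasWeakDbar_of_contDiff hb hΩ hv hvs),
    factorial_mul_innerL2 hg.2.1.1 hv] at h1
  rw [eq_comm, sub_eq_iff_eq_add] at h1
  rw [h1, ← Finset.sum_add_distrib]
  refine Finset.sum_congr rfl fun K _ => ?_
  rw [← integral_add (integrableOn_mul_of_memLp hb (hg.2.1.2 K) hΩ
      (contDiff_conj (hvs K)).continuous)
    (integrableOn_mul_of_continuous hb (contDiff_divForm hus K).continuous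
      (contDiff_conj (hvs K)).continuous)]
  exact integral_congr_ae (ae_of_all _ fun z => by simp only; ring)

variable (H : IsGlobalDefining Ω ρ) {u : Coeffs n (m + 1)} {g : Coeffs n m} (hu : IsForm u)
  (hus : ∀ J, ContDiff ℝ ∞ (u J)) (hg : HasDbarStar Ω u g)

include H hu hus hg

/-- Inside `Ω`, `∂̄*` is its formal expression: for the test form `χ_κ v` the total divergence
integrates to zero, and `κ → ∞` removes the cutoff `χ_κ`. -/
theorem sum_integral_add_divForm_eq_zero {v : Coeffs n m} (hv : IsForm v)
    (hvs : ∀ J, ContDiff ℝ ∞ (v J)) :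
    ∑ K, ∫ z in Ω, (g K z + divForm u K z) * conj (v K z) = 0 := by
  have hlim : Tendsto (fun κ => ∑ K, ∫ z in Ω, cutoff Ω ρ κ z *
      ((g K z + divForm u K z) * conj (v K z))) atTop
      (𝓝 (∑ K, ∫ z in Ω, (g K z + divForm u K z) * conj (v K z))) := by
    refine tendsto_finsetSum _ fun K _ => tendsto_integral_cutoff_mul H ?_
    have h1 := integrableOn_mul_of_memLp H.bounded (hg.2.1.2 K) H.isOpen
      (contDiff_conj (hvs K)).continuous
    have h2 := integrableOn_mul_of_continuous H.bounded
      (contDiff_divForm hus K).continuous (contDiff_conj (hvs K)).continuous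
    refine (h1.add h2).congr (ae_of_all _ fun z => ?_)
    simp only [Pi.add_apply]; ring
  refine tendsto_nhds_unique hlim (tendsto_const_nhds.congr fun κ => ?_)
  have hχ := isTest_cutoff H κ
  have hreal : ∀ z, conj (cutoff Ω ρ κ z) = cutoff Ω ρ κ z := by
    intro z
    by_cases hz : z ∈ Ω
    · rw [cutoff, Set.indicator_of_mem hz, Complex.conj_ofReal]
    · simp [cutoff, hz]
  have h := integral_div_eq_of_hasDbarStar (v := fun K z => cutoff Ω ρ κ z * v K z)
    H.bounded H.isOpen hu hus hg
    (isForm_of_skew fun z => (hv.skew z).const_mul _) (fun K => hχ.1.mul (hvs K))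
  rw [integral_finsetSum] at h
  · rw [Finset.sum_eq_zero] at h
    · rw [h]
      refine Finset.sum_congr rfl fun K _ => integral_congr_ae (ae_of_all _ fun z => ?_)
      simp only [map_mul, hreal]; ring
    · intro j _
      rw [integral_finsetSum]
      · refine Finset.sum_eq_zero fun K _ => ?_
        have : (fun w => u (consIdx j K) w * conj (cutoff Ω ρ κ w * v K w)) =
            fun w => cutoff Ω ρ κ w * (u (consIdx j K) w * conj (v K w)) := by
          funext w; simp only [map_mul, hreal]; ring
        rw [this]
        exact setIntegral_dz_eq_zero (hχ.mul_right ((hus _).mul (contDiff_conj (hvs K)))) j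
      · intro K _
        exact integrableOn_of_continuous H.bounded
          (contDiff_dz j ((hus _).mul (contDiff_conj (hχ.1.mul (hvs _))))).continuous
  · intro j _
    exact integrableOn_of_continuous H.bounded (continuous_finsetSum _ fun K _ =>
      (contDiff_dz j ((hus _).mul (contDiff_conj (hχ.1.mul (hvs _))))).continuous)

/-- This is the boundary condition in weak form: with the interior part of `∂̄*` identified, the
boundary term must vanish against every `v` smooth up to the boundary. -/
theorem integral_div_eq_zero_of_hasDbarStar {v : Coeffs n m} (hv : IsForm v)
    (hvs : ∀ J, ContDiff ℝ ∞ (v J)) :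
    ∫ z in Ω, ∑ j, ∑ K, dz j (fun w => u (consIdx j K) w * conj (v K w)) z = 0 := by
  rw [integral_div_eq_of_hasDbarStar H.bounded H.isOpen hu hus hg hv hvs,
    sum_integral_add_divForm_eq_zero H hu hus hg hv hvs]

/-- Testing with `v = divForm u` makes `g + divForm u` orthogonal to `divForm u`. -/
theorem sum_integral_divForm_le :
    ∑ K, ∫ z in Ω, ‖divForm u K z‖ ^ 2 ≤ ∑ K, ∫ z in Ω, ‖g K z‖ ^ 2 := by
  have h := congrArg Complex.re (sum_integral_add_divForm_eq_zero H hu hus hg (hu.divForm hus)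
    (contDiff_divForm hus))
  rw [Complex.re_sum, Complex.zero_re] at h
  have hint : ∀ K, IntegrableOn
      (fun z => (g K z + divForm u K z) * conj (divForm u K z)) Ω := by
    intro K
    have h1 := integrableOn_mul_of_memLp H.bounded (hg.2.1.2 K) H.isOpen
      (contDiff_conj (contDiff_divForm hus K)).continuous
    have h2 := integrableOn_mul_of_continuous H.bounded
      (contDiff_divForm hus K).continuous (contDiff_conj (contDiff_divForm hus K)).continuous
    refine (h1.add h2).congr (ae_of_all _ fun z => ?_)
    simp only [Pi.add_apply]; ring
  have hd : ∀ K, IntegrableOn (fun z => ‖divForm u K z‖ ^ 2) Ω := fun K =>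
    integrableOn_of_continuous H.bounded ((contDiff_divForm hus K).continuous.norm.pow 2)
  have hle : ∀ K, ∫ z in Ω, ‖divForm u K z‖ ^ 2 ≤ (∫ z in Ω, ‖g K z‖ ^ 2) + 
      2 * (∫ z in Ω, (g K z + divForm u K z) * conj (divForm u K z)).re := by
    intro K
    have hgi : IntegrableOn (fun z => ‖g K z‖ ^ 2) Ω := (hg.2.1.2 K).integrable_norm_pow (by simp)
    have hre : IntegrableOn (fun z =>
        ((g K z + divForm u K z) * conj (divForm u K z)).re) Ω := (hint K).re
    have e : (∫ z in Ω, (g K z + divForm u K z) * conj (divForm u K z)).re =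
        ∫ z in Ω, ((g K z + divForm u K z) * conj (divForm u K z)).re := (integral_re (hint K)).symm
    rw [e, ← integral_const_mul, ← integral_add hgi (hre.const_mul 2)]
    refine integral_mono (hd K) (hgi.add (hre.const_mul 2)) fun z => ?_
    simp only [← Complex.normSq_eq_norm_sq, Complex.normSq_apply, Complex.mul_re, Complex.add_re,
      Complex.add_im, Complex.conj_re, Complex.conj_im]
    -- With `d = divForm u K z`, the right side minus the left is `|g + d|²`.
    nlinarith [sq_nonneg ((g K z).re + (divForm u K z).re),
      sq_nonneg ((g K z).im + (divForm u K z).im)]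
  calc _ ≤ ∑ K, ((∫ z in Ω, ‖g K z‖ ^ 2) + 
      2 * (∫ z in Ω, (g K z + divForm u K z) * conj (divForm u K z)).re) :=
        Finset.sum_le_sum fun K _ => hle K
    _ = _ := by rw [Finset.sum_add_distrib, ← Finset.mul_sum, h, mul_zero, add_zero]

end Adjoint

/-! ### Boundary behaviour of forms in the domain of the adjoint -/

/-- The normal part `∑_l ∂ρ/∂z_l u_{lK}` of a form. -/
def normalPart {n m : ℕ} (ρ : Cn n → ℝ) (u : Coeffs n (m + 1)) : Coeffs n m :=
  fun K z => ∑ l, dz l (toC ρ) z * u (consIdx l K) z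

section Boundary

variable {n m : ℕ} {Ω : Set (Cn n)} {ρ : Cn n → ℝ}

theorem IsForm.normalPart {u : Coeffs n (m + 1)} (hu : IsForm u) : IsForm (normalPart ρ u) :=
  isForm_of_skew fun z => Skew.sum fun j _ => ((hu.skew z).consIdx j).const_mul _

theorem contDiff_normalPart (hρ : ContDiff ℝ ∞ ρ) {u : Coeffs n (m + 1)}
    (hs : ∀ J, ContDiff ℝ ∞ (u J)) (K : Fin m → Fin n) : ContDiff ℝ ∞ (normalPart ρ u K) :=
  ContDiff.sum fun l _ => (contDiff_dz l (contDiff_toC hρ)).mul (hs _)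

/-- The squared Euclidean distance to `p`. -/
def distSq (p : Cn n) (z : Cn n) : ℝ := ∑ j, Complex.normSq (z j - p j)

theorem toC_distSq (p : Cn n) :
    toC (distSq p) = fun z => ∑ j, (z j - p j) * conj (z j - p j) := by
  funext z
  simp only [toC, distSq, Complex.ofReal_sum, Complex.mul_conj]

theorem contDiff_distSq (p : Cn n) : ContDiff ℝ ∞ (distSq p) := by
  refine ContDiff.sum fun j _ => ?_
  have h1 : ContDiff ℝ ∞ (fun z : Cn n => z j - p j) := (contDiff_coord j).sub contDiff_const
  have h2 : ContDiff ℝ ∞ (fun z : Cn n => ((z j - p j) * conj (z j - p j)).re) :=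
    Complex.reCLM.contDiff.comp (h1.mul (contDiff_conj h1))
  simpa only [Complex.mul_conj, Complex.ofReal_re] using h2

theorem dz_distSq (p : Cn n) (j : Fin n) (z : Cn n) :
    dz j (toC (distSq p)) z = conj (z j - p j) := by
  have h1 : ∀ i, ContDiff ℝ ∞ (fun z : Cn n => z i - p i) := fun i =>
    (contDiff_coord i).sub contDiff_const
  have hd : ∀ i, DifferentiableAt ℝ (fun z : Cn n => z i - p i) z := fun i =>
    ContDiff.differentiableAt_of_smooth (h1 i) z
  have hdc : ∀ i, DifferentiableAt ℝ (fun z : Cn n => conj (z i - p i)) z := fun i =>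
    ContDiff.differentiableAt_of_smooth (contDiff_conj (h1 i)) z
  rw [toC_distSq, dz_sum j _ fun i _ => (hd i).fun_mul (hdc i)]
  have : ∀ i, dz j (fun z : Cn n => (z i - p i) * conj (z i - p i)) z =
      if i = j then conj (z i - p i) else 0 := by
    intro i
    rw [dz_mul j (hd i) (hdc i), dz_conj j (hd i),
      dz_sub j (ContDiff.differentiableAt_of_smooth (contDiff_coord i) z)
        (differentiableAt_const _),
      dzbar_sub j (ContDiff.differentiableAt_of_smooth (contDiff_coord i) z)
        (differentiableAt_const _), dz_coord, dzbar_coord, dz_const, dzbar_const]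
    split_ifs <;> simp
  rw [Finset.sum_congr rfl fun i _ => this i]
  simp

/-- The norm on `Cn n` is the supremum norm, while `distSq` is Euclidean. -/
theorem norm_sub_lt_of_distSq_lt {p z : Cn n} {r : ℝ} (hr : 0 < r) (h : distSq p z < r ^ 2) :
    ‖z - p‖ < r := by
  rw [pi_norm_lt_iff hr]
  intro j
  have h1 : Complex.normSq (z j - p j) ≤ distSq p z :=
    Finset.single_le_sum (f := fun j => Complex.normSq (z j - p j))
      (fun i _ => Complex.normSq_nonneg _) (Finset.mem_univ j)
  rw [Complex.normSq_eq_norm_sq] at h1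
  exact lt_of_pow_lt_pow_left₀ 2 hr.le (h1.trans_lt h)

theorem hasDerivAt_expNegInvGlue (t : ℝ) :
    HasDerivAt expNegInvGlue (t⁻¹ ^ 2 * expNegInvGlue t) t := by
  simpa using expNegInvGlue.hasDerivAt_polynomial_eval_inv_mul 1 t

theorem setIntegral_pos_of_continuous (hΩ : IsOpen Ω) (hb : Bornology.IsBounded Ω)
    {f : Cn n → ℝ} (hf : Continuous f) (h0 : ∀ z ∈ Ω, 0 ≤ f z) (h1 : ∃ z ∈ Ω, 0 < f z) :
    0 < ∫ z in Ω, f z := by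
  rw [setIntegral_pos_iff_support_of_nonneg_ae
    ((ae_restrict_iff' hΩ.measurableSet).2 (ae_of_all _ h0)) (integrableOn_of_continuous hb hf)]
  obtain ⟨z, hz, hfz⟩ := h1
  exact (hf.isOpen_support.inter hΩ).measure_pos _ ⟨z, hfz.ne', hz⟩

theorem frontier_subset_closure_diff (hΩ : IsOpen Ω) {p : Cn n} (hp : p ∈ frontier Ω) :
    p ∈ closure Ω ∧ p ∉ Ω := by
  rw [hΩ.frontier_eq] at hp; exact hp

/-- Suppose `N(p) ≠ 0`. The weak boundary condition is tested with `G N`, where `G = exp(-1/w)` for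
`w > 0`, `G = 0` elsewhere, and `w = ρ - |z - p|² + s`. As `ρ < 0` in `Ω`, the part of `Ω` where `w
> 0` is a small set near `p` on which `w ≤ s`. Differentiating `G` gives `w⁻² G` times a quantity
close to `∑_K |N_K(p)|² > 0`, and for small `s` this dominates all other terms. The divergence then
has a positive integral, a contradiction. -/
theorem normalPart_eq_zero (H : IsGlobalDefining Ω ρ) {u : Coeffs n (m + 1)} {g : Coeffs n m}
    (hu : IsForm u) (hus : ∀ J, ContDiff ℝ ∞ (u J)) (hg : HasDbarStar Ω u g)
    {p : Cn n} (hp : p ∈ frontier Ω) (K : Fin m → Fin n) : normalPart ρ u K p = 0 := by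
  by_contra hK
  set N := normalPart ρ u with hN
  have hNs : ∀ K, ContDiff ℝ ∞ (N K) := contDiff_normalPart H.smooth hus
  have hprod : ∀ j K, ContDiff ℝ ∞ (fun z => u (consIdx j K) z * conj (N K z)) := fun j K =>
    (hus _).mul (contDiff_conj (hNs K))
  -- `c₁` is the coefficient of `w⁻² G`, coming from the derivatives of `w`, and `c₂` the
  -- coefficient of the undifferentiated `G`.
  set c₁ : Cn n → ℂ := fun z => ∑ j, ∑ K, (dz j (toC ρ) z - conj (z j - p j)) *
    (u (consIdx j K) z * conj (N K z)) with hc₁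
  set c₂ : Cn n → ℂ := fun z => ∑ j, ∑ K, dz j (fun w => u (consIdx j K) w * conj (N K w)) z
    with hc₂
  have hc₁c : Continuous c₁ := continuous_finsetSum _ fun j _ => continuous_finsetSum _ fun K _ =>
    ((contDiff_dz j (contDiff_toC H.smooth)).sub
      (contDiff_conj ((contDiff_coord j).sub contDiff_const))).continuous.mul (hprod j K).continuous
  have hc₂c : Continuous c₂ := continuous_finsetSum _ fun j _ => continuous_finsetSum _ fun K _ =>
    (contDiff_dz j (hprod j K)).continuous
  have hpos : 0 < (c₁ p).re := by
    have : c₁ p = ∑ K, ((‖N K p‖ ^ 2 : ℝ) : ℂ) := by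
      simp only [hc₁, sub_self, map_zero, sub_zero]
      rw [Finset.sum_comm]
      refine Finset.sum_congr rfl fun K _ => ?_
      rw [Complex.ofReal_pow, ← Complex.mul_conj']
      change _ = (∑ l, dz l (toC ρ) p * u (consIdx l K) p) * conj (N K p)
      rw [Finset.sum_mul]
      exact Finset.sum_congr rfl fun j _ => by ring
    rw [this, Complex.re_sum]
    simp only [Complex.ofReal_re]
    exact Finset.sum_pos' (fun _ _ => by positivity)
      ⟨K, Finset.mem_univ _, by have := norm_pos_iff.2 hK; positivity⟩
  set c := (c₁ p).re / 2 with hc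
  have hcpos : 0 < c := half_pos hpos
  set C := |(c₂ p).re| + 1 with hC
  have hCpos : 0 < C := by positivity
  have hev : ∀ᶠ z in 𝓝 p, c < (c₁ z).re ∧ -C < (c₂ z).re := by
    refine ((Complex.continuous_re.comp hc₁c).continuousAt.eventually_const_lt
      (show c < (c₁ p).re from half_lt_self hpos)).and
      ((Complex.continuous_re.comp hc₂c).continuousAt.eventually_const_lt (?_ : -C < (c₂ p).re))
    have := neg_abs_le (c₂ p).re
    linarith
  obtain ⟨r, hr, hball⟩ := Metric.eventually_nhds_iff.1 hev
  -- `s ≤ r²` keeps the relevant set inside the ball where the bounds on `c₁` and `c₂` hold; `s² C ≤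
  -- c` gives `w⁻² c ≥ C` whenever `0 < w ≤ s`.
  obtain ⟨s, hs, hsr, hsC⟩ : ∃ s : ℝ, 0 < s ∧ s ≤ r ^ 2 ∧ s ^ 2 * C ≤ c := by
    refine ⟨min (r ^ 2) (min 1 (c / C)), by positivity, min_le_left _ _, ?_⟩
    set s := min (r ^ 2) (min 1 (c / C)) with hs
    have h0 : 0 < s := by positivity
    have h1 : s ≤ 1 := (min_le_right _ _).trans (min_le_left _ _)
    have h2 : s ≤ c / C := (min_le_right _ _).trans (min_le_right _ _)
    rw [le_div_iff₀ hCpos] at h2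
    nlinarith
  set w : Cn n → ℝ := fun z => ρ z - distSq p z + s with hw
  have hws : ContDiff ℝ ∞ w := (H.smooth.sub (contDiff_distSq p)).add contDiff_const
  have hdw : ∀ j z, dz j (toC w) z = dz j (toC ρ) z - conj (z j - p j) := by
    intro j z
    have : toC w = fun z => (toC ρ z - toC (distSq p) z) + (s : ℂ) := by
      funext z; simp [toC, hw]
    have d1 := ContDiff.differentiableAt_of_smooth (contDiff_toC H.smooth) z
    have d2 := ContDiff.differentiableAt_of_smooth (contDiff_toC (contDiff_distSq p)) z
    rw [this, dz_add j (d1.fun_sub d2) (differentiableAt_const _), dz_sub j d1 d2, dz_const,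
      dz_distSq, add_zero]
  set G : Cn n → ℂ := fun z => ((expNegInvGlue (w z) : ℝ) : ℂ) with hG
  have hGs : ContDiff ℝ ∞ G := contDiff_toC (expNegInvGlue.contDiff.comp hws)
  have hdG : ∀ j z, dz j G z = (((w z)⁻¹ ^ 2 * expNegInvGlue (w z) : ℝ) : ℂ) *
      (dz j (toC ρ) z - conj (z j - p j)) := by
    intro j z
    rw [← hdw]
    exact dz_comp_real j (hasDerivAt_expNegInvGlue (w z))
      (ContDiff.differentiableAt_of_smooth hws z)
  have h0 := integral_div_eq_zero_of_hasDbarStar H hu hus hg (v := fun K z => G z * N K z)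
    (isForm_of_skew fun z => (hu.normalPart.skew z).const_mul _) (fun K => hGs.mul (hNs K))
  set I : Cn n → ℂ := fun z => ∑ j, ∑ K,
    dz j (fun w => u (consIdx j K) w * conj (G w * N K w)) z with hI
  have hIc : Continuous I := continuous_finsetSum _ fun j _ => continuous_finsetSum _ fun K _ =>
    (contDiff_dz j ((hus _).mul (contDiff_conj (hGs.mul (hNs K))))).continuous
  have hIre : ∀ z, (I z).re =
      expNegInvGlue (w z) * ((w z)⁻¹ ^ 2 * (c₁ z).re + (c₂ z).re) := by
    intro z
    have : I z = ((expNegInvGlue (w z) : ℝ) : ℂ) *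
        ((((w z)⁻¹ ^ 2 : ℝ) : ℂ) * c₁ z + c₂ z) := by
      simp only [hI, hc₁, hc₂, Finset.mul_sum, ← Finset.sum_add_distrib]
      refine Finset.sum_congr rfl fun j _ => Finset.sum_congr rfl fun K _ => ?_
      have e : (fun w => u (consIdx j K) w * conj (G w * N K w)) =
          fun w => G w * (u (consIdx j K) w * conj (N K w)) := by
        funext y
        simp only [hG, map_mul, Complex.conj_ofReal]; ring
      rw [e, dz_mul j (ContDiff.differentiableAt_of_smooth hGs z)
        (ContDiff.differentiableAt_of_smooth (hprod j K) z), hdG]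
      simp only [hG]
      push_cast; ring
    rw [this, Complex.re_ofReal_mul, Complex.add_re, Complex.re_ofReal_mul]
  have hstrict : ∀ z ∈ Ω, 0 < w z → 0 < (I z).re := by
    intro z hz hwz
    have hρz := H.neg z hz
    have hd : 0 ≤ distSq p z := Finset.sum_nonneg fun _ _ => Complex.normSq_nonneg _
    have hdist : dist z p < r := by
      rw [dist_eq_norm]
      refine norm_sub_lt_of_distSq_lt hr ?_
      simp only [hw] at hwz
      linarith
    obtain ⟨h1, h2⟩ := hball hdist
    have hws' : w z ≤ s := by simp only [hw]; linarith
    rw [hIre]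
    refine mul_pos (expNegInvGlue.pos_of_pos hwz) ?_
    have h3 : C ≤ (w z)⁻¹ ^ 2 * c := by
      rw [inv_pow, ← div_eq_inv_mul, le_div_iff₀ (by positivity)]
      calc C * w z ^ 2 ≤ C * s ^ 2 := by gcongr
        _ ≤ c := by linarith
    have h4 : (w z)⁻¹ ^ 2 * c ≤ (w z)⁻¹ ^ 2 * (c₁ z).re := by gcongr
    linarith
  have hposint : 0 < ∫ z in Ω, (I z).re := by
    refine setIntegral_pos_of_continuous H.isOpen H.bounded (Complex.continuous_re.comp hIc)
      (fun z hz => ?_) ?_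
    · by_cases hwz : 0 < w z
      · exact (hstrict z hz hwz).le
      · rw [hIre, expNegInvGlue.zero_of_nonpos (not_lt.1 hwz), zero_mul]
    · have hcl := (frontier_subset_closure_diff H.isOpen hp).1
      have hwp : 0 < w p := by
        simp only [hw, H.zero p hp, distSq]; simpa using hs
      have hnhds : {z | 0 < w z} ∈ 𝓝 p :=
        (isOpen_lt continuous_const hws.continuous).mem_nhds hwp
      obtain ⟨z, hz1, hz2⟩ := mem_closure_iff_nhds.1 hcl _ hnhds
      exact ⟨z, hz2, hstrict z hz2 hz1⟩
  have e := integral_re (𝕜 := ℂ) (integrableOn_of_continuous H.bounded hIc)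
  have e2 : ∫ z in Ω, (I z).re = (∫ z in Ω, I z).re := e
  rw [e2, h0] at hposint
  simp at hposint

/-! ### Tangential derivatives -/

theorem fderiv_ne_zero_of_sum_dz_pos {z : Cn n} (hρ : DifferentiableAt ℝ ρ z)
    (h : 0 < ∑ j, ‖dz j (toC ρ) z‖ ^ 2) : fderiv ℝ ρ z ≠ 0 := by
  intro h0
  refine h.ne' (Finset.sum_eq_zero fun j _ => ?_)
  rw [dz_toC j hρ]
  simp [dx, dy, h0]

/-- If a zero of `ρ` near `p` were outside the closure of `Ω`, then `ρ ≥ 0` around it, so it would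
be a local minimum, while the gradient does not vanish near `p`. -/
theorem eventually_mem_frontier (H : IsGlobalDefining Ω ρ) {p : Cn n} (hp : p ∈ frontier Ω) :
    ∀ᶠ z in 𝓝 p, ρ z = 0 → z ∈ frontier Ω := by
  have hcont : Continuous (fun z => ∑ j, ‖dz j (toC ρ) z‖ ^ 2) :=
    continuous_finsetSum _ fun j _ =>
      (contDiff_dz j (contDiff_toC H.smooth)).continuous.norm.pow 2
  filter_upwards [hcont.continuousAt.eventually_const_lt (H.grad p hp),
    eventually_eventually_nhds.2 (H.loc p hp)] with z h1 h2 hz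
  rw [H.isOpen.frontier_eq]
  refine ⟨?_, fun h => (H.neg z h).ne hz⟩
  by_contra hcl
  refine fderiv_ne_zero_of_sum_dz_pos (ContDiff.differentiableAt_of_smooth H.smooth z) h1 ?_
  refine IsLocalMin.fderiv_eq_zero ?_
  filter_upwards [h2, isClosed_closure.isOpen_compl.mem_nhds hcl] with y hy1 hy2
  rw [hz]
  by_contra hlt
  exact hy2 (subset_closure (hy1 (not_le.1 hlt)))

/-- Near `p` the level set of `ρ` lies in the boundary, where `φ = 0`, so `p` is an extremum of `φ`
under the constraint and Lagrange multipliers apply. The multiplier of `dφ` is nonzero because `dρ ≠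
0` at `p`. -/
theorem exists_fderiv_eq_smul (H : IsGlobalDefining Ω ρ) {φ : Cn n → ℝ}
    (hφ : ContDiff ℝ ∞ φ) (h0 : ∀ z ∈ frontier Ω, φ z = 0) {p : Cn n} (hp : p ∈ frontier Ω) :
    ∃ μ : ℝ, fderiv ℝ φ p = μ • fderiv ℝ ρ p := by
  have hext : IsLocalExtrOn φ {x | ρ x = ρ p} p := by
    refine Or.inl ?_
    have h := eventually_mem_frontier H hp
    filter_upwards [nhdsWithin_le_nhds h, self_mem_nhdsWithin] with z hz1 hz2
    rw [h0 p hp, h0 z (hz1 (hz2.trans (H.zero p hp)))]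
  obtain ⟨a, b, hab, he⟩ := hext.exists_multipliers_of_hasStrictFDerivAt_1d
    (H.smooth.contDiffAt.hasStrictFDerivAt (by simp)) (hφ.contDiffAt.hasStrictFDerivAt (by simp))
  have hne := fderiv_ne_zero_of_sum_dz_pos (ContDiff.differentiableAt_of_smooth H.smooth p)
    (H.grad p hp)
  have hb : b ≠ 0 := by
    rintro rfl
    rw [zero_smul, add_zero, smul_eq_zero] at he
    rcases he with rfl | he
    · exact hab rfl
    · exact hne he
  refine ⟨-(b⁻¹ * a), ?_⟩
  have := congrArg (fun L => b⁻¹ • L) he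
  simp only [smul_add, smul_smul, inv_mul_cancel₀ hb, one_smul, smul_zero] at this
  exact (eq_neg_of_add_eq_zero_right this).trans (neg_smul _ _).symm

theorem exists_dzbar_eq_mul (H : IsGlobalDefining Ω ρ) {f : Cn n → ℂ}
    (hf : ContDiff ℝ ∞ f) (h0 : ∀ z ∈ frontier Ω, f z = 0) {p : Cn n} (hp : p ∈ frontier Ω) :
    ∃ μ : ℂ, ∀ j, dzbar j f p = μ * dzbar j (toC ρ) p := by
  have hre : ContDiff ℝ ∞ (fun z => (f z).re) := Complex.reCLM.contDiff.comp hf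
  have him : ContDiff ℝ ∞ (fun z => (f z).im) := Complex.imCLM.contDiff.comp hf
  obtain ⟨μ, hμ⟩ := exists_fderiv_eq_smul H hre (fun z hz => by simp [h0 z hz]) hp
  obtain ⟨ν, hν⟩ := exists_fderiv_eq_smul H him (fun z hz => by simp [h0 z hz]) hp
  have hfe : f = fun z => toC (fun z => (f z).re) z + Complex.I * toC (fun z => (f z).im) z := by
    funext z
    simp only [toC]
    rw [mul_comm, Complex.re_add_im]
  refine ⟨μ + Complex.I * ν, fun j => ?_⟩
  have d1 := ContDiff.differentiableAt_of_smooth (contDiff_toC hre) p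
  have d2 := ContDiff.differentiableAt_of_smooth (contDiff_toC him) p
  rw [hfe, dzbar_add j d1 (d2.const_mul _), dzbar_mul j (differentiableAt_const _) d2,
    dzbar_const]
  simp only [dzbar, dx, dy, fderiv_toC (ContDiff.differentiableAt_of_smooth hre p),
    fderiv_toC (ContDiff.differentiableAt_of_smooth him p),
    fderiv_toC (ContDiff.differentiableAt_of_smooth H.smooth p), hμ, hν, smul_apply, smul_eq_mul]
  push_cast
  ring

end Boundary

/-! ### The basic estimate -/

section BasicEstimate

variable {n m : ℕ} {Ω : Set (Cn n)} {ρ : Cn n → ℝ}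

/-- The multiplier `A - |z|²`. -/
def multiplier (n : ℕ) (A : ℝ) (z : Cn n) : ℝ := A - distSq 0 z

theorem contDiff_multiplier (A : ℝ) : ContDiff ℝ ∞ (multiplier n A) :=
  contDiff_const.sub (contDiff_distSq 0)

theorem dz_multiplier (A : ℝ) (j : Fin n) (z : Cn n) :
    dz j (toC (multiplier n A)) z = -conj (z j) := by
  have : toC (multiplier n A) = fun z => (A : ℂ) - toC (distSq 0) z := by
    funext z; simp [toC, multiplier]
  rw [this, dz_sub j (differentiableAt_const _)
    (ContDiff.differentiableAt_of_smooth (contDiff_toC (contDiff_distSq 0)) z), dz_const,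
    dz_distSq]
  simp

theorem dzbar_multiplier (A : ℝ) (j : Fin n) (z : Cn n) :
    dzbar j (toC (multiplier n A)) z = -z j := by
  rw [dzbar_toC j (ContDiff.differentiableAt_of_smooth (contDiff_multiplier A) z), dz_multiplier]
  simp

theorem exists_multiplier_bounds (hb : Bornology.IsBounded Ω) :
    ∃ A : ℝ, 1 ≤ A ∧ ∀ z ∈ closure Ω, 1 ≤ multiplier n A z ∧ multiplier n A z ≤ A ∧
      distSq 0 z ≤ A := by
  obtain ⟨M, hM, h⟩ := exists_bound_of_continuous hb (contDiff_distSq (0 : Cn n)).continuous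
  -- The extra `1` makes the multiplier at least `1` on the closure.
  refine ⟨M + 1, by linarith, fun z hz => ?_⟩
  have h1 := (le_abs_self _).trans (h z hz)
  have h2 : 0 ≤ distSq 0 z := Finset.sum_nonneg fun _ _ => Complex.normSq_nonneg _
  simp only [multiplier]
  exact ⟨by linarith, by linarith, by linarith⟩

/-- The holomorphic part of the vector field in the basic identity. -/
def fieldF (A : ℝ) (w : Fin n → Cn n → ℂ) (j : Fin n) : Cn n → ℂ :=
  fun z => w j z * (toC (multiplier n A) z * conj (∑ k, dz k (w k) z) -
    ∑ k, z k * conj (w k z))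

/-- The antiholomorphic part of the vector field in the basic identity. -/
def fieldG (A : ℝ) (w : Fin n → Cn n → ℂ) (k : Fin n) : Cn n → ℂ :=
  fun z => -(toC (multiplier n A) z * ∑ j, w j z * conj (dzbar j (w k) z))

variable {w : Fin n → Cn n → ℂ} (hw : ∀ j, ContDiff ℝ ∞ (w j)) (A : ℝ)

include hw

theorem contDiff_div : ContDiff ℝ ∞ (fun z => ∑ k, dz k (w k) z) :=
  ContDiff.sum fun k _ => contDiff_dz k (hw k)

theorem contDiff_sum_coord_mul_conj : ContDiff ℝ ∞ (fun z : Cn n => ∑ k, z k * conj (w k z)) :=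
  ContDiff.sum fun k _ => (contDiff_coord k).mul (contDiff_conj (hw k))

theorem contDiff_fieldF (j : Fin n) : ContDiff ℝ ∞ (fieldF A w j) :=
  (hw j).mul (((contDiff_toC (contDiff_multiplier A)).mul (contDiff_conj (contDiff_div hw))).sub
    (contDiff_sum_coord_mul_conj hw))

theorem contDiff_sum_mul_conj_dzbar (k : Fin n) :
    ContDiff ℝ ∞ (fun z => ∑ j, w j z * conj (dzbar j (w k) z)) :=
  ContDiff.sum fun j _ => (hw j).mul (contDiff_conj (contDiff_dzbar j (hw k)))

theorem contDiff_fieldG (k : Fin n) : ContDiff ℝ ∞ (fieldG A w k) :=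
  ((contDiff_toC (contDiff_multiplier A)).mul (contDiff_sum_mul_conj_dzbar hw k)).neg

theorem dz_fieldF (j : Fin n) (z : Cn n) :
    dz j (fieldF A w j) z = dz j (w j) z * (toC (multiplier n A) z * conj (∑ k, dz k (w k) z) -
      ∑ k, z k * conj (w k z)) + w j z * (-conj (z j) * conj (∑ k, dz k (w k) z) +
      toC (multiplier n A) z * conj (∑ k, dzbar j (dz k (w k)) z) -
      (conj (w j z) + ∑ k, z k * conj (dzbar j (w k) z))) := by
  have hd := fun i => ContDiff.differentiableAt_of_smooth (hw i) z
  have ha := ContDiff.differentiableAt_of_smooth (contDiff_toC (contDiff_multiplier (n := n) A)) z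
  have hδ := ContDiff.differentiableAt_of_smooth (contDiff_div hw) z
  have hδc := ContDiff.differentiableAt_of_smooth (contDiff_conj (contDiff_div hw)) z
  have hs := ContDiff.differentiableAt_of_smooth (contDiff_sum_coord_mul_conj hw) z
  have hc := fun i => ContDiff.differentiableAt_of_smooth (contDiff_coord (n := n) i) z
  have hwc := fun i => ContDiff.differentiableAt_of_smooth (contDiff_conj (hw i)) z
  have e : dz j (fun z : Cn n => ∑ k, z k * conj (w k z)) z =
      conj (w j z) + ∑ k, z k * conj (dzbar j (w k) z) := by
    rw [dz_sum j _ fun i _ => (hc i).fun_mul (hwc i)]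
    have : ∀ k, dz j (fun z : Cn n => z k * conj (w k z)) z =
        (if k = j then conj (w k z) else 0) + z k * conj (dzbar j (w k) z) := by
      intro k
      rw [dz_mul j (hc k) (hwc k), dz_coord, dz_conj j (hd k)]
      split_ifs <;> simp
    rw [Finset.sum_congr rfl fun k _ => this k, Finset.sum_add_distrib]
    simp
  unfold fieldF
  rw [dz_mul j (hd j) ((ha.fun_mul hδc).fun_sub hs), dz_sub j (ha.fun_mul hδc) hs,
    dz_mul j ha hδc, dz_multiplier, dz_conj j hδ, e,
    dzbar_sum j _ fun k _ => ContDiff.differentiableAt_of_smooth (contDiff_dz k (hw k)) z]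

theorem dzbar_fieldG (k : Fin n) (z : Cn n) :
    dzbar k (fieldG A w k) z = z k * (∑ j, w j z * conj (dzbar j (w k) z)) -
      toC (multiplier n A) z * ∑ j, (dzbar k (w j) z * conj (dzbar j (w k) z) +
        w j z * conj (dzbar j (dz k (w k)) z)) := by
  have hd := fun i => ContDiff.differentiableAt_of_smooth (hw i) z
  have ha := ContDiff.differentiableAt_of_smooth (contDiff_toC (contDiff_multiplier (n := n) A)) z
  have hs := ContDiff.differentiableAt_of_smooth (contDiff_sum_mul_conj_dzbar hw k) z
  have hD := fun j => ContDiff.differentiableAt_of_smooth (contDiff_dzbar j (hw k)) z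
  have hDc := fun j => ContDiff.differentiableAt_of_smooth
    (contDiff_conj (contDiff_dzbar j (hw k))) z
  unfold fieldG
  rw [dzbar_neg, dzbar_mul k ha hs, dzbar_multiplier,
    dzbar_sum k _ fun j _ => (hd j).fun_mul (hDc j)]
  have : ∀ j, dzbar k (fun z => w j z * conj (dzbar j (w k) z)) z =
      dzbar k (w j) z * conj (dzbar j (w k) z) + w j z * conj (dzbar j (dz k (w k)) z) := by
    intro j
    rw [dzbar_mul k (hd j) (hDc j), dzbar_conj k (hD j), dz_dzbar_comm _ _ (hw k)]
  rw [Finset.sum_congr rfl fun j _ => this j]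
  ring

/-- With `a = A - |z|²`, the field is `F_j = w_j conj(∑_k ∂(a w_k)/∂z_k)`, `G_k = -a ∑_j w_j
conj(∂w_k/∂z̄_j)`. It is built so that the second derivatives of `w` cancel; the term `-|w|²` comes
from the complex Hessian of `a`, which is minus the identity. -/
theorem div_field_eq (z : Cn n) :
    ∑ j, (dz j (fieldF A w j) z + dzbar j (fieldG A w j) z) =
      toC (multiplier n A) z * ((∑ k, dz k (w k) z) * conj (∑ k, dz k (w k) z)) -
      (∑ k, dz k (w k) z) * ∑ k, z k * conj (w k z) -
      conj (∑ k, dz k (w k) z) * (∑ k, conj (z k) * w k z) -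
      ∑ k, w k z * conj (w k z) -
      toC (multiplier n A) z * ∑ j, ∑ k, dzbar j (w k) z * conj (dzbar k (w j) z) := by
  simp only [dz_fieldF hw, dzbar_fieldG hw]
  set δ := ∑ k, dz k (w k) z
  set a := toC (multiplier n A) z
  set s := ∑ k, z k * conj (w k z)
  have h1 : ∑ j, w j z * (a * conj (∑ k, dzbar j (dz k (w k)) z)) =
      ∑ k, a * ∑ j, w j z * conj (dzbar j (dz k (w k)) z) := by
    simp only [map_sum, Finset.mul_sum]
    rw [Finset.sum_comm]
    exact Finset.sum_congr rfl fun _ _ => Finset.sum_congr rfl fun _ _ => by ring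
  have h2 : ∑ j, w j z * ∑ k, z k * conj (dzbar j (w k) z) =
      ∑ k, z k * ∑ j, w j z * conj (dzbar j (w k) z) := by
    simp only [Finset.mul_sum]
    rw [Finset.sum_comm]
    exact Finset.sum_congr rfl fun _ _ => Finset.sum_congr rfl fun _ _ => by ring
  have h3 : ∑ j, (dz j (w j) z * (a * conj δ - s)) = δ * (a * conj δ - s) := by
    rw [Finset.sum_mul]
  have h4 : ∑ j, w j z * (-conj (z j) * conj δ) = -(conj δ * ∑ k, conj (z k) * w k z) := by
    rw [Finset.mul_sum, ← Finset.sum_neg_distrib]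
    exact Finset.sum_congr rfl fun _ _ => by ring
  have h5 : a * ∑ j, ∑ k, dzbar j (w k) z * conj (dzbar k (w j) z) =
      ∑ j, a * ∑ k, dzbar j (w k) z * conj (dzbar k (w j) z) := by rw [Finset.mul_sum]
  simp only [Finset.sum_add_distrib, mul_add, mul_sub, Finset.sum_sub_distrib] at h1 h2 h3 h4 h5 ⊢
  linear_combination h1 - h2 + h3 + h4 + h5

/-- The two terms mixing `w` with its divergence `δ` are absorbed: `|t|² ≤ A|w|²` by Cauchy-Schwarz,
and `2|δ||t| ≤ 2A|δ|² + |t|²/(2A)` uses up only half of `|w|²`. -/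
theorem re_div_field_le (z : Cn n) (hA : 1 ≤ A) (h1 : multiplier n A z ≤ A)
    (h2 : distSq 0 z ≤ A) :
    (∑ j, (dz j (fieldF A w j) z + dzbar j (fieldG A w j) z)).re ≤
      3 * A * ‖∑ k, dz k (w k) z‖ ^ 2 - 1 / 2 * ∑ k, ‖w k z‖ ^ 2 -
      multiplier n A z * (∑ j, ∑ k, dzbar j (w k) z * conj (dzbar k (w j) z)).re := by
  rw [div_field_eq hw]
  set δ := ∑ k, dz k (w k) z
  set X := ∑ j, ∑ k, dzbar j (w k) z * conj (dzbar k (w j) z)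
  set t := ∑ k, conj (z k) * w k z with ht
  have hs : ∑ k, z k * conj (w k z) = conj t := by
    rw [ht, map_sum]
    exact Finset.sum_congr rfl fun _ _ => by simp
  have hw2 : ∑ k, w k z * conj (w k z) = ((∑ k, ‖w k z‖ ^ 2 : ℝ) : ℂ) := by
    push_cast
    exact Finset.sum_congr rfl fun _ _ => Complex.mul_conj' _
  have ht2 : ‖t‖ ^ 2 ≤ A * ∑ k, ‖w k z‖ ^ 2 := by
    have h3 : ‖t‖ ≤ ∑ k, ‖z k‖ * ‖w k z‖ := by
      refine (norm_sum_le _ _).trans (le_of_eq (Finset.sum_congr rfl fun k _ => ?_))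
      rw [norm_mul, RCLike.norm_conj]
    have h4 : (∑ k, ‖z k‖ * ‖w k z‖) ^ 2 ≤ (∑ k, ‖z k‖ ^ 2) * ∑ k, ‖w k z‖ ^ 2 :=
      Finset.sum_mul_sq_le_sq_mul_sq _ _ _
    have h5 : ∑ k, ‖z k‖ ^ 2 ≤ A := by
      refine le_trans (le_of_eq (Finset.sum_congr rfl fun k _ => ?_)) h2
      rw [← Complex.normSq_eq_norm_sq]; simp
    have h6 : 0 ≤ ∑ k, ‖w k z‖ ^ 2 := Finset.sum_nonneg fun _ _ => by positivity
    calc ‖t‖ ^ 2 ≤ (∑ k, ‖z k‖ * ‖w k z‖) ^ 2 := by gcongr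
      _ ≤ _ := h4
      _ ≤ _ := by gcongr
  rw [hs, hw2, Complex.mul_conj']
  set W := ∑ k, ‖w k z‖ ^ 2
  have e1 : (toC (multiplier n A) z * (((‖δ‖ : ℝ) : ℂ) ^ 2)).re = multiplier n A z * ‖δ‖ ^ 2 := by
    rw [← Complex.ofReal_pow]
    simp only [toC]
    rw [← Complex.ofReal_mul, Complex.ofReal_re]
  have e2 : (toC (multiplier n A) z * X).re = multiplier n A z * X.re := by
    simp only [toC, Complex.re_ofReal_mul]
  have e3 : -(δ * conj t).re ≤ ‖δ‖ * ‖t‖ := by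
    have := (neg_le_abs _).trans (Complex.abs_re_le_norm (δ * conj t))
    rwa [norm_mul, RCLike.norm_conj] at this
  have e4 : -(conj δ * t).re ≤ ‖δ‖ * ‖t‖ := by
    have := (neg_le_abs _).trans (Complex.abs_re_le_norm (conj δ * t))
    rwa [norm_mul, RCLike.norm_conj] at this
  simp only [Complex.sub_re, Complex.ofReal_re, e1, e2]
  have hδ : 0 ≤ ‖δ‖ ^ 2 := by positivity
  have e5 : 2 * (‖δ‖ * ‖t‖) ≤ 2 * A * ‖δ‖ ^ 2 + 1 / 2 * W := by
    have hA0 : 0 < A := by linarith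
    have h7 : ‖t‖ ^ 2 / A ≤ W := by rw [div_le_iff₀ hA0]; linarith
    have h8 : 2 * (‖δ‖ * ‖t‖) ≤ 2 * A * ‖δ‖ ^ 2 + 1 / 2 * (‖t‖ ^ 2 / A) := by
      have : 2 * A * ‖δ‖ ^ 2 + 1 / 2 * (‖t‖ ^ 2 / A) - 2 * (‖δ‖ * ‖t‖) =
          (2 * A * ‖δ‖ - ‖t‖) ^ 2 / (2 * A) := by field_simp; ring
      have h9 : 0 ≤ (2 * A * ‖δ‖ - ‖t‖) ^ 2 / (2 * A) := by positivity
      linarith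
    linarith
  have e6 : multiplier n A z * ‖δ‖ ^ 2 ≤ A * ‖δ‖ ^ 2 := by gcongr
  linarith

/-- The flux of `F` vanishes because `w` is tangential. Since `∑_k (∂ρ/∂z_k) w_k` vanishes along the
boundary, its `∂/∂z̄_j` derivatives are `μ ∂ρ/∂z̄_j`, and pairing these with `conj w_j` gives zero
by tangency again. So the flux of `G` is the multiplier times the conjugate of the Levi form at `w`,
which is where pseudoconvexity enters. -/
theorem boundary_field_nonneg (H : IsGlobalDefining Ω ρ) (hL : LeviNonneg Ω ρ)
    (hA : ∀ z ∈ closure Ω, 0 ≤ multiplier n A z)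
    (hN : ∀ z ∈ frontier Ω, ∑ k, dz k (toC ρ) z * w k z = 0) {z : Cn n} (hz : z ∈ frontier Ω) :
    0 ≤ (∑ j, (dz j (toC ρ) z * fieldF A w j z + dzbar j (toC ρ) z * fieldG A w j z)).re := by
  have hd := fun i => ContDiff.differentiableAt_of_smooth (hw i) z
  have hρd := fun i => ContDiff.differentiableAt_of_smooth
    (contDiff_dz i (contDiff_toC H.smooth)) z
  have hNs : ContDiff ℝ ∞ (fun z => ∑ k, dz k (toC ρ) z * w k z) :=
    ContDiff.sum fun k _ => (contDiff_dz k (contDiff_toC H.smooth)).mul (hw k)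
  obtain ⟨μ, hμ⟩ := exists_dzbar_eq_mul H hNs hN hz
  have hdN : ∀ j, ∑ k, (hess ρ k j z * w k z + dz k (toC ρ) z * dzbar j (w k) z) =
      μ * dzbar j (toC ρ) z := by
    intro j
    rw [← hμ j, dzbar_sum j _ fun k _ => (hρd k).fun_mul (hd k)]
    refine Finset.sum_congr rfl fun k _ => ?_
    rw [dzbar_mul j (hρd k) (hd k), hess, dz_dzbar_comm _ _ (contDiff_toC H.smooth)]
  have hρc : ∀ j, dzbar j (toC ρ) z = conj (dz j (toC ρ) z) := fun j =>
    dzbar_toC j (ContDiff.differentiableAt_of_smooth H.smooth z)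
  have h1 : ∑ j, dz j (toC ρ) z * fieldF A w j z = 0 := by
    simp only [fieldF, ← mul_assoc]
    rw [← Finset.sum_mul, hN z hz, zero_mul]
  set Λ := ∑ j, ∑ k, hess ρ j k z * w j z * conj (w k z) with hΛ
  have h2 : ∑ k, ∑ j, dz k (toC ρ) z * dzbar j (w k) z * conj (w j z) = -Λ := by
    have h3 : ∑ j, (∑ k, (hess ρ k j z * w k z + dz k (toC ρ) z * dzbar j (w k) z)) * conj (w j z)
        = 0 := by
      have h4 : ∑ j, (μ * dzbar j (toC ρ) z) * conj (w j z) =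
          μ * conj (∑ j, dz j (toC ρ) z * w j z) := by
        rw [map_sum, Finset.mul_sum]
        refine Finset.sum_congr rfl fun j _ => ?_
        rw [hρc, map_mul]; ring
      simp only [hdN]
      rw [h4, hN z hz]; simp
    simp only [Finset.sum_add_distrib, add_mul, Finset.sum_mul] at h3
    have e1 : ∑ j, ∑ k, hess ρ k j z * w k z * conj (w j z) = Λ := Finset.sum_comm
    have e2 : ∑ j, ∑ k, dz k (toC ρ) z * dzbar j (w k) z * conj (w j z) =
      ∑ k, ∑ j, dz k (toC ρ) z * dzbar j (w k) z * conj (w j z) := Finset.sum_comm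
    rw [e1, e2] at h3
    linear_combination h3
  have h5 : ∑ j, dzbar j (toC ρ) z * fieldG A w j z = toC (multiplier n A) z * conj Λ := by
    have h6 : conj Λ = -conj (∑ k, ∑ j, dz k (toC ρ) z * dzbar j (w k) z * conj (w j z)) := by
      rw [h2]; simp
    rw [h6]
    simp only [fieldG, map_sum, map_mul, Complex.conj_conj, Finset.mul_sum, hρc,
      ← Finset.sum_neg_distrib]
    refine Finset.sum_congr rfl fun k _ => Finset.sum_congr rfl fun j _ => by ring
  rw [Finset.sum_add_distrib, h1, h5, zero_add]
  simp only [toC, Complex.re_ofReal_mul, Complex.conj_re]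
  exact mul_nonneg (hA z (frontier_subset_closure hz))
    (hL z hz (fun j => w j z) (hN z hz))

theorem continuous_re_sum_dzbar_mul_conj : Continuous (fun z =>
    (∑ j, ∑ k, dzbar j (w k) z * conj (dzbar k (w j) z)).re) :=
  Complex.continuous_re.comp (continuous_finsetSum _ fun j _ => continuous_finsetSum _ fun k _ =>
    (contDiff_dzbar j (hw k)).continuous.mul (contDiff_conj (contDiff_dzbar k (hw j))).continuous)

theorem integral_vector_estimate (H : IsGlobalDefining Ω ρ) (hL : LeviNonneg Ω ρ)
    (hA1 : 1 ≤ A)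
    (hA : ∀ z ∈ closure Ω, 1 ≤ multiplier n A z ∧ multiplier n A z ≤ A ∧ distSq 0 z ≤ A)
    (hN : ∀ z ∈ frontier Ω, ∑ k, dz k (toC ρ) z * w k z = 0) :
    0 ≤ ∫ z in Ω, (3 * A * ‖∑ k, dz k (w k) z‖ ^ 2 - 1 / 2 * ∑ k, ‖w k z‖ ^ 2 -
      multiplier n A z * (∑ j, ∑ k, dzbar j (w k) z * conj (dzbar k (w j) z)).re) := by
  have h := integral_div_nonneg H (contDiff_fieldF hw A) (contDiff_fieldG hw A) fun z hz =>
    boundary_field_nonneg hw A H hL (fun z hz => zero_le_one.trans (hA z hz).1) hN hz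
  have hc : Continuous (fun z => ∑ j, (dz j (fieldF A w j) z + dzbar j (fieldG A w j) z)) :=
    continuous_finsetSum _ fun j _ => (contDiff_dz j (contDiff_fieldF hw A j)).continuous.add
      (contDiff_dzbar j (contDiff_fieldG hw A j)).continuous
  have e : ∫ z in Ω, (∑ j, (dz j (fieldF A w j) z + dzbar j (fieldG A w j) z)).re =
      (∫ z in Ω, ∑ j, (dz j (fieldF A w j) z + dzbar j (fieldG A w j) z)).re :=
    integral_re (𝕜 := ℂ) (integrableOn_of_continuous H.bounded hc)
  rw [← e] at h
  refine h.trans (setIntegral_mono_on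
    (integrableOn_of_continuous H.bounded (Complex.continuous_re.comp hc))
    (integrableOn_of_continuous H.bounded ?_) H.isOpen.measurableSet fun z hz =>
      re_div_field_le hw A z hA1 (hA z (subset_closure hz)).2.1 (hA z (subset_closure hz)).2.2)
  exact ((continuous_const.mul ((contDiff_div hw).continuous.norm.pow 2)).sub
    (continuous_const.mul (continuous_finsetSum _ fun k _ => (hw k).continuous.norm.pow 2))).sub
    ((contDiff_multiplier A).continuous.mul (continuous_re_sum_dzbar_mul_conj hw))

end BasicEstimate

/-! ### From the vector field estimate to forms -/

section BasicEstimateForms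

variable {n m : ℕ} {Ω : Set (Cn n)} {ρ : Cn n → ℝ}

theorem sum_normSq_dbar_eq {u : Coeffs n (m + 1)} (hu : IsForm u)
    (hus : ∀ J, ContDiff ℝ ∞ (u J)) (z : Cn n) :
    ∑ J, ‖dbar u J z‖ ^ 2 = (m + 2) * (∑ j, ∑ L, ‖dzbar j (u L) z‖ ^ 2 -
      (m + 1) * ∑ K : Fin m → Fin n, (∑ j, ∑ k, dzbar j (u (consIdx k K)) z *
        conj (dzbar k (u (consIdx j K)) z)).re) := by
  have h := sum_wedge_mul_conj (D := fun j L => dzbar j (u L) z) fun j => hu.dzbar_skew hus j z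
  simp only [Complex.mul_conj', ← dbar_eq_wedge] at h
  have h2 := congrArg Complex.re h
  have e : ((m : ℂ) + 2) * (∑ j, ∑ L, ((‖dzbar j (u L) z‖ : ℝ) : ℂ) ^ 2 -
      (m + 1) * ∑ K : Fin m → Fin n, ∑ j, ∑ k, dzbar j (u (consIdx k K)) z *
        conj (dzbar k (u (consIdx j K)) z)) =
      ((m + 2 : ℝ) : ℂ) * (((∑ j, ∑ L, ‖dzbar j (u L) z‖ ^ 2 : ℝ) : ℂ) -
      ((m + 1 : ℝ) : ℂ) * ∑ K : Fin m → Fin n, ∑ j, ∑ k, dzbar j (u (consIdx k K)) z *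
        conj (dzbar k (u (consIdx j K)) z)) := by push_cast; rfl
  rw [e, Complex.re_ofReal_mul, Complex.sub_re, Complex.re_ofReal_mul, Complex.ofReal_re,
    Complex.re_sum] at h2
  rw [← Complex.re_sum, ← h2]
  refine Finset.sum_congr rfl fun J _ => ?_
  rw [← Complex.ofReal_pow, Complex.ofReal_re]

/-- Here `W` is `|u|²`, `D` the barred gradient, `Q` is `|∂̄u|²`, `S` the squared divergence, `X`
the cross terms and `a` the multiplier. Solving `hq` for `(m + 1)X` turns `2(m + 1)aX` into `2aD`
minus a multiple of `Q`, and `a ≥ 1` recovers `D`. -/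
theorem basic_estimate_aux {m A a D Q W S X : ℝ} (hm : 0 ≤ m) (ha1 : 1 ≤ a) (ha2 : a ≤ A)
    (hD : 0 ≤ D) (hQ : 0 ≤ Q) (hW : 0 ≤ W) (hq : Q = (m + 2) * (D - (m + 1) * X)) :
    W + D ≤ 6 * A * (m + 1) * (Q + S) -
      2 * (m + 1) * (3 * A * S - 1 / 2 * W - a * X) := by
  have hX : (m + 1) * X = D - Q / (m + 2) := by
    rw [hq]; field_simp; ring
  have h0 : 0 ≤ Q / (m + 2) := by positivity
  have h1 : a * (Q / (m + 2)) ≤ A * Q :=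
    mul_le_mul ha2 (div_le_self hQ (by linarith)) h0 (by linarith)
  have h2 : D ≤ a * D := le_mul_of_one_le_left hD ha1
  have h3 : 0 ≤ m * W := by positivity
  have h6 : 0 ≤ A * Q := mul_nonneg (by linarith) hQ
  have h4 : 0 ≤ m * (A * Q) := mul_nonneg hm h6
  have h5 : (m + 1) * (a * X) = a * D - a * (Q / (m + 2)) := by
    linear_combination a * hX
  linarith

/-- The basic estimate for `∂̄ ⊕ ∂̄*` on a bounded pseudoconvex domain, including the barred
derivatives. -/
theorem exists_basic_estimate (H : IsGlobalDefining Ω ρ) (hL : LeviNonneg Ω ρ) (m : ℕ) :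
    ∃ C : ℝ, 0 < C ∧ ∀ (u : Coeffs n (m + 1)) (g : Coeffs n m), IsForm u →
      (∀ J, ContDiff ℝ ∞ (u J)) → HasDbarStar Ω u g →
      ∫ z in Ω, (∑ J, ‖u J z‖ ^ 2 + ∑ j, ∑ J, ‖dzbar j (u J) z‖ ^ 2) ≤
        C * ((∑ J, ∫ z in Ω, ‖dbar u J z‖ ^ 2) + ∑ K, ∫ z in Ω, ‖g K z‖ ^ 2) := by
  obtain ⟨A, hA1, hA⟩ := exists_multiplier_bounds H.bounded
  refine ⟨6 * A * (m + 1), by positivity, fun u g hu hus hg => ?_⟩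
  have hdiv := sum_integral_divForm_le H hu hus hg
  -- For each fixed `K` the coefficients `u_{jK}` form a vector field, tangential on the boundary
  -- because the normal part vanishes there.
  have hv := fun K : Fin m → Fin n => integral_vector_estimate (w := fun j => u (consIdx j K))
    (fun j => hus _) A H hL hA1 hA (fun z hz => normalPart_eq_zero H hu hus hg hz K)
  have hsum := Finset.sum_nonneg fun (K : Fin m → Fin n) (_ : K ∈ Finset.univ) => hv K
  have c1 : ∀ K : Fin m → Fin n, Continuous (fun z => ‖divForm u K z‖ ^ 2) := fun K =>
    (contDiff_divForm hus K).continuous.norm.pow 2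
  have c2 : ∀ J, Continuous (fun z => ‖u J z‖ ^ 2) := fun J => (hus J).continuous.norm.pow 2
  have c3 : ∀ j J, Continuous (fun z => ‖dzbar j (u J) z‖ ^ 2) := fun j J =>
    (contDiff_dzbar j (hus J)).continuous.norm.pow 2
  have c4 : ∀ J, Continuous (fun z => ‖dbar u J z‖ ^ 2) := fun J =>
    (contDiff_dbar hus J).continuous.norm.pow 2
  rw [← integral_finsetSum] at hsum
  swap
  · intro K _
    exact integrableOn_of_continuous H.bounded (((continuous_const.mul (c1 K)).sub
      (continuous_const.mul (continuous_finsetSum _ fun k _ => c2 _))).sub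
      ((contDiff_multiplier A).continuous.mul
        (continuous_re_sum_dzbar_mul_conj fun j => hus (consIdx j K))))
  -- The bracket subtracted on the right has a nonnegative integral by `hsum`, so it can be dropped
  -- after integration.
  have hle : ∫ z in Ω, (∑ J, ‖u J z‖ ^ 2 + ∑ j, ∑ J, ‖dzbar j (u J) z‖ ^ 2) ≤
      ∫ z in Ω, ((6 * A * (m + 1)) * (∑ J, ‖dbar u J z‖ ^ 2 + ∑ K, ‖divForm u K z‖ ^ 2) -
        (2 * (m + 1)) * ∑ K : Fin m → Fin n, (3 * A * ‖∑ k, dz k (u (consIdx k K)) z‖ ^ 2 -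
          1 / 2 * ∑ k, ‖u (consIdx k K) z‖ ^ 2 -
          multiplier n A z * (∑ j, ∑ k, dzbar j (u (consIdx k K)) z *
            conj (dzbar k (u (consIdx j K)) z)).re)) := by
    refine setIntegral_mono_on ?_ ?_ H.isOpen.measurableSet fun z hz => ?_
    · exact integrableOn_of_continuous H.bounded ((continuous_finsetSum _ fun J _ => c2 J).add
        (continuous_finsetSum _ fun j _ => continuous_finsetSum _ fun J _ => c3 j J))
    · refine integrableOn_of_continuous H.bounded ((continuous_const.mul
        ((continuous_finsetSum _ fun J _ => c4 J).add
          (continuous_finsetSum _ fun K _ => c1 K))).sub (continuous_const.mul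
            (continuous_finsetSum _ fun K _ => ?_)))
      exact (((continuous_const.mul (c1 K)).sub
        (continuous_const.mul (continuous_finsetSum _ fun k _ => c2 _))).sub
        ((contDiff_multiplier A).continuous.mul
          (continuous_re_sum_dzbar_mul_conj fun j => hus (consIdx j K))))
    · obtain ⟨ha1, ha2, -⟩ := hA z (subset_closure hz)
      have hq := sum_normSq_dbar_eq hu hus z
      rw [sum_consIdx (fun J => ‖u J z‖ ^ 2)]
      simp only [Finset.sum_sub_distrib, ← Finset.mul_sum]
      rw [Finset.sum_comm (f := fun (K : Fin m → Fin n) k => ‖u (consIdx k K) z‖ ^ 2)]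
      have hdf : ∑ K : Fin m → Fin n, ‖∑ k, dz k (u (consIdx k K)) z‖ ^ 2 =
        ∑ K, ‖divForm u K z‖ ^ 2 := rfl
      rw [hdf]
      exact basic_estimate_aux (Nat.cast_nonneg m) ha1 ha2
        (Finset.sum_nonneg fun _ _ => Finset.sum_nonneg fun _ _ => by positivity)
        (Finset.sum_nonneg fun _ _ => by positivity)
        (Finset.sum_nonneg fun _ _ => Finset.sum_nonneg fun _ _ => by positivity) hq
  refine hle.trans ?_
  rw [integral_sub, integral_const_mul, integral_const_mul, integral_add, integral_finsetSum,
    integral_finsetSum]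
  · have h7 : 0 ≤ 6 * A * ((m : ℝ) + 1) := by positivity
    have h8 := mul_nonneg (show (0 : ℝ) ≤ 2 * (m + 1) by positivity) hsum
    have h9 := mul_le_mul_of_nonneg_left hdiv h7
    linarith
  · exact fun K _ => integrableOn_of_continuous H.bounded (c1 K)
  · exact fun J _ => integrableOn_of_continuous H.bounded (c4 J)
  · exact integrableOn_of_continuous H.bounded (continuous_finsetSum _ fun J _ => c4 J)
  · exact integrableOn_of_continuous H.bounded (continuous_finsetSum _ fun J _ => c1 J)
  · exact integrableOn_of_continuous H.bounded (continuous_const.mul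
      ((continuous_finsetSum _ fun J _ => c4 J).add (continuous_finsetSum _ fun K _ => c1 K)))
  · refine integrableOn_of_continuous H.bounded (continuous_const.mul
      (continuous_finsetSum _ fun K _ => ?_))
    exact (((continuous_const.mul (c1 K)).sub
      (continuous_const.mul (continuous_finsetSum _ fun k _ => c2 _))).sub
      ((contDiff_multiplier A).continuous.mul
        (continuous_re_sum_dzbar_mul_conj fun j => hus (consIdx j K))))

end BasicEstimateForms

/-! ### Duality between `W^{-1}` and functions vanishing on the boundary -/

section Duality

variable {n : ℕ} {Ω : Set (Cn n)} {ρ : Cn n → ℝ} {f g φ : Cn n → ℂ}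

/-- Needed for `sobNegOne` to be a genuine supremum: on an unbounded set the real `sSup` takes the
default value `0`. -/
theorem bddAbove_sobNegOne (hb : Bornology.IsBounded Ω) (hg : Continuous g) :
    BddAbove {r : ℝ | ∃ φ : Cn n → ℂ, IsTest Ω φ ∧ sobOneSq Ω φ ≤ 1 ∧
      r = ‖∫ z in Ω, g z * φ z‖} := by
  refine ⟨(∫ z in Ω, ‖g z‖ ^ 2) + 1, ?_⟩
  rintro r ⟨φ, hφ, h1, rfl⟩
  have hgi : IntegrableOn (fun z => ‖g z‖ ^ 2) Ω :=
    integrableOn_of_continuous hb (hg.norm.pow 2)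
  have hφi : IntegrableOn (fun z => ‖φ z‖ ^ 2) Ω :=
    integrableOn_of_continuous hb (hφ.1.continuous.norm.pow 2)
  have h2 : ∫ z in Ω, ‖φ z‖ ^ 2 ≤ 1 := by
    refine le_trans ?_ h1
    refine le_add_of_nonneg_right (Finset.sum_nonneg fun j _ => ?_)
    exact add_nonneg (integral_nonneg fun _ => by positivity)
      (integral_nonneg fun _ => by positivity)
  calc ‖∫ z in Ω, g z * φ z‖ ≤ ∫ z in Ω, ‖g z * φ z‖ := norm_integral_le_integral_norm _
    _ ≤ ∫ z in Ω, (‖g z‖ ^ 2 + ‖φ z‖ ^ 2) := by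
        refine integral_mono (integrableOn_mul_of_continuous hb hg hφ.1.continuous).norm
          (hgi.add hφi) fun z => ?_
        simp only [norm_mul]
        nlinarith [sq_nonneg (‖g z‖ - ‖φ z‖), sq_nonneg (‖g z‖), sq_nonneg (‖φ z‖)]
    _ = (∫ z in Ω, ‖g z‖ ^ 2) + ∫ z in Ω, ‖φ z‖ ^ 2 := integral_add hgi hφi
    _ ≤ _ := by linarith

theorem sobOneSq_const_mul (hφ : ContDiff ℝ ∞ φ) (t : ℝ) :
    sobOneSq Ω (fun z => (t : ℂ) * φ z) = t ^ 2 * sobOneSq Ω φ := by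
  have hd : ∀ z v, fderiv ℝ (fun z => (t : ℂ) * φ z) z v = t * fderiv ℝ φ z v := by
    intro z v
    rw [(((ContDiff.differentiableAt_of_smooth hφ z).hasFDerivAt).const_mul (t : ℂ)).fderiv]
    simp
  have hn : ∀ x : ℂ, ‖(t : ℂ) * x‖ ^ 2 = t ^ 2 * ‖x‖ ^ 2 := by
    intro x
    rw [norm_mul, mul_pow, Complex.norm_real, Real.norm_eq_abs, sq_abs]
  simp only [sobOneSq, dx, dy, hd, hn, integral_const_mul, mul_add, Finset.mul_sum]

theorem norm_integral_mul_test_le (hb : Bornology.IsBounded Ω) (hg : Continuous g)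
    (hφ : IsTest Ω φ) {S : ℝ} (hS : 0 < S) (h : sobOneSq Ω φ ≤ S) :
    ‖∫ z in Ω, g z * φ z‖ ^ 2 ≤ sobNegOne Ω g ^ 2 * S := by
  set t := (Real.sqrt S)⁻¹ with ht
  have hsq : 0 < Real.sqrt S := Real.sqrt_pos.2 hS
  have ht2 : t ^ 2 = S⁻¹ := by rw [ht, inv_pow, Real.sq_sqrt hS.le]
  have htest : IsTest Ω (fun z => (t : ℂ) * φ z) := by
    have := hφ.mul_right (F := fun _ => (t : ℂ)) contDiff_const
    simpa only [mul_comm] using this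
  have hle : ‖∫ z in Ω, g z * ((t : ℂ) * φ z)‖ ≤ sobNegOne Ω g := by
    refine le_csSup (bddAbove_sobNegOne hb hg) ⟨_, htest, ?_, rfl⟩
    rw [sobOneSq_const_mul hφ.1, ht2, inv_mul_le_iff₀ hS, mul_one]
    exact h
  have he : ∫ z in Ω, g z * ((t : ℂ) * φ z) = t * ∫ z in Ω, g z * φ z := by
    rw [← integral_const_mul]
    exact integral_congr_ae (ae_of_all _ fun z => by simp only; ring)
  rw [he, norm_mul, Complex.norm_real, Real.norm_of_nonneg (by positivity)] at hle
  have h2 := pow_le_pow_left₀ (by positivity) hle 2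
  rw [mul_pow, ht2, inv_mul_le_iff₀ hS] at h2
  linarith

/-- Truncations of `f` that vanish where `f` is small. -/
def truncation (f : Cn n → ℂ) (κ : ℕ) (z : Cn n) : ℂ :=
  ((step (κ * Complex.normSq (f z)) : ℝ) : ℂ) * f z

theorem contDiff_normSq (hf : ContDiff ℝ ∞ f) : ContDiff ℝ ∞ (fun z => Complex.normSq (f z)) := by
  have h2 : ContDiff ℝ ∞ (fun z : Cn n => (f z * conj (f z)).re) :=
    Complex.reCLM.contDiff.comp (hf.mul (contDiff_conj hf))
  simpa only [Complex.mul_conj, Complex.ofReal_re] using h2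

theorem contDiff_truncation (hf : ContDiff ℝ ∞ f) (κ : ℕ) : ContDiff ℝ ∞ (truncation f κ) :=
  (contDiff_toC (contDiff_step.comp (contDiff_const.mul (contDiff_normSq hf)))).mul hf

theorem isTest_truncation (hΩ : IsOpen Ω) (hb : Bornology.IsBounded Ω) (hf : ContDiff ℝ ∞ f)
    (h0 : ∀ z ∈ frontier Ω, f z = 0) (κ : ℕ) : IsTest Ω (Ω.indicator (truncation f κ)) := by
  refine isTest_indicator hΩ hb (contDiff_truncation hf κ) fun p hp => ?_
  have hc : ContinuousAt (fun z => (κ : ℝ) * Complex.normSq (f z)) p :=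
    (continuous_const.mul (contDiff_normSq hf).continuous).continuousAt
  have : (fun z => (κ : ℝ) * Complex.normSq (f z)) p < 1 := by simp [h0 p hp]
  filter_upwards [hc.eventually_lt_const this] with z hz
  rw [truncation, step_of_le hz.le]; simp

theorem hasFDerivAt_normSq (hf : ContDiff ℝ ∞ f) (z v : Cn n) :
    |fderiv ℝ (fun z => Complex.normSq (f z)) z v| ≤ 2 * ‖f z‖ * ‖fderiv ℝ f z v‖ := by
  have hd := ContDiff.differentiableAt_of_smooth hf z
  have hdc := ContDiff.differentiableAt_of_smooth (contDiff_conj hf) z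
  have h1 : (((fderiv ℝ (fun z => Complex.normSq (f z)) z v : ℝ)) : ℂ) =
      f z * conj (fderiv ℝ f z v) + conj (f z) * fderiv ℝ f z v := by
    rw [← fderiv_toC (ContDiff.differentiableAt_of_smooth (contDiff_normSq hf) z)]
    have : toC (fun z => Complex.normSq (f z)) = fun z => f z * conj (f z) := by
      funext z; simp [toC, Complex.mul_conj]
    rw [this, fderiv_fun_mul hd hdc]
    simp [fderiv_conj hd]
  rw [← Real.norm_eq_abs, ← Complex.norm_real, h1]
  refine (norm_add_le _ _).trans (le_of_eq ?_)
  simp only [norm_mul, RCLike.norm_conj]; ring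

/-- With `t = κ|f|²`, differentiating the cutoff contributes at most `2 t h'(t) |df|`, bounded
independently of `κ`. -/
theorem norm_fderiv_truncation_le {B : ℝ} (hB : ∀ t, 0 ≤ t → t * deriv step t ≤ B)
    (hf : ContDiff ℝ ∞ f) (κ : ℕ) (z v : Cn n) :
    ‖fderiv ℝ (truncation f κ) z v‖ ≤ (1 + 2 * B) * ‖fderiv ℝ f z v‖ := by
  have hs : ContDiff ℝ ∞ (fun z => step (κ * Complex.normSq (f z))) :=
    contDiff_step.comp (contDiff_const.mul (contDiff_normSq hf))
  have hd := ContDiff.differentiableAt_of_smooth hf z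
  have hds := ContDiff.differentiableAt_of_smooth hs z
  have hdn := ContDiff.differentiableAt_of_smooth (contDiff_normSq hf) z
  have h1 : fderiv ℝ (fun z => step (κ * Complex.normSq (f z))) z v =
      deriv step (κ * Complex.normSq (f z)) *
        (κ * fderiv ℝ (fun z => Complex.normSq (f z)) z v) := by
    have := (hasDerivAt_step (κ * Complex.normSq (f z))).comp_hasFDerivAt z
      (hdn.hasFDerivAt.const_mul (κ : ℝ))
    have h2 : HasFDerivAt (fun z => step (κ * Complex.normSq (f z))) _ z := this
    rw [h2.fderiv]; simp
  have h3 : fderiv ℝ (truncation f κ) z v =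
      ((step (κ * Complex.normSq (f z)) : ℝ) : ℂ) * fderiv ℝ f z v +
        f z * ((fderiv ℝ (fun z => step (κ * Complex.normSq (f z))) z v : ℝ) : ℂ) := by
    have : truncation f κ = fun z => toC (fun z => step (κ * Complex.normSq (f z))) z * f z := rfl
    rw [this, fderiv_fun_mul (ContDiff.differentiableAt_of_smooth (contDiff_toC hs) z) hd]
    simp [fderiv_toC hds, toC]
  set t := (κ : ℝ) * Complex.normSq (f z) with ht
  have ht0 : 0 ≤ t := mul_nonneg (Nat.cast_nonneg _) (Complex.normSq_nonneg _)
  have hds0 := deriv_step_nonneg t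
  rw [h3, h1]
  refine (norm_add_le _ _).trans ?_
  rw [norm_mul, norm_mul, Complex.norm_real, Complex.norm_real, Real.norm_of_nonneg (step_nonneg _),
    Real.norm_eq_abs, abs_mul, abs_mul, abs_of_nonneg hds0, abs_of_nonneg (Nat.cast_nonneg κ)]
  have h4 := hasFDerivAt_normSq hf z v
  have h5 : step t * ‖fderiv ℝ f z v‖ ≤ 1 * ‖fderiv ℝ f z v‖ := by
    gcongr; exact step_le_one t
  have h6 : ‖f z‖ * (deriv step t * (κ * |fderiv ℝ (fun z => Complex.normSq (f z)) z v|)) ≤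
      2 * (t * deriv step t) * ‖fderiv ℝ f z v‖ := by
    calc _ ≤ ‖f z‖ * (deriv step t * (κ * (2 * ‖f z‖ * ‖fderiv ℝ f z v‖))) := by gcongr
      _ = 2 * (t * deriv step t) * ‖fderiv ℝ f z v‖ := by
        rw [ht, Complex.normSq_eq_norm_sq]; ring
  have h7 : 2 * (t * deriv step t) * ‖fderiv ℝ f z v‖ ≤ 2 * B * ‖fderiv ℝ f z v‖ := by
    gcongr; exact hB t ht0
  linarith

theorem sobOneSq_truncation_le {B : ℝ} (hB0 : 0 ≤ B)
    (hB : ∀ t, 0 ≤ t → t * deriv step t ≤ B) (hΩ : IsOpen Ω) (hb : Bornology.IsBounded Ω)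
    (hf : ContDiff ℝ ∞ f) (κ : ℕ) :
    sobOneSq Ω (Ω.indicator (truncation f κ)) ≤ (1 + 2 * B) ^ 2 * sobOneSq Ω f := by
  have hev : ∀ z ∈ Ω, Ω.indicator (truncation f κ) =ᶠ[𝓝 z] truncation f κ := by
    intro z hz
    filter_upwards [hΩ.mem_nhds hz] with y hy
    exact Set.indicator_of_mem hy _
  have hc : Continuous (truncation f κ) := (contDiff_truncation hf κ).continuous
  have hder : ∀ v, ∫ z in Ω, ‖fderiv ℝ (Ω.indicator (truncation f κ)) z v‖ ^ 2 ≤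
      (1 + 2 * B) ^ 2 * ∫ z in Ω, ‖fderiv ℝ f z v‖ ^ 2 := by
    intro v
    rw [← integral_const_mul, setIntegral_congr_fun (g := fun z =>
      ‖fderiv ℝ (truncation f κ) z v‖ ^ 2) hΩ.measurableSet fun z hz => by
        simp only [(hev z hz).fderiv_eq]]
    refine integral_mono (integrableOn_of_continuous hb
      ((contDiff_fderiv_apply (contDiff_truncation hf κ) v).continuous.norm.pow 2))
      (integrableOn_of_continuous hb
        (continuous_const.mul ((contDiff_fderiv_apply hf v).continuous.norm.pow 2))) fun z => ?_
    simp only [← mul_pow]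
    exact pow_le_pow_left₀ (norm_nonneg _) (norm_fderiv_truncation_le hB hf κ z v) 2
  have h0 : ∫ z in Ω, ‖Ω.indicator (truncation f κ) z‖ ^ 2 ≤
      (1 + 2 * B) ^ 2 * ∫ z in Ω, ‖f z‖ ^ 2 := by
    rw [← integral_const_mul, setIntegral_congr_fun (g := fun z =>
      ‖truncation f κ z‖ ^ 2) hΩ.measurableSet fun z hz => by
        simp only [Set.indicator_of_mem hz]]
    refine integral_mono (integrableOn_of_continuous hb (hc.norm.pow 2))
      (integrableOn_of_continuous hb
        (continuous_const.mul (hf.continuous.norm.pow 2))) fun z => ?_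
    simp only [← mul_pow]
    refine pow_le_pow_left₀ (norm_nonneg _) ?_ 2
    rw [truncation, norm_mul, Complex.norm_real, Real.norm_of_nonneg (step_nonneg _)]
    gcongr
    exact (step_le_one _).trans (by linarith)
  simp only [sobOneSq, dx, dy, mul_add, Finset.mul_sum]
  exact add_le_add h0 (Finset.sum_le_sum fun j _ => add_le_add (hder _) (hder _))

theorem tendsto_integral_mul_truncation (hΩ : IsOpen Ω) (hb : Bornology.IsBounded Ω)
    (hg : Continuous g) (hf : ContDiff ℝ ∞ f) :
    Tendsto (fun κ => ∫ z in Ω, g z * Ω.indicator (truncation f κ) z) atTop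
      (𝓝 (∫ z in Ω, g z * f z)) := by
  have hi := integrableOn_mul_of_continuous hb hg hf.continuous
  refine (tendsto_integral_of_dominated_convergence (fun z => ‖g z * f z‖)
    (F := fun κ z => g z * truncation f κ z) (fun κ => ?_) hi.norm
    (fun κ => ae_of_all _ fun z => ?_) (ae_of_all _ fun z => ?_)).congr fun κ => ?_
  · exact (hg.mul (contDiff_truncation hf κ).continuous).aestronglyMeasurable
  · rw [norm_mul, norm_mul, truncation, norm_mul, Complex.norm_real,
      Real.norm_of_nonneg (step_nonneg _)]
    gcongr
    exact mul_le_of_le_one_left (norm_nonneg _) (step_le_one _)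
  · by_cases h0 : f z = 0
    · simp [truncation, h0]
    · have hpos : 0 < Complex.normSq (f z) := Complex.normSq_pos.2 h0
      refine tendsto_const_nhds.congr' ?_
      obtain ⟨N, hN⟩ := exists_nat_gt (2 / Complex.normSq (f z))
      filter_upwards [eventually_ge_atTop N] with κ hκ
      have h1 : (N : ℝ) ≤ κ := by exact_mod_cast hκ
      have h2 : 2 / Complex.normSq (f z) < κ := hN.trans_le h1
      rw [div_lt_iff₀ hpos] at h2
      rw [truncation, step_of_ge h2.le]; simp
  · exact setIntegral_congr_fun hΩ.measurableSet fun z hz => by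
      simp only [Set.indicator_of_mem hz]

/-- The pairing with test functions extends to smooth functions that merely vanish on the boundary:
their truncations are test functions, bounded in `W¹` uniformly in `κ`, and the integrals converge.
Truncating by the size of `f` requires no estimate of `f` in terms of `ρ`. -/
theorem exists_norm_integral_mul_le (hΩ : IsOpen Ω) (hb : Bornology.IsBounded Ω) :
    ∃ B : ℝ, 0 < B ∧ ∀ g f : Cn n → ℂ, Continuous g → ContDiff ℝ ∞ f →
      (∀ z ∈ frontier Ω, f z = 0) → ∀ S : ℝ, 0 < S → sobOneSq Ω f ≤ S →
        ‖∫ z in Ω, g z * f z‖ ^ 2 ≤ sobNegOne Ω g ^ 2 * (B * S) := by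
  obtain ⟨B, hB0, hB⟩ := exists_bound_deriv_step
  refine ⟨(1 + 2 * B) ^ 2, by positivity, fun g f hg hf h0 S hS hfS => ?_⟩
  refine le_of_tendsto ((tendsto_integral_mul_truncation hΩ hb hg hf).norm.pow 2)
    (Eventually.of_forall fun κ => ?_)
  refine norm_integral_mul_test_le hb hg (isTest_truncation hΩ hb hf h0 κ) (by positivity) ?_
  exact (sobOneSq_truncation_le hB0.le hB hΩ hb hf κ).trans (by gcongr)

/-- The field `(f conj(∂f), -f conj(∂̄f))` vanishes on the boundary, and in its divergence the
second-order terms cancel because mixed derivatives commute. -/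
theorem sum_integral_dz_eq_dzbar (H : IsGlobalDefining Ω ρ) (hf : ContDiff ℝ ∞ f)
    (h0 : ∀ z ∈ frontier Ω, f z = 0) :
    ∑ j, ∫ z in Ω, ‖dz j f z‖ ^ 2 = ∑ j, ∫ z in Ω, ‖dzbar j f z‖ ^ 2 := by
  have h := integral_div_eq_zero H (F := fun j z => f z * conj (dz j f z))
    (G := fun j z => -(f z * conj (dzbar j f z)))
    (fun j => hf.mul (contDiff_conj (contDiff_dz j hf)))
    (fun j => (hf.mul (contDiff_conj (contDiff_dzbar j hf))).neg)
    (fun z hz => by simp [h0 z hz])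
  have e : ∀ z, ∑ j, (dz j (fun z => f z * conj (dz j f z)) z +
      dzbar j (fun z => -(f z * conj (dzbar j f z))) z) =
      ((∑ j, (‖dz j f z‖ ^ 2 - ‖dzbar j f z‖ ^ 2) : ℝ) : ℂ) := by
    intro z
    have hd := ContDiff.differentiableAt_of_smooth hf z
    push_cast
    refine Finset.sum_congr rfl fun j _ => ?_
    have d1 := ContDiff.differentiableAt_of_smooth (contDiff_dz j hf) z
    have d2 := ContDiff.differentiableAt_of_smooth (contDiff_dzbar j hf) z
    have d1c := ContDiff.differentiableAt_of_smooth (contDiff_conj (contDiff_dz j hf)) z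
    have d2c := ContDiff.differentiableAt_of_smooth (contDiff_conj (contDiff_dzbar j hf)) z
    rw [dzbar_neg, dz_mul j hd d1c, dzbar_mul j hd d2c, dz_conj j d1, dzbar_conj j d2,
      dz_dzbar_comm j j hf, Complex.mul_conj', Complex.mul_conj']
    ring
  simp only [e] at h
  rw [integral_complex_ofReal, Complex.ofReal_re, integral_finsetSum] at h
  · rw [← sub_eq_zero, ← Finset.sum_sub_distrib, ← h]
    refine Finset.sum_congr rfl fun j _ => (integral_sub ?_ ?_).symm
    · exact integrableOn_of_continuous H.bounded ((contDiff_dz j hf).continuous.norm.pow 2)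
    · exact integrableOn_of_continuous H.bounded ((contDiff_dzbar j hf).continuous.norm.pow 2)
  · intro j _
    exact integrableOn_of_continuous H.bounded (((contDiff_dz j hf).continuous.norm.pow 2).sub
      ((contDiff_dzbar j hf).continuous.norm.pow 2))

theorem norm_add_sq_le_two (a b : ℂ) : ‖a + b‖ ^ 2 ≤ 2 * ‖a‖ ^ 2 + 2 * ‖b‖ ^ 2 := by
  have h := pow_le_pow_left₀ (norm_nonneg _) (norm_add_le a b) 2
  nlinarith [sq_nonneg (‖a‖ - ‖b‖)]

theorem norm_sub_sq_le_two (a b : ℂ) : ‖a - b‖ ^ 2 ≤ 2 * ‖a‖ ^ 2 + 2 * ‖b‖ ^ 2 := by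
  simpa [sub_eq_add_neg] using norm_add_sq_le_two a (-b)

/-- For each `j` the real derivatives cost at most `4|∂f|² + 4|∂̄f|²`; trading `∂̄f` for `∂f` after
integration gives the `8`. Only unbarred derivatives of `f` remain. -/
theorem sobOneSq_le (H : IsGlobalDefining Ω ρ) (hf : ContDiff ℝ ∞ f)
    (h0 : ∀ z ∈ frontier Ω, f z = 0) :
    sobOneSq Ω f ≤ ∫ z in Ω, (‖f z‖ ^ 2 + 8 * ∑ j, ‖dz j f z‖ ^ 2) := by
  have i1 : ∀ j, IntegrableOn (fun z => ‖dz j f z‖ ^ 2) Ω := fun j =>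
    integrableOn_of_continuous H.bounded ((contDiff_dz j hf).continuous.norm.pow 2)
  have i2 : ∀ j, IntegrableOn (fun z => ‖dzbar j f z‖ ^ 2) Ω := fun j =>
    integrableOn_of_continuous H.bounded ((contDiff_dzbar j hf).continuous.norm.pow 2)
  have i3 : ∀ v, IntegrableOn (fun z => ‖fderiv ℝ f z v‖ ^ 2) Ω := fun v =>
    integrableOn_of_continuous H.bounded ((contDiff_fderiv_apply hf v).continuous.norm.pow 2)
  have hx : ∀ j, ∫ z in Ω, ‖dx j f z‖ ^ 2 ≤
      2 * (∫ z in Ω, ‖dz j f z‖ ^ 2) + 2 * ∫ z in Ω, ‖dzbar j f z‖ ^ 2 := by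
    intro j
    rw [← integral_const_mul, ← integral_const_mul,
      ← integral_add ((i1 j).const_mul _) ((i2 j).const_mul _)]
    refine integral_mono (i3 _) (((i1 j).const_mul _).add ((i2 j).const_mul _)) fun z => ?_
    simp only [dx_eq]
    exact norm_add_sq_le_two _ _
  have hy : ∀ j, ∫ z in Ω, ‖dy j f z‖ ^ 2 ≤
      2 * (∫ z in Ω, ‖dz j f z‖ ^ 2) + 2 * ∫ z in Ω, ‖dzbar j f z‖ ^ 2 := by
    intro j
    rw [← integral_const_mul, ← integral_const_mul,
      ← integral_add ((i1 j).const_mul _) ((i2 j).const_mul _)]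
    refine integral_mono (i3 _) (((i1 j).const_mul _).add ((i2 j).const_mul _)) fun z => ?_
    simp only [dy_eq, norm_mul, Complex.norm_I, one_mul]
    exact norm_sub_sq_le_two _ _
  have hs := sum_integral_dz_eq_dzbar H hf h0
  have i4 : IntegrableOn (fun z => ‖f z‖ ^ 2) Ω :=
    integrableOn_of_continuous H.bounded (hf.continuous.norm.pow 2)
  have i5 : IntegrableOn (fun z => 8 * ∑ j, ‖dz j f z‖ ^ 2) Ω :=
    integrableOn_of_continuous H.bounded (continuous_const.mul (continuous_finsetSum _ fun j _ =>
      (contDiff_dz j hf).continuous.norm.pow 2))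
  rw [integral_add i4 i5, integral_const_mul,
    integral_finsetSum _ fun j _ => i1 j, sobOneSq]
  have : ∑ j, ((∫ z in Ω, ‖dx j f z‖ ^ 2) + ∫ z in Ω, ‖dy j f z‖ ^ 2) ≤
      ∑ j, (4 * (∫ z in Ω, ‖dz j f z‖ ^ 2) + 4 * ∫ z in Ω, ‖dzbar j f z‖ ^ 2) :=
    Finset.sum_le_sum fun j _ => by linarith [hx j, hy j]
  simp only [Finset.sum_add_distrib, ← Finset.mul_sum, ← hs] at this ⊢
  linarith

end Duality

/-! ### The normal part is of lower order -/

section NormalPart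

variable {n m : ℕ} {Ω : Set (Cn n)} {ρ : Cn n → ℝ}

theorem exists_bound_derivatives (H : IsGlobalDefining Ω ρ) :
    ∃ M : ℝ, 0 < M ∧ ∀ z ∈ closure Ω, ∀ i l, ‖dz l (toC ρ) z‖ ≤ M ∧
      ‖dz i (dz l (toC ρ)) z‖ ≤ M ∧ ‖dzbar i (dz l (toC ρ)) z‖ ≤ M := by
  have hρ := contDiff_toC H.smooth
  have c1 : ∀ l, Continuous (fun z => ‖dz l (toC ρ) z‖) := fun l =>
    (contDiff_dz l hρ).continuous.norm
  have c2 : ∀ i l, Continuous (fun z => ‖dz i (dz l (toC ρ)) z‖) := fun i l =>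
    (contDiff_dz i (contDiff_dz l hρ)).continuous.norm
  have c3 : ∀ i l, Continuous (fun z => ‖dzbar i (dz l (toC ρ)) z‖) := fun i l =>
    (contDiff_dzbar i (contDiff_dz l hρ)).continuous.norm
  obtain ⟨M, hM, h⟩ := exists_bound_of_continuous H.bounded (f := fun z => ∑ i, ∑ l,
    (‖dz l (toC ρ) z‖ + ‖dz i (dz l (toC ρ)) z‖ + ‖dzbar i (dz l (toC ρ)) z‖))
    (continuous_finsetSum _ fun i _ => continuous_finsetSum _ fun l _ =>
      ((c1 l).add (c2 i l)).add (c3 i l))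
  refine ⟨M, hM, fun z hz i l => ?_⟩
  have h1 := (le_abs_self _).trans (h z hz)
  have h2 : ‖dz l (toC ρ) z‖ + ‖dz i (dz l (toC ρ)) z‖ + ‖dzbar i (dz l (toC ρ)) z‖ ≤ M := by
    refine le_trans ?_ h1
    refine le_trans ?_ (Finset.single_le_sum (f := fun i => ∑ l, (‖dz l (toC ρ) z‖ +
      ‖dz i (dz l (toC ρ)) z‖ + ‖dzbar i (dz l (toC ρ)) z‖))
      (fun _ _ => Finset.sum_nonneg fun _ _ => by positivity) (Finset.mem_univ i))
    exact Finset.single_le_sum (f := fun l => (‖dz l (toC ρ) z‖ +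
      ‖dz i (dz l (toC ρ)) z‖ + ‖dzbar i (dz l (toC ρ)) z‖))
      (fun _ _ => by positivity) (Finset.mem_univ l)
  have p1 := norm_nonneg (dz l (toC ρ) z)
  have p2 := norm_nonneg (dz i (dz l (toC ρ)) z)
  have p3 := norm_nonneg (dzbar i (dz l (toC ρ)) z)
  exact ⟨by linarith, by linarith, by linarith⟩

/-- The pointwise energy controlled by the basic estimate. -/
def energy {q : ℕ} (u : Coeffs n q) (z : Cn n) : ℝ :=
  ∑ J, ‖u J z‖ ^ 2 + ∑ j, ∑ J, ‖dzbar j (u J) z‖ ^ 2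

theorem energy_nonneg {q : ℕ} (u : Coeffs n q) (z : Cn n) : 0 ≤ energy u z :=
  add_nonneg (Finset.sum_nonneg fun _ _ => by positivity)
    (Finset.sum_nonneg fun _ _ => Finset.sum_nonneg fun _ _ => by positivity)

theorem continuous_energy {q : ℕ} {u : Coeffs n q} (hus : ∀ J, ContDiff ℝ ∞ (u J)) :
    Continuous (energy u) :=
  (continuous_finsetSum _ fun J _ => (hus J).continuous.norm.pow 2).add
    (continuous_finsetSum _ fun j _ => continuous_finsetSum _ fun J _ =>
      (contDiff_dzbar j (hus J)).continuous.norm.pow 2)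

theorem norm_le_sqrt_energy {q : ℕ} (u : Coeffs n q) (J : Fin q → Fin n) (z : Cn n) :
    ‖u J z‖ ≤ Real.sqrt (energy u z) := by
  refine Real.le_sqrt_of_sq_le (le_trans ?_ (le_add_of_nonneg_right
    (Finset.sum_nonneg fun _ _ => Finset.sum_nonneg fun _ _ => by positivity)))
  exact Finset.single_le_sum (f := fun J => ‖u J z‖ ^ 2) (fun _ _ => by positivity)
    (Finset.mem_univ J)

theorem norm_dzbar_le_sqrt_energy {q : ℕ} (u : Coeffs n q) (j : Fin n) (J : Fin q → Fin n)
    (z : Cn n) : ‖dzbar j (u J) z‖ ≤ Real.sqrt (energy u z) := by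
  refine Real.le_sqrt_of_sq_le (le_trans ?_ (le_add_of_nonneg_left
    (Finset.sum_nonneg fun _ _ => by positivity)))
  refine le_trans ?_ (Finset.single_le_sum (f := fun j => ∑ J, ‖dzbar j (u J) z‖ ^ 2)
    (fun _ _ => Finset.sum_nonneg fun _ _ => by positivity) (Finset.mem_univ j))
  exact Finset.single_le_sum (f := fun J => ‖dzbar j (u J) z‖ ^ 2) (fun _ _ => by positivity)
    (Finset.mem_univ J)

/-- The function `∂ρ/∂z_l · conj N_K`, with `N` the normal part of `u`. -/
def normalTest (ρ : Cn n → ℝ) (u : Coeffs n (m + 1)) (l : Fin n) (K : Fin m → Fin n) :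
    Cn n → ℂ := fun z => dz l (toC ρ) z * conj (normalPart ρ u K z)

theorem contDiff_normalTest (hρ : ContDiff ℝ ∞ ρ) {u : Coeffs n (m + 1)}
    (hus : ∀ J, ContDiff ℝ ∞ (u J)) (l : Fin n) (K : Fin m → Fin n) :
    ContDiff ℝ ∞ (normalTest ρ u l K) :=
  (contDiff_dz l (contDiff_toC hρ)).mul (contDiff_conj (contDiff_normalPart hρ hus K))

/-- The conjugate in `normalTest` is what makes this possible: an unbarred derivative of `conj N` is
the conjugate of a barred derivative of `N`, and `energy` contains all barred derivatives of `u`. -/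
theorem exists_normalTest_bound (H : IsGlobalDefining Ω ρ) (m : ℕ) :
    ∃ M : ℝ, 0 < M ∧ ∀ u : Coeffs n (m + 1), (∀ J, ContDiff ℝ ∞ (u J)) →
      ∀ l K, ∀ z ∈ closure Ω, ‖normalTest ρ u l K z‖ ^ 2 +
        8 * ∑ j, ‖dz j (normalTest ρ u l K) z‖ ^ 2 ≤ M * energy u z := by
  obtain ⟨M, hM, hbd⟩ := exists_bound_derivatives H
  refine ⟨(n * M ^ 2) ^ 2 + 8 * (n * (3 * n * M ^ 2) ^ 2) + 1, by positivity,
    fun u hus l K z hz => ?_⟩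
  set τ := Real.sqrt (energy u z) with hτ
  have hτ0 : 0 ≤ τ := Real.sqrt_nonneg _
  have hτ2 : τ ^ 2 = energy u z := Real.sq_sqrt (energy_nonneg u z)
  have hN : ‖normalPart ρ u K z‖ ≤ n * (M * τ) := by
    refine (norm_sum_le_of_le _ (n := fun _ => M * τ) fun i _ => ?_).trans (by simp)
    rw [norm_mul]
    exact mul_le_mul (hbd z hz i i).1 (norm_le_sqrt_energy u _ z) (norm_nonneg _) hM.le
  have hρd := fun i => ContDiff.differentiableAt_of_smooth
    (contDiff_dz i (contDiff_toC H.smooth)) z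
  have hud := fun J => ContDiff.differentiableAt_of_smooth (hus J) z
  have hNd := ContDiff.differentiableAt_of_smooth (contDiff_normalPart H.smooth hus K) z
  have hNdc := ContDiff.differentiableAt_of_smooth
    (contDiff_conj (contDiff_normalPart H.smooth hus K)) z
  have hdN : ∀ j, ‖dzbar j (normalPart ρ u K) z‖ ≤ n * (2 * M * τ) := by
    intro j
    have e : dzbar j (normalPart ρ u K) z = ∑ i, (dzbar j (dz i (toC ρ)) z * u (consIdx i K) z +
        dz i (toC ρ) z * dzbar j (u (consIdx i K)) z) := by
      have : normalPart ρ u K = fun z => ∑ i, dz i (toC ρ) z * u (consIdx i K) z := rfl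
      rw [this, dzbar_sum j _ fun i _ => (hρd i).fun_mul (hud _)]
      exact Finset.sum_congr rfl fun i _ => dzbar_mul j (hρd i) (hud _)
    rw [e]
    refine (norm_sum_le_of_le _ (n := fun _ => 2 * M * τ) fun i _ => ?_).trans (by simp)
    refine (norm_add_le _ _).trans ?_
    rw [norm_mul, norm_mul]
    have h1 := mul_le_mul (hbd z hz j i).2.2 (norm_le_sqrt_energy u (consIdx i K) z)
      (norm_nonneg _) hM.le
    have h2 := mul_le_mul (hbd z hz j i).1 (norm_dzbar_le_sqrt_energy u j (consIdx i K) z)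
      (norm_nonneg _) hM.le
    linarith
  have hf : ‖normalTest ρ u l K z‖ ^ 2 ≤ (n * M ^ 2) ^ 2 * energy u z := by
    rw [← hτ2, ← mul_pow]
    refine pow_le_pow_left₀ (norm_nonneg _) ?_ 2
    rw [normalTest, norm_mul, RCLike.norm_conj]
    calc _ ≤ M * (n * (M * τ)) := mul_le_mul (hbd z hz l l).1 hN (norm_nonneg _) hM.le
      _ = _ := by ring
  have hdf : ∀ j, ‖dz j (normalTest ρ u l K) z‖ ^ 2 ≤ (3 * n * M ^ 2) ^ 2 * energy u z := by
    intro j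
    rw [← hτ2, ← mul_pow]
    refine pow_le_pow_left₀ (norm_nonneg _) ?_ 2
    unfold normalTest
    rw [dz_mul j (hρd l) hNdc, dz_conj j hNd]
    refine (norm_add_le _ _).trans ?_
    rw [norm_mul, norm_mul, RCLike.norm_conj, RCLike.norm_conj]
    have h1 := mul_le_mul (hbd z hz j l).2.1 hN (norm_nonneg _) hM.le
    have h2 := mul_le_mul (hbd z hz j l).1 (hdN j) (norm_nonneg _) hM.le
    linarith
  have hsum : ∑ j, ‖dz j (normalTest ρ u l K) z‖ ^ 2 ≤
      n * ((3 * n * M ^ 2) ^ 2 * energy u z) :=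
    (Finset.sum_le_sum fun j _ => hdf j).trans (by simp)
  have := energy_nonneg u z
  linarith

theorem sobNegOne_sign {q : ℕ} {u : Coeffs n q} (hu : IsForm u) (σ : Equiv.Perm (Fin q))
    (J : Fin q → Fin n) : sobNegOne Ω (u (J ∘ σ)) = sobNegOne Ω (u J) := by
  have h : ∀ φ : Cn n → ℂ, ‖∫ z in Ω, u (J ∘ σ) z * φ z‖ = ‖∫ z in Ω, u J z * φ z‖ := by
    intro φ
    simp only [hu σ J, mul_assoc]
    rw [integral_const_mul, norm_mul, norm_sign, one_mul]
  simp only [sobNegOne, h]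

theorem sobNegOne_eq_zero {f : Cn n → ℂ} (hf : ∀ z, f z = 0) : sobNegOne Ω f = 0 := by
  have h : ∀ φ : Cn n → ℂ, ‖∫ z in Ω, f z * φ z‖ = 0 := by
    intro φ; simp [hf]
  simp only [sobNegOne, h]
  refine le_antisymm (Real.sSup_nonpos ?_) (Real.sSup_nonneg ?_) <;>
  · rintro r ⟨φ, -, -, rfl⟩
    exact le_rfl

theorem factorial_mul_negOneSq {q : ℕ} {u : Coeffs n q} (hu : IsForm u) :
    ∑ J, sobNegOne Ω (u J) ^ 2 = q.factorial * negOneSq Ω u := by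
  rw [negOneSq, ← nsmul_eq_mul, ← sum_eq_factorial_sum_incr]
  · intro σ J
    rw [sobNegOne_sign hu]
  · intro J hJ
    rw [sobNegOne_eq_zero fun z => (hu.skew z).eq_zero hJ]; simp

theorem negOneSq_nonneg {q : ℕ} (u : Coeffs n q) : 0 ≤ negOneSq Ω u :=
  Finset.sum_nonneg fun _ _ => by positivity

theorem normSq_nonneg {q : ℕ} (u : Coeffs n q) : 0 ≤ normSq Ω u :=
  Finset.sum_nonneg fun _ _ => integral_nonneg fun _ => by positivity

/-- The arithmetic-geometric mean inequality: the difference of the squares is `(δS - a²/(4δ))²`. -/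
theorem le_mul_add_div {x a S δ : ℝ} (hS : 0 ≤ S) (hδ : 0 < δ)
    (h : x ^ 2 ≤ a ^ 2 * S) : x ≤ δ * S + a ^ 2 / (4 * δ) := by
  have h1 : a ^ 2 * S ≤ (δ * S + a ^ 2 / (4 * δ)) ^ 2 := by
    have : (δ * S + a ^ 2 / (4 * δ)) ^ 2 - a ^ 2 * S = (δ * S - a ^ 2 / (4 * δ)) ^ 2 := by
      field_simp; ring
    nlinarith [sq_nonneg (δ * S - a ^ 2 / (4 * δ))]
  exact le_of_sq_le_sq (h.trans h1) (by positivity)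

/-- Duality between `W^{-1}` and functions vanishing on the boundary, with the `W¹` norm of
`normalTest` bounded through the basic estimate. -/
theorem integral_normalPart_le (H : IsGlobalDefining Ω ρ) (hL : LeviNonneg Ω ρ) (m : ℕ) :
    ∃ C : ℝ, 0 < C ∧ ∀ (u : Coeffs n (m + 1)) (g : Coeffs n m), IsForm u →
      (∀ J, ContDiff ℝ ∞ (u J)) → HasDbarStar Ω u g → ∀ δ : ℝ, 0 < δ → ∀ l K,
      ‖∫ z in Ω, u (consIdx l K) z * normalTest ρ u l K z‖ ≤
        δ * (C * (normSq Ω (dbar u) + normSq Ω g)) +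
          sobNegOne Ω (u (consIdx l K)) ^ 2 / (4 * δ) := by
  obtain ⟨C, hC, hbasic⟩ := exists_basic_estimate H hL m
  obtain ⟨M, hM, htest⟩ := exists_normalTest_bound H m
  obtain ⟨B, hB, hdual⟩ := exists_norm_integral_mul_le H.isOpen H.bounded
  -- `∂̄u` has degree `m + 2` and `g` degree `m`; a single factorial serves for both norms.
  have hfac1 : (1 : ℝ) ≤ (m + 2).factorial := by exact_mod_cast Nat.factorial_pos _
  have hfac2 : (m.factorial : ℝ) ≤ (m + 2).factorial := by
    exact_mod_cast Nat.factorial_le (by omega)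
  refine ⟨B * (M * (C * (m + 2).factorial)), by positivity, fun u g hu hus hg δ hδ l K => ?_⟩
  set Q := normSq Ω (dbar u) + normSq Ω g with hQ
  have hQ0 : 0 ≤ Q := add_nonneg (normSq_nonneg _) (normSq_nonneg _)
  have h1 : ∫ z in Ω, energy u z ≤ C * ((m + 2).factorial * Q) := by
    refine (hbasic u g hu hus hg).trans ?_
    rw [← factorial_mul_normSq (hu.dbar hus), ← factorial_mul_normSq hg.2.1.1]
    have : (m.factorial : ℝ) * normSq Ω g ≤ (m + 2).factorial * normSq Ω g :=
      mul_le_mul_of_nonneg_right hfac2 (normSq_nonneg _)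
    rw [hQ, mul_add ((m + 2).factorial : ℝ)]
    gcongr
  have hfs := contDiff_normalTest H.smooth hus l K
  have hf0 : ∀ z ∈ frontier Ω, normalTest ρ u l K z = 0 := fun z hz => by
    rw [normalTest, normalPart_eq_zero H hu hus hg hz K]; simp
  have h2 : sobOneSq Ω (normalTest ρ u l K) ≤ M * (C * (m + 2).factorial) * Q := by
    refine (sobOneSq_le H hfs hf0).trans ?_
    have h3 : ∫ z in Ω, (‖normalTest ρ u l K z‖ ^ 2 +
        8 * ∑ j, ‖dz j (normalTest ρ u l K) z‖ ^ 2) ≤ ∫ z in Ω, M * energy u z := by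
      refine setIntegral_mono_on (integrableOn_of_continuous H.bounded ?_)
        (integrableOn_of_continuous H.bounded (continuous_const.mul (continuous_energy hus)))
        H.isOpen.measurableSet fun z hz => htest u hus l K z (subset_closure hz)
      exact (hfs.continuous.norm.pow 2).add (continuous_const.mul
        (continuous_finsetSum _ fun j _ => (contDiff_dz j hfs).continuous.norm.pow 2))
    rw [integral_const_mul] at h3
    refine h3.trans ?_
    calc M * ∫ z in Ω, energy u z ≤ M * (C * ((m + 2).factorial * Q)) := by gcongr
      _ = _ := by ring
  -- The duality estimate needs a positive bound, but `Q` may be zero. The padding `η / (δ * B)`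
  -- contributes exactly `η` to the final inequality.
  refine le_of_forall_pos_le_add fun η hη => ?_
  have hS : 0 < M * (C * (m + 2).factorial) * Q + η / (δ * B) := by positivity
  have h4 := hdual (u (consIdx l K)) _ (hus _).continuous hfs hf0 _ hS
    (h2.trans (le_add_of_nonneg_right (by positivity)))
  have h5 := le_mul_add_div (by positivity) hδ h4
  refine h5.trans (le_of_eq ?_)
  field_simp
  ring

/-- On forms in the domain of `∂̄*`, the normal part is compact with respect to the energy. -/
theorem exists_normalPart_estimate (H : IsGlobalDefining Ω ρ) (hL : LeviNonneg Ω ρ) (m : ℕ)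
    {δ : ℝ} (hδ : 0 < δ) :
    ∃ C : ℝ, 0 < C ∧ ∀ (u : Coeffs n (m + 1)) (g : Coeffs n m), IsForm u →
      (∀ J, ContDiff ℝ ∞ (u J)) → HasDbarStar Ω u g →
      ∑ K, ∫ z in Ω, ‖normalPart ρ u K z‖ ^ 2 ≤
        δ * (normSq Ω (dbar u) + normSq Ω g) + C * negOneSq Ω u := by
  obtain ⟨C, hC, hest⟩ := integral_normalPart_le H hL m
  set D : ℝ := ((Fintype.card (Fin n) * Fintype.card (Fin m → Fin n) : ℕ) : ℝ) with hD
  have hD0 : 0 ≤ D := Nat.cast_nonneg _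
  -- `D` counts the pairs `(l, K)`, each costing `δ' C Q`; `D + 1` avoids division by zero.
  set δ' := δ / ((D + 1) * C) with hδ'
  have hδ'0 : 0 < δ' := by positivity
  refine ⟨(m + 1).factorial / (4 * δ'), by positivity, fun u g hu hus hg => ?_⟩
  have hcN : ∀ K, Continuous (fun z => ‖normalPart ρ u K z‖ ^ 2) := fun K =>
    (contDiff_normalPart H.smooth hus K).continuous.norm.pow 2
  have h1 : ∀ K, ∫ z in Ω, ‖normalPart ρ u K z‖ ^ 2 ≤
      ∑ l, ‖∫ z in Ω, u (consIdx l K) z * normalTest ρ u l K z‖ := by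
    intro K
    have e : ((∫ z in Ω, ‖normalPart ρ u K z‖ ^ 2 : ℝ) : ℂ) =
        ∑ l, ∫ z in Ω, u (consIdx l K) z * normalTest ρ u l K z := by
      rw [← integral_finsetSum, ← integral_complex_ofReal]
      · refine integral_congr_ae (ae_of_all _ fun z => ?_)
        simp only [Complex.ofReal_pow, ← Complex.mul_conj', normalTest]
        change (∑ l, dz l (toC ρ) z * u (consIdx l K) z) * conj (normalPart ρ u K z) = _
        rw [Finset.sum_mul]
        exact Finset.sum_congr rfl fun l _ => by ring
      · intro l _
        exact integrableOn_mul_of_continuous H.bounded (hus _).continuous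
          (contDiff_normalTest H.smooth hus l K).continuous
    calc ∫ z in Ω, ‖normalPart ρ u K z‖ ^ 2
        ≤ ‖((∫ z in Ω, ‖normalPart ρ u K z‖ ^ 2 : ℝ) : ℂ)‖ := by
          rw [Complex.norm_real]; exact le_abs_self _
      _ ≤ _ := by rw [e]; exact norm_sum_le _ _
  set Q := normSq Ω (dbar u) + normSq Ω g with hQ
  have hQ0 : 0 ≤ Q := add_nonneg (normSq_nonneg _) (normSq_nonneg _)
  calc ∑ K, ∫ z in Ω, ‖normalPart ρ u K z‖ ^ 2
      ≤ ∑ K, ∑ l, (δ' * (C * Q) + sobNegOne Ω (u (consIdx l K)) ^ 2 / (4 * δ')) :=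
        Finset.sum_le_sum fun K _ => (h1 K).trans
          (Finset.sum_le_sum fun l _ => hest u g hu hus hg δ' hδ'0 l K)
    _ = D * (δ' * (C * Q)) + (∑ J, sobNegOne Ω (u J) ^ 2) / (4 * δ') := by
        rw [sum_consIdx (fun J => sobNegOne Ω (u J) ^ 2), Finset.sum_comm]
        simp only [Finset.sum_add_distrib, ← Finset.sum_div, Finset.sum_const, Finset.card_univ,
          nsmul_eq_mul, hD]
        push_cast; ring
    _ ≤ _ := by
        rw [factorial_mul_negOneSq hu]
        have h2 : D * (δ' * (C * Q)) ≤ δ * Q := by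
          have : δ' * C * (D + 1) = δ := by rw [hδ']; field_simp
          have h3 : 0 ≤ δ' * C * Q := by positivity
          calc D * (δ' * (C * Q)) ≤ (D + 1) * (δ' * C * Q) := by linarith
            _ = δ * Q := by rw [← this]; ring
        have h4 : ((m + 1).factorial : ℝ) * negOneSq Ω u / (4 * δ') =
          (m + 1).factorial / (4 * δ') * negOneSq Ω u := by ring
        rw [h4]
        linarith

end NormalPart

/-! ### Smooth extensions -/

section Extension

variable {n : ℕ} {Ω : Set (Cn n)} {ρ : Cn n → ℝ}

/-- Multiplication by a cutoff that is `1` near `s` and `0` near the complement of `U`. Agreement on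
neighbourhoods, rather than only on `s`, preserves all derivatives at points of `s`. -/
theorem exists_contDiff_extension {s U : Set (Cn n)} (hs : IsClosed s) (hU : IsOpen U)
    (hsU : s ⊆ U) (hρ : ContDiffOn ℝ ∞ ρ U) :
    ∃ r : Cn n → ℝ, ContDiff ℝ ∞ r ∧ ∀ z ∈ s, r =ᶠ[𝓝 z] ρ := by
  obtain ⟨χ, h0, h1, -⟩ := exists_contMDiffMap_zero_one_nhds_of_isClosed
    (modelWithCornersSelf ℝ (Cn n)) (n := (⊤ : ℕ∞)) hU.isClosed_compl hs
    (Set.disjoint_left.2 fun z hz hzs => hz (hsU hzs))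
  have hχ : ContDiff ℝ ∞ χ := χ.contMDiff.contDiff
  refine ⟨fun z => χ z * ρ z, contDiff_iff_contDiffAt.2 fun z => ?_, fun z hz => ?_⟩
  · by_cases hz : z ∈ U
    · exact hχ.contDiffAt.mul (hρ.contDiffAt (hU.mem_nhds hz))
    · refine (contDiffAt_const (c := (0 : ℝ))).congr_of_eventuallyEq ?_
      filter_upwards [h0.filter_mono (nhds_le_nhdsSet hz)] with y hy
      simp [hy]
  · filter_upwards [h1.filter_mono (nhds_le_nhdsSet hz)] with y hy
    simp [hy]

theorem toC_congr {r : Cn n → ℝ} {z : Cn n} (h : r =ᶠ[𝓝 z] ρ) : toC r =ᶠ[𝓝 z] toC ρ := by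
  filter_upwards [h] with y hy
  simp only [toC, hy]

theorem hess_congr {r : Cn n → ℝ} {z : Cn n} (h : r =ᶠ[𝓝 z] ρ) (j k : Fin n) :
    hess r j k z = hess ρ j k z := by
  refine dz_congr j ?_
  filter_upwards [(toC_congr h).eventuallyEq_nhds] with y hy
  exact dzbar_congr k hy

/-- The extended function may be negative far from `Ω`, so the description of `Ω` by its sign
survives only near boundary points; this is what `loc` records. -/
theorem isGlobalDefining_of_eventuallyEq (hΩ : IsOpen Ω) (hb : Bornology.IsBounded Ω)
    (hρ : IsDefiningFunction Ω ρ) {r : Cn n → ℝ} (hr : ContDiff ℝ ∞ r)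
    (he : ∀ z ∈ closure Ω, r =ᶠ[𝓝 z] ρ) : IsGlobalDefining Ω r := by
  obtain ⟨U, hU, hcU, -, hΩρ, hgrad⟩ := hρ
  have hneg : ∀ z ∈ Ω, r z < 0 := by
    intro z hz
    rw [(he z (subset_closure hz)).self_of_nhds]
    rw [hΩρ] at hz
    exact hz.2
  refine ⟨hΩ, hb, hr, hneg, fun z hz => le_antisymm ?_ ?_, fun z hz => ?_, fun p hp => ?_⟩
  · have hcl : closure Ω ⊆ {z | r z ≤ 0} :=
      closure_minimal (fun z hz => (hneg z hz).le) (isClosed_le hr.continuous continuous_const)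
    exact hcl (frontier_subset_closure hz)
  · have h1 := frontier_subset_closure_diff hΩ hz
    rw [(he z h1.1).self_of_nhds]
    by_contra hlt
    refine h1.2 ?_
    rw [hΩρ]
    exact ⟨hcU h1.1, not_le.1 hlt⟩
  · rw [sum_norm_dz_sq (ContDiff.differentiableAt_of_smooth hr z)]
    have : gradNorm r z = gradNorm ρ z := by
      simp only [gradNorm, dx, dy, (he z (frontier_subset_closure hz)).fderiv_eq]
    rw [this]
    have := hgrad z hz
    positivity
  · have h1 := frontier_subset_closure hp
    filter_upwards [he p h1, hU.mem_nhds (hcU h1)] with z hz hzU hlt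
    rw [hΩρ]
    exact ⟨hzU, by rwa [hz] at hlt⟩

theorem leviNonneg_of_eventuallyEq (hL : LeviNonneg Ω ρ) {r : Cn n → ℝ}
    (he : ∀ z ∈ closure Ω, r =ᶠ[𝓝 z] ρ) : LeviNonneg Ω r := by
  intro z hz w hw
  have h := he z (frontier_subset_closure hz)
  simp only [dz_congr _ (toC_congr h)] at hw
  simp only [hess_congr h]
  exact hL z hz w hw

/-- Extending the coefficients one by one may destroy skew-symmetry off the closure; averaging over
permutations with signs restores it and changes nothing on the closure. -/
theorem exists_contDiff_form {q : ℕ} {u : Coeffs n q} (hu : IsSmoothForm Ω u) :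
    ∃ v : Coeffs n q, IsForm v ∧ (∀ J, ContDiff ℝ ∞ (v J)) ∧
      ∀ J, Set.EqOn (u J) (v J) (closure Ω) := by
  choose g hg hgu using hu.2
  refine ⟨fun J z => (q.factorial : ℂ)⁻¹ *
    ∑ σ : Equiv.Perm (Fin q), ((Equiv.Perm.sign σ : ℤ) : ℂ) * g (J ∘ σ) z, ?_, ?_, ?_⟩
  · intro τ J z
    change _ = ((Equiv.Perm.sign τ : ℤ) : ℂ) * ((q.factorial : ℂ)⁻¹ *
      ∑ σ : Equiv.Perm (Fin q), ((Equiv.Perm.sign σ : ℤ) : ℂ) * g (J ∘ σ) z)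
    rw [mul_left_comm, Finset.mul_sum, ← Equiv.sum_comp (Equiv.mulLeft τ)
      (fun σ : Equiv.Perm (Fin q) =>
        ((Equiv.Perm.sign τ : ℤ) : ℂ) * (((Equiv.Perm.sign σ : ℤ) : ℂ) * g (J ∘ σ) z))]
    refine congrArg _ (Finset.sum_congr rfl fun σ _ => ?_)
    have e : J ∘ (τ * σ : Equiv.Perm (Fin q)) = (J ∘ τ) ∘ σ := rfl
    simp only [Equiv.coe_mulLeft, Equiv.Perm.sign_mul, e]
    push_cast
    linear_combination (-((Equiv.Perm.sign σ : ℤ) : ℂ) * g ((J ∘ τ) ∘ σ) z) * sign_mul_self τ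
  · intro J
    exact contDiff_const.mul (ContDiff.sum fun σ _ => contDiff_const.mul (hg _))
  · intro J z hz
    have h : ∀ σ : Equiv.Perm (Fin q), ((Equiv.Perm.sign σ : ℤ) : ℂ) * g (J ∘ σ) z = u J z := by
      intro σ
      rw [← hgu (J ∘ σ) hz, hu.1 σ J z, ← mul_assoc, sign_mul_self, one_mul]
    simp only [h, Finset.sum_const, Finset.card_univ, Fintype.card_perm, Fintype.card_fin,
      nsmul_eq_mul]
    rw [inv_mul_cancel_left₀]
    exact_mod_cast Nat.factorial_ne_zero q

end Extension

/-! ### Comparison of the two pairings -/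

section Pairing

variable {n m : ℕ} {Ω : Set (Cn n)} {ρ r : Cn n → ℝ}

/-- The pairing of `mixedForm ρ r u` with `β`. -/
def mixedPairing (ρ r : Cn n → ℝ) (u : Coeffs n (m + 1)) (β : Coeffs n m) (z : Cn n) : ℂ :=
  ∑ K ∈ incr n m, mixedForm ρ r u K z * β K z

theorem dbarWedge_eq_wedge (β : Coeffs n m) (J : Fin (m + 1) → Fin n) (z : Cn n) :
    dbarWedge ρ β J z = wedge (fun j L => dzbar j (toC ρ) z * β L z) J := by
  simp only [dbarWedge, wedge, mul_assoc]

theorem Hform_eq_mixedPairing_zero (u : Coeffs n 1) (β : Coeffs n 0) (z : Cn n) :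
    Hform r (dbarWedge ρ β) u z = mixedPairing ρ r u β z := by
  simp only [Hform, mixedPairing, mixedForm, dbarWedge_eq_wedge, wedge_zero, Finset.sum_mul]
  exact Finset.sum_congr rfl fun _ _ => Finset.sum_congr rfl fun _ _ =>
    Finset.sum_congr rfl fun _ _ => by ring

theorem skew_consIdx_consIdx {U : (Fin (m + 2) → Fin n) → ℂ} (hU : Skew U) (k l : Fin n)
    (L : Fin m → Fin n) : U (consIdx k (consIdx l L)) = -U (consIdx l (consIdx k L)) := by
  rw [hU.eq_consIdx_dropIdx (consIdx k (consIdx l L)) (Fin.succ 0),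
    dropIdx_consIdx_succ, dropIdx_consIdx_zero]
  simp [consIdx]

/-- The core identity. Splitting off the first index of `∂̄ρ ∧ β` leaves a wedge with `∂̄ρ` in the
remaining indices; adjointness moves it onto `u` as a contraction with `∂ρ`. -/
theorem Hform_eq_mixedPairing_add (hρ : ContDiff ℝ ∞ ρ) {u : Coeffs n (m + 2)}
    {β : Coeffs n (m + 1)} (hu : IsForm u) (hβ : IsForm β) (z : Cn n) :
    Hform r (dbarWedge ρ β) u z = mixedPairing ρ r u β z + (m.factorial : ℂ)⁻¹ *
      ∑ j, ∑ k, ∑ L, hess r j k z * β (consIdx j L) z * conj (normalPart ρ u (consIdx k L) z) := by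
  have hρc : ∀ j, dzbar j (toC ρ) z = conj (dz j (toC ρ) z) := fun j =>
    dzbar_toC j (ContDiff.differentiableAt_of_smooth hρ z)
  have hsplit : Hform r (dbarWedge ρ β) u z = mixedPairing ρ r u β z -
      ∑ K ∈ incr n (m + 1), ∑ j, ∑ k, hess r j k z *
        wedge (fun l L => dzbar l (toC ρ) z * β (consIdx j L) z) K *
          conj (u (consIdx k K) z) := by
    rw [Hform, mixedPairing, ← Finset.sum_sub_distrib]
    refine Finset.sum_congr rfl fun K _ => ?_
    rw [mixedForm, Finset.sum_mul, ← Finset.sum_sub_distrib]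
    refine Finset.sum_congr rfl fun j _ => ?_
    rw [Finset.sum_mul, ← Finset.sum_sub_distrib]
    refine Finset.sum_congr rfl fun k _ => ?_
    rw [dbarWedge_eq_wedge, wedge_consIdx]
    ring
  have hskew : ∀ j, Skew (wedge (fun l (L : Fin m → Fin n) =>
      dzbar l (toC ρ) z * β (consIdx j L) z)) := fun j =>
    skew_wedge fun l => ((hβ.skew z).consIdx j).const_mul _
  -- The adjoint formula concerns sums over all tuples, so the sum over increasing `K` is first
  -- symmetrized; the factor `(m + 1)!` becomes `m!` when the adjoint formula supplies `m + 1`.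
  have hall := sum_eq_factorial_sum_incr (F := fun K : Fin (m + 1) → Fin n =>
      ∑ j, ∑ k, hess r j k z *
        wedge (fun l L => dzbar l (toC ρ) z * β (consIdx j L) z) K * conj (u (consIdx k K) z))
    (fun σ K => Finset.sum_congr rfl fun j _ => Finset.sum_congr rfl fun k _ => by
      have hs : u (consIdx k (K ∘ σ)) z = ((Equiv.Perm.sign σ : ℤ) : ℂ) * u (consIdx k K) z :=
        (hu.skew z).consIdx k σ K
      rw [hskew j σ K, hs, map_mul, map_intCast]
      linear_combination (hess r j k z *
        wedge (fun l L => dzbar l (toC ρ) z * β (consIdx j L) z) K *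
        conj (u (consIdx k K) z)) * sign_mul_self σ)
    (fun K hK => Finset.sum_eq_zero fun j _ => Finset.sum_eq_zero fun k _ => by
      rw [(hskew j).eq_zero hK]; ring)
  have hwedge : ∑ K : Fin (m + 1) → Fin n, ∑ j, ∑ k, hess r j k z *
      wedge (fun l L => dzbar l (toC ρ) z * β (consIdx j L) z) K * conj (u (consIdx k K) z) =
      -((m + 1 : ℂ) * ∑ j, ∑ k, ∑ L, hess r j k z * β (consIdx j L) z *
        conj (normalPart ρ u (consIdx k L) z)) := by
    rw [Finset.sum_comm, Finset.mul_sum, ← Finset.sum_neg_distrib]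
    refine Finset.sum_congr rfl fun j _ => ?_
    rw [Finset.sum_comm, Finset.mul_sum, ← Finset.sum_neg_distrib]
    refine Finset.sum_congr rfl fun k _ => ?_
    have h1 := sum_skew_mul_wedge ((hu.skew z).consIdx k).conj
      (fun l (L : Fin m → Fin n) => dzbar l (toC ρ) z * β (consIdx j L) z)
    have h2 : ∑ K : Fin (m + 1) → Fin n, hess r j k z *
        wedge (fun l L => dzbar l (toC ρ) z * β (consIdx j L) z) K * conj (u (consIdx k K) z) =
        hess r j k z * ∑ K : Fin (m + 1) → Fin n, conj (u (consIdx k K) z) *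
          wedge (fun l L => dzbar l (toC ρ) z * β (consIdx j L) z) K := by
      rw [Finset.mul_sum]
      exact Finset.sum_congr rfl fun _ _ => by ring
    rw [h2, h1, Finset.sum_comm]
    simp only [Finset.mul_sum, ← Finset.sum_neg_distrib]
    refine Finset.sum_congr rfl fun L _ => ?_
    rw [normalPart, map_sum]
    simp only [Finset.mul_sum, ← Finset.sum_neg_distrib]
    refine Finset.sum_congr rfl fun l _ => ?_
    -- Contraction hits the second index of `u`; exchanging the first two gives the sign that turns
    -- the difference into a sum.
    rw [skew_consIdx_consIdx (hu.skew z) k l L, hρc, map_neg, map_mul]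
    ring
  rw [hwedge, nsmul_eq_mul, Nat.factorial_succ] at hall
  rw [hsplit]
  have hm : (m : ℂ) + 1 ≠ 0 := Nat.cast_add_one_ne_zero m
  have hf : (m.factorial : ℂ) ≠ 0 := by exact_mod_cast Nat.factorial_ne_zero m
  set S := ∑ K ∈ incr n (m + 1), ∑ j, ∑ k, hess r j k z *
        wedge (fun l L => dzbar l (toC ρ) z * β (consIdx j L) z) K * conj (u (consIdx k K) z)
  set T := ∑ j, ∑ k, ∑ L, hess r j k z * β (consIdx j L) z *
        conj (normalPart ρ u (consIdx k L) z)
  have hST : -T = m.factorial * S := by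
    refine mul_left_cancel₀ hm ?_
    push_cast at hall
    linear_combination hall
  have : -S = (m.factorial : ℂ)⁻¹ * T := by
    rw [eq_inv_mul_iff_mul_eq₀ hf]
    linear_combination hST
  rw [← this]; ring

/-- The difference of the two pairings is controlled by the normal part. -/
theorem exists_Hform_sub_mixedPairing_le (n m : ℕ) :
    ∃ c : ℝ, 0 < c ∧ ∀ (ρ r : Cn n → ℝ) (u : Coeffs n (m + 1)) (β : Coeffs n m) (z : Cn n) (M : ℝ),
      ContDiff ℝ ∞ ρ → IsForm u → IsForm β → (∀ j k, ‖hess r j k z‖ ≤ M) →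
      ‖Hform r (dbarWedge ρ β) u z - mixedPairing ρ r u β z‖ ^ 2 ≤
        (c * M ^ 2 * ∑ K, ‖β K z‖ ^ 2) * ∑ K, ‖normalPart ρ u K z‖ ^ 2 := by
  cases m with
  | zero =>
    refine ⟨1, one_pos, fun ρ r u β z M _ _ _ _ => ?_⟩
    rw [Hform_eq_mixedPairing_zero, sub_self, norm_zero, zero_pow two_ne_zero]
    positivity
  | succ m =>
    refine ⟨((n * (n * (Fintype.card (Fin m → Fin n) : ℕ)) : ℝ)) ^ 2 + 1, by positivity,
      fun ρ r u β z M hρ hu hβ hM => ?_⟩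
    rw [Hform_eq_mixedPairing_add hρ hu hβ, add_sub_cancel_left]
    set b := ∑ K, ‖β K z‖ ^ 2 with hb
    set ν := ∑ K, ‖normalPart ρ u K z‖ ^ 2 with hν
    have hb0 : 0 ≤ b := Finset.sum_nonneg fun _ _ => by positivity
    have hν0 : 0 ≤ ν := Finset.sum_nonneg fun _ _ => by positivity
    have hβle : ∀ K, ‖β K z‖ ≤ Real.sqrt b := fun K => Real.le_sqrt_of_sq_le
      (Finset.single_le_sum (f := fun K => ‖β K z‖ ^ 2) (fun _ _ => by positivity)
        (Finset.mem_univ K))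
    have hNle : ∀ K, ‖normalPart ρ u K z‖ ≤ Real.sqrt ν := fun K => Real.le_sqrt_of_sq_le
      (Finset.single_le_sum (f := fun K => ‖normalPart ρ u K z‖ ^ 2) (fun _ _ => by positivity)
        (Finset.mem_univ K))
    have hterm : ∀ j k L, ‖hess r j k z * β (consIdx j L) z *
        conj (normalPart ρ u (consIdx k L) z)‖ ≤ M * Real.sqrt b * Real.sqrt ν := by
      intro j k L
      have hM0 : 0 ≤ M := (norm_nonneg _).trans (hM j k)
      rw [norm_mul, norm_mul, RCLike.norm_conj]
      exact mul_le_mul (mul_le_mul (hM j k) (hβle _) (norm_nonneg _) hM0) (hNle _)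
        (norm_nonneg _) (by positivity)
    have hsum : ‖∑ j, ∑ k, ∑ L, hess r j k z * β (consIdx j L) z *
        conj (normalPart ρ u (consIdx k L) z)‖ ≤
        (n * (n * (Fintype.card (Fin m → Fin n) : ℕ)) : ℝ) * (M * Real.sqrt b * Real.sqrt ν) := by
      refine (norm_sum_le_of_le _ fun j _ => norm_sum_le_of_le _ fun k _ =>
        norm_sum_le_of_le _ fun L _ => hterm j k L).trans (le_of_eq ?_)
      simp only [Finset.sum_const, Finset.card_univ, Fintype.card_fin, nsmul_eq_mul]
      ring
    have hfac : ‖(m.factorial : ℂ)⁻¹‖ ≤ 1 := by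
      rw [norm_inv, Complex.norm_natCast]
      exact inv_le_one_of_one_le₀ (by exact_mod_cast Nat.factorial_pos m)
    rw [norm_mul]
    have h1 := (mul_le_of_le_one_left (norm_nonneg _) hfac).trans hsum
    have h2 := pow_le_pow_left₀ (by positivity) h1 2
    refine h2.trans ?_
    rw [mul_pow _ (M * Real.sqrt b * Real.sqrt ν), mul_pow (M * Real.sqrt b), mul_pow M, Real.sq_sqrt hb0, Real.sq_sqrt hν0]
    have : 0 ≤ M ^ 2 * b * ν := by positivity
    linarith

/-- Cauchy-Schwarz by discriminant: for every `t > 0` the pointwise bound gives `2|∫f| ≤ t∫P +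
t⁻¹∫Q`, so a quadratic polynomial in `t` is nonnegative. -/
theorem norm_sq_setIntegral_le (hb : Bornology.IsBounded Ω) (hΩ : IsOpen Ω) {f : Cn n → ℂ}
    {P Q : Cn n → ℝ} (hf : Continuous f) (hP : Continuous P) (hQ : Continuous Q)
    (hP0 : ∀ z, 0 ≤ P z) (hQ0 : ∀ z, 0 ≤ Q z) (h : ∀ z ∈ Ω, ‖f z‖ ^ 2 ≤ P z * Q z) :
    ‖∫ z in Ω, f z‖ ^ 2 ≤ (∫ z in Ω, P z) * ∫ z in Ω, Q z := by
  have hPi := integrableOn_of_continuous hb hP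
  have hQi := integrableOn_of_continuous hb hQ
  set x := ‖∫ z in Ω, f z‖
  set p := ∫ z in Ω, P z
  set q := ∫ z in Ω, Q z
  have hp : 0 ≤ p := integral_nonneg hP0
  have hq : 0 ≤ q := integral_nonneg hQ0
  have hx : 0 ≤ x := norm_nonneg _
  have key : ∀ t : ℝ, 0 < t → 2 * x ≤ t * p + t⁻¹ * q := by
    intro t ht
    have h1 : x ≤ ∫ z in Ω, (t / 2 * P z + t⁻¹ / 2 * Q z) := by
      refine (norm_integral_le_integral_norm _).trans (setIntegral_mono_on
        (integrableOn_of_continuous hb hf).norm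
        ((hPi.const_mul _).add (hQi.const_mul _)) hΩ.measurableSet fun z hz => ?_)
      have hp1 := hP0 z
      have hq1 := hQ0 z
      refine le_of_sq_le_sq ((h z hz).trans ?_) (by positivity)
      have : (t / 2 * P z + t⁻¹ / 2 * Q z) ^ 2 - P z * Q z =
          (t / 2 * P z - t⁻¹ / 2 * Q z) ^ 2 := by field_simp; ring
      nlinarith [sq_nonneg (t / 2 * P z - t⁻¹ / 2 * Q z)]
    rw [integral_add (hPi.const_mul _) (hQi.const_mul _), integral_const_mul,
      integral_const_mul] at h1
    linarith
  have hd : discrim p (-2 * x) q ≤ 0 := by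
    refine discrim_le_zero fun t => ?_
    rcases le_or_gt t 0 with ht | ht
    · have h1 : 0 ≤ p * (t * t) := mul_nonneg hp (mul_self_nonneg t)
      have h2 : 0 ≤ -t * x := mul_nonneg (by linarith) hx
      linarith
    · have h1 := mul_le_mul_of_nonneg_left (key t ht) ht.le
      have h2 : t * (t * p + t⁻¹ * q) = p * (t * t) + q := by field_simp
      linarith
  rw [discrim] at hd
  linarith

theorem IsForm.mixedForm {u : Coeffs n (m + 1)} (hu : IsForm u) : IsForm (mixedForm ρ r u) :=
  isForm_of_skew fun z => Skew.sum fun _ _ => Skew.sum fun k _ =>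
    (((hu.skew z).consIdx k).conj).const_mul _

theorem contDiff_mixedForm (hρ : ContDiff ℝ ∞ ρ) (hr : ContDiff ℝ ∞ r) {u : Coeffs n (m + 1)}
    (hus : ∀ J, ContDiff ℝ ∞ (u J)) (K : Fin m → Fin n) : ContDiff ℝ ∞ (mixedForm ρ r u K) :=
  ContDiff.sum fun j _ => ContDiff.sum fun k _ =>
    ((contDiff_hess j k hr).mul (contDiff_dzbar j (contDiff_toC hρ))).mul (contDiff_conj (hus _))

theorem contDiff_dbarWedge (hρ : ContDiff ℝ ∞ ρ) {β : Coeffs n m}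
    (hβ : ∀ K, ContDiff ℝ ∞ (β K)) (J : Fin (m + 1) → Fin n) :
    ContDiff ℝ ∞ (dbarWedge ρ β J) :=
  ContDiff.sum fun _ _ => (contDiff_const.mul (contDiff_dzbar _ (contDiff_toC hρ))).mul (hβ _)

theorem contDiff_Hform (hr : ContDiff ℝ ∞ r) {v u : Coeffs n (m + 1)}
    (hv : ∀ J, ContDiff ℝ ∞ (v J)) (hu : ∀ J, ContDiff ℝ ∞ (u J)) :
    ContDiff ℝ ∞ (Hform r v u) :=
  ContDiff.sum fun _ _ => ContDiff.sum fun j _ => ContDiff.sum fun k _ =>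
    ((contDiff_hess j k hr).mul (hv _)).mul (contDiff_conj (hu _))

theorem contDiff_mixedPairing (hρ : ContDiff ℝ ∞ ρ) (hr : ContDiff ℝ ∞ r)
    {u : Coeffs n (m + 1)} {β : Coeffs n m} (hu : ∀ J, ContDiff ℝ ∞ (u J))
    (hβ : ∀ J, ContDiff ℝ ∞ (β J)) : ContDiff ℝ ∞ (mixedPairing ρ r u β) :=
  ContDiff.sum fun K _ => (contDiff_mixedForm hρ hr hu K).mul (hβ K)

theorem integral_sum_incr_norm_sq (hb : Bornology.IsBounded Ω) {v : Coeffs n m}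
    (hv : ∀ J, ContDiff ℝ ∞ (v J)) :
    ∫ z in Ω, ∑ K ∈ incr n m, ‖v K z‖ ^ 2 = normSq Ω v :=
  integral_finsetSum _ fun K _ => integrableOn_of_continuous hb ((hv K).continuous.norm.pow 2)

theorem norm_sq_integral_mixedPairing_le (H : IsGlobalDefining Ω ρ) (hr : ContDiff ℝ ∞ r)
    {u : Coeffs n (m + 1)} {β : Coeffs n m} (hu : ∀ J, ContDiff ℝ ∞ (u J))
    (hβ : ∀ J, ContDiff ℝ ∞ (β J)) :
    ‖∫ z in Ω, mixedPairing ρ r u β z‖ ^ 2 ≤ normSq Ω (mixedForm ρ r u) * normSq Ω β := by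
  rw [← integral_sum_incr_norm_sq H.bounded hβ,
    ← integral_sum_incr_norm_sq H.bounded (contDiff_mixedForm H.smooth hr hu)]
  refine norm_sq_setIntegral_le H.bounded H.isOpen
    (contDiff_mixedPairing H.smooth hr hu hβ).continuous
    (continuous_finsetSum _ fun K _ =>
      (contDiff_mixedForm H.smooth hr hu K).continuous.norm.pow 2)
    (continuous_finsetSum _ fun K _ => (hβ K).continuous.norm.pow 2)
    (fun z => Finset.sum_nonneg fun _ _ => by positivity)
    (fun z => Finset.sum_nonneg fun _ _ => by positivity) fun z _ => ?_
  have h1 : ‖mixedPairing ρ r u β z‖ ≤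
      ∑ K ∈ incr n m, ‖mixedForm ρ r u K z‖ * ‖β K z‖ :=
    norm_sum_le_of_le _ fun K _ => (norm_mul _ _).le
  exact (pow_le_pow_left₀ (norm_nonneg _) h1 2).trans (Finset.sum_mul_sq_le_sq_mul_sq _ _ _)

theorem exists_bound_hess (hb : Bornology.IsBounded Ω) (hr : ContDiff ℝ ∞ r) :
    ∃ M : ℝ, 0 < M ∧ ∀ z ∈ closure Ω, ∀ j k, ‖hess r j k z‖ ≤ M := by
  obtain ⟨M, hM, h⟩ := exists_bound_of_continuous hb (f := fun z => ∑ j, ∑ k, ‖hess r j k z‖)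
    (continuous_finsetSum _ fun j _ => continuous_finsetSum _ fun k _ =>
      (contDiff_hess j k hr).continuous.norm)
  refine ⟨M, hM, fun z hz j k => le_trans ?_ ((le_abs_self _).trans (h z hz))⟩
  refine le_trans ?_ (Finset.single_le_sum (f := fun j => ∑ k, ‖hess r j k z‖)
    (fun _ _ => Finset.sum_nonneg fun _ _ => by positivity) (Finset.mem_univ j))
  exact Finset.single_le_sum (f := fun k => ‖hess r j k z‖) (fun _ _ => by positivity)
    (Finset.mem_univ k)

/-- The two pairings agree up to a small multiple of the energy and a compact term. -/
theorem exists_integral_Hform_sub_le (H : IsGlobalDefining Ω ρ) (hL : LeviNonneg Ω ρ)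
    (hr : ContDiff ℝ ∞ r) (m : ℕ) {δ : ℝ} (hδ : 0 < δ) :
    ∃ C : ℝ, 0 < C ∧ ∀ (u : Coeffs n (m + 1)) (g : Coeffs n m), IsForm u →
      (∀ J, ContDiff ℝ ∞ (u J)) → HasDbarStar Ω u g → ∀ β : Coeffs n m, IsForm β →
      (∀ J, ContDiff ℝ ∞ (β J)) → normSq Ω β ≤ 1 →
      ‖(∫ z in Ω, Hform r (dbarWedge ρ β) u z) - ∫ z in Ω, mixedPairing ρ r u β z‖ ^ 2 ≤
        δ * (normSq Ω (dbar u) + normSq Ω g) + C * negOneSq Ω u := by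
  obtain ⟨c, hc, hpt⟩ := exists_Hform_sub_mixedPairing_le n m
  obtain ⟨M, hM, hhess⟩ := exists_bound_hess H.bounded hr
  set A := c * M ^ 2 * m.factorial with hA
  have hA0 : 0 < A := by positivity
  -- `A` contains the bound `M` for the Hessian of `r`, which nothing controls uniformly over a
  -- family. Using the compactness estimate with `δ / A` moves this dependence into the constant of
  -- the `W^{-1}` term.
  obtain ⟨C, hC, hest⟩ := exists_normalPart_estimate H hL m (δ := δ / A) (by positivity)
  refine ⟨A * C, by positivity, fun u g hu hus hg β hβ hβs hβ1 => ?_⟩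
  have hN := hest u g hu hus hg
  have cH := (contDiff_Hform hr (contDiff_dbarWedge H.smooth hβs) hus).continuous
  have cP := (contDiff_mixedPairing H.smooth hr hus hβs).continuous
  have cβ : ∀ K, Continuous (fun z => ‖β K z‖ ^ 2) := fun K => (hβs K).continuous.norm.pow 2
  have cN : ∀ K, Continuous (fun z => ‖normalPart ρ u K z‖ ^ 2) := fun K =>
    (contDiff_normalPart H.smooth hus K).continuous.norm.pow 2
  rw [← integral_sub (integrableOn_of_continuous H.bounded cH)
    (integrableOn_of_continuous H.bounded cP)]
  have h1 := norm_sq_setIntegral_le H.bounded H.isOpen (cH.sub cP)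
    (P := fun z => c * M ^ 2 * ∑ K, ‖β K z‖ ^ 2) (Q := fun z => ∑ K, ‖normalPart ρ u K z‖ ^ 2)
    (continuous_const.mul (continuous_finsetSum _ fun K _ => cβ K))
    (continuous_finsetSum _ fun K _ => cN K)
    (fun z => mul_nonneg (by positivity) (Finset.sum_nonneg fun _ _ => by positivity))
    (fun z => Finset.sum_nonneg fun _ _ => by positivity)
    (fun z hz => hpt ρ r u β z M H.smooth hu hβ (hhess z (subset_closure hz)))
  rw [integral_const_mul, integral_finsetSum _ fun K _ => integrableOn_of_continuous H.bounded
    (cβ K), integral_finsetSum _ fun K _ => integrableOn_of_continuous H.bounded (cN K),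
    ← factorial_mul_normSq hβ] at h1
  have hN0 : 0 ≤ ∑ K, ∫ z in Ω, ‖normalPart ρ u K z‖ ^ 2 :=
    Finset.sum_nonneg fun _ _ => integral_nonneg fun _ => by positivity
  have h2 : c * M ^ 2 * (m.factorial * normSq Ω β) ≤ A := by
    calc c * M ^ 2 * (m.factorial * normSq Ω β) = A * normSq Ω β := by rw [hA]; ring
      _ ≤ A * 1 := by gcongr
      _ = A := mul_one A
  refine h1.trans ((mul_le_mul h2 hN hN0 hA0.le).trans (le_of_eq ?_))
  field_simp

end Pairing

/-! ### Invariance under change outside the closure -/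

section Congr

variable {n m : ℕ} {Ω : Set (Cn n)} {ρ ρ' r r' : Cn n → ℝ}

theorem normSq_congr (hΩ : IsOpen Ω) {u v : Coeffs n m} (h : ∀ J, Set.EqOn (u J) (v J) Ω) :
    normSq Ω u = normSq Ω v :=
  Finset.sum_congr rfl fun J _ => setIntegral_congr_fun hΩ.measurableSet fun z hz => by
    simp only [h J hz]

theorem negOneSq_congr (hΩ : IsOpen Ω) {u v : Coeffs n m} (h : ∀ J, Set.EqOn (u J) (v J) Ω) :
    negOneSq Ω u = negOneSq Ω v := by
  refine Finset.sum_congr rfl fun J _ => ?_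
  have e : ∀ φ : Cn n → ℂ, ∫ z in Ω, u J z * φ z = ∫ z in Ω, v J z * φ z := fun φ =>
    setIntegral_congr_fun hΩ.measurableSet fun z hz => by simp only [h J hz]
  simp only [sobNegOne, e]

theorem eqOn_dbar (hΩ : IsOpen Ω) {u v : Coeffs n m} (h : ∀ J, Set.EqOn (u J) (v J) Ω)
    (J : Fin (m + 1) → Fin n) : Set.EqOn (dbar u J) (dbar v J) Ω := fun z hz =>
  Finset.sum_congr rfl fun s _ => by
    rw [dzbar_congr _ ((h (dropIdx J s)).eventuallyEq_of_mem (hΩ.mem_nhds hz))]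

theorem HasDbarStar.congr (hΩ : IsOpen Ω) {u v : Coeffs n (m + 1)} {g : Coeffs n m}
    (hug : HasDbarStar Ω u g) (hv : IsForm v) (h : ∀ J, Set.EqOn (u J) (v J) Ω) :
    HasDbarStar Ω v g := by
  refine ⟨⟨hv, fun J => (hug.1.2 J).ae_eq ?_⟩, hug.2.1, fun w f hwf => ?_⟩
  · filter_upwards [ae_restrict_mem hΩ.measurableSet] with z hz using h J hz
  · rw [← hug.2.2 w f hwf]
    exact Finset.sum_congr rfl fun J _ => setIntegral_congr_fun hΩ.measurableSet fun z hz => by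
      simp only [h J hz]

theorem eqOn_mixedForm (hρ : ∀ z ∈ Ω, ρ =ᶠ[𝓝 z] ρ') (hr : ∀ z ∈ Ω, r =ᶠ[𝓝 z] r')
    {u v : Coeffs n (m + 1)} (h : ∀ J, Set.EqOn (u J) (v J) Ω) (K : Fin m → Fin n) :
    Set.EqOn (mixedForm ρ r u K) (mixedForm ρ' r' v K) Ω := fun z hz => by
  simp only [mixedForm, hess_congr (hr z hz), dzbar_congr _ (toC_congr (hρ z hz)), h _ hz]

theorem integral_Hform_dbarWedge_congr (hΩ : IsOpen Ω) (hρ : ∀ z ∈ Ω, ρ =ᶠ[𝓝 z] ρ')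
    (hr : ∀ z ∈ Ω, r =ᶠ[𝓝 z] r') {u v : Coeffs n (m + 1)} {β γ : Coeffs n m}
    (h : ∀ J, Set.EqOn (u J) (v J) Ω) (hβ : ∀ K, Set.EqOn (β K) (γ K) Ω) :
    ∫ z in Ω, Hform r (dbarWedge ρ β) u z = ∫ z in Ω, Hform r' (dbarWedge ρ' γ) v z :=
  setIntegral_congr_fun hΩ.measurableSet fun z hz => by
    simp only [Hform, dbarWedge, hess_congr (hr z hz), dzbar_congr _ (toC_congr (hρ z hz)),
      h _ hz, hβ _ hz]

theorem CondII.congr (hΩ : IsOpen Ω) (hρ : ∀ z ∈ Ω, ρ =ᶠ[𝓝 z] ρ') (hr : ∀ z ∈ Ω, r =ᶠ[𝓝 z] r')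
    {ε : ℝ} (h : CondII Ω ρ m ε r) : CondII Ω ρ' m ε r' := by
  obtain ⟨C, hC⟩ := h
  refine ⟨C, fun u g hu hg => ?_⟩
  rw [← normSq_congr hΩ (eqOn_mixedForm hρ hr fun _ => Set.eqOn_refl _ _)]
  exact hC u g hu hg

theorem CondIII.congr (hΩ : IsOpen Ω) (hρ : ∀ z ∈ Ω, ρ =ᶠ[𝓝 z] ρ')
    (hr : ∀ z ∈ Ω, r =ᶠ[𝓝 z] r') {ε : ℝ} (h : CondIII Ω ρ m ε r) : CondIII Ω ρ' m ε r' := by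
  obtain ⟨C, hC⟩ := h
  refine ⟨C, fun u g hu hg => ?_⟩
  refine le_trans (iSup_mono fun β => ?_) (hC u g hu hg)
  rw [integral_Hform_dbarWedge_congr hΩ hρ hr (fun _ => Set.eqOn_refl _ _)
    (fun _ => Set.eqOn_refl _ _)]

end Congr

/-! ### The equivalence for global defining functions -/

section Equivalence

variable {n m : ℕ} {Ω : Set (Cn n)} {ρ r : Cn n → ℝ}

theorem norm_sq_le_two_mul_add (a b : ℂ) : ‖a‖ ^ 2 ≤ 2 * ‖b‖ ^ 2 + 2 * ‖a - b‖ ^ 2 := by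
  have h : ‖a‖ ≤ ‖b‖ + ‖a - b‖ := by simpa using norm_add_le b (a - b)
  nlinarith [norm_nonneg a, sq_nonneg (‖b‖ - ‖a - b‖), pow_le_pow_left₀ (norm_nonneg a) h 2]

/-- Cauchy-Schwarz bounds the mixed pairing by the norm in (ii); this and the difference of the
pairings each cost `ε/4`, doubled by `|a|² ≤ 2|b|² + 2|a - b|²`. -/
theorem CondII.condIII (H : IsGlobalDefining Ω ρ) (hL : LeviNonneg Ω ρ) (hr : ContDiff ℝ ∞ r)
    {ε : ℝ} (hε : 0 < ε) (h : CondII Ω ρ m (ε / 4) r) : CondIII Ω ρ m ε r := by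
  obtain ⟨C₁, hC₁⟩ := h
  obtain ⟨C₂, -, hC₂⟩ := exists_integral_Hform_sub_le H hL hr m (δ := ε / 4) (by positivity)
  refine ⟨2 * C₁ + 2 * C₂, fun u g hu hug => iSup_le fun ⟨β, hβ, hβ1⟩ => ?_⟩
  rw [EReal.coe_le_coe_iff]
  obtain ⟨v, hv, hvs, huv⟩ := exists_contDiff_form hu
  obtain ⟨γ, hγ, hγs, hβγ⟩ := exists_contDiff_form hβ
  have huv' : ∀ J, Set.EqOn (u J) (v J) Ω := fun J => (huv J).mono subset_closure
  have hβγ' : ∀ J, Set.EqOn (β J) (γ J) Ω := fun J => (hβγ J).mono subset_closure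
  have hvg := hug.congr H.isOpen hv huv'
  have h1 := hC₁ u g hu hug
  rw [normSq_congr H.isOpen (eqOn_mixedForm (fun _ _ => EventuallyEq.rfl)
    (fun _ _ => EventuallyEq.rfl) huv')] at h1
  rw [normSq_congr H.isOpen hβγ'] at hβ1
  rw [integral_Hform_dbarWedge_congr H.isOpen (fun _ _ => EventuallyEq.rfl)
    (fun _ _ => EventuallyEq.rfl) huv' hβγ']
  rw [normSq_congr H.isOpen (eqOn_dbar H.isOpen huv'), negOneSq_congr H.isOpen huv'] at h1 ⊢
  have h2 := hC₂ v g hv hvs hvg γ hγ hγs hβ1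
  have h3 := norm_sq_integral_mixedPairing_le H hr hvs hγs
  have h4 := mul_le_of_le_one_right (normSq_nonneg (Ω := Ω) (mixedForm ρ r v)) hβ1
  have h5 := norm_sq_le_two_mul_add (∫ z in Ω, Hform r (dbarWedge ρ γ) v z)
    (∫ z in Ω, mixedPairing ρ r v γ z)
  linarith

/-- The normalized conjugate of a form attains the norm of the form. -/
theorem exists_pairing_eq (hb : Bornology.IsBounded Ω) {f : Coeffs n m} (hf : IsForm f)
    (hfs : ∀ J, ContDiff ℝ ∞ (f J)) (hpos : 0 < normSq Ω f) :
    ∃ β : Coeffs n m, IsForm β ∧ (∀ J, ContDiff ℝ ∞ (β J)) ∧ normSq Ω β = 1 ∧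
      ‖∫ z in Ω, ∑ K ∈ incr n m, f K z * β K z‖ ^ 2 = normSq Ω f := by
  set s := √(normSq Ω f)
  have hs : s ^ 2 = normSq Ω f := Real.sq_sqrt hpos.le
  have hs0 : 0 < s := Real.sqrt_pos.2 hpos
  refine ⟨fun K z => ((s⁻¹ : ℝ) : ℂ) * conj (f K z),
    isForm_of_skew fun z => ((hf.skew z).conj).const_mul _,
    fun J => contDiff_const.mul (contDiff_conj (hfs J)), ?_, ?_⟩
  · have e : ∀ K z, ‖((s⁻¹ : ℝ) : ℂ) * conj (f K z)‖ ^ 2 = (s ^ 2)⁻¹ * ‖f K z‖ ^ 2 := fun K z => by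
      rw [norm_mul, RCLike.norm_conj, Complex.norm_real, Real.norm_of_nonneg (by positivity),
        mul_pow, inv_pow]
    simp only [normSq, e, integral_const_mul, ← Finset.mul_sum]
    rw [hs]
    exact inv_mul_cancel₀ hpos.ne'
  · have e : ∀ z, ∑ K ∈ incr n m, f K z * (((s⁻¹ : ℝ) : ℂ) * conj (f K z)) =
        ((s⁻¹ * ∑ K ∈ incr n m, ‖f K z‖ ^ 2 : ℝ) : ℂ) := fun z => by
      push_cast
      rw [Finset.mul_sum]
      refine Finset.sum_congr rfl fun K _ => ?_
      rw [mul_left_comm, Complex.mul_conj, Complex.normSq_eq_norm_sq]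
      push_cast
      rfl
    simp only [e]
    rw [integral_complex_ofReal, integral_const_mul, integral_sum_incr_norm_sq hb hfs, ← hs,
      Complex.norm_real, Real.norm_of_nonneg (by positivity)]
    field_simp

/-- A single competitor in the supremum suffices: the normalized conjugate of `mixedForm ρ r v`,
whose mixed pairing has absolute square exactly the norm in (ii). -/
theorem CondIII.condII (H : IsGlobalDefining Ω ρ) (hL : LeviNonneg Ω ρ) (hr : ContDiff ℝ ∞ r)
    {ε : ℝ} (hε : 0 < ε) (h : CondIII Ω ρ m (ε / 4) r) : CondII Ω ρ m ε r := by
  obtain ⟨C₁, hC₁⟩ := h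
  obtain ⟨C₂, hC₂0, hC₂⟩ := exists_integral_Hform_sub_le H hL hr m (δ := ε / 4) (by positivity)
  -- `C₁` may be negative; the absolute value keeps the right side nonnegative when the mixed form
  -- is zero and cannot be normalized.
  refine ⟨2 * |C₁| + 2 * C₂, fun u g hu hug => ?_⟩
  obtain ⟨v, hv, hvs, huv⟩ := exists_contDiff_form hu
  have huv' : ∀ J, Set.EqOn (u J) (v J) Ω := fun J => (huv J).mono subset_closure
  have hvg := hug.congr H.isOpen hv huv'
  have h1 := hC₁ u g hu hug
  rw [normSq_congr H.isOpen (eqOn_mixedForm (fun _ _ => EventuallyEq.rfl)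
    (fun _ _ => EventuallyEq.rfl) huv')]
  rw [normSq_congr H.isOpen (eqOn_dbar H.isOpen huv'), negOneSq_congr H.isOpen huv'] at h1 ⊢
  have hQ := add_nonneg (normSq_nonneg (Ω := Ω) (dbar v)) (normSq_nonneg (Ω := Ω) g)
  have hN := negOneSq_nonneg (Ω := Ω) v
  rcases (normSq_nonneg (Ω := Ω) (mixedForm ρ r v)).eq_or_lt with h0 | h0
  · rw [← h0]
    positivity
  obtain ⟨β, hβ, hβs, hβ1, hpair⟩ := exists_pairing_eq H.bounded hv.mixedForm
    (contDiff_mixedForm H.smooth hr hvs) h0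
  have hβsm : IsSmoothForm Ω β := ⟨hβ, fun J => ⟨β J, hβs J, Set.eqOn_refl _ _⟩⟩
  have h2 := (le_iSup (fun γ : {γ : Coeffs n m // IsSmoothForm Ω γ ∧ normSq Ω γ ≤ 1} =>
    ((‖∫ z in Ω, Hform r (dbarWedge ρ γ.1) u z‖ ^ 2 : ℝ) : EReal)) ⟨β, hβsm, hβ1.le⟩).trans h1
  rw [EReal.coe_le_coe_iff, integral_Hform_dbarWedge_congr H.isOpen
    (fun _ _ => EventuallyEq.rfl) (fun _ _ => EventuallyEq.rfl) huv'
    (fun _ => Set.eqOn_refl _ _)] at h2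
  have h3 := hC₂ v g hv hvs hvg β hβ hβs hβ1.le
  rw [norm_sub_rev] at h3
  have h4 := norm_sq_le_two_mul_add (∫ z in Ω, mixedPairing ρ r v β z)
    (∫ z in Ω, Hform r (dbarWedge ρ β) v z)
  have h5 : ‖∫ z in Ω, mixedPairing ρ r v β z‖ ^ 2 = normSq Ω (mixedForm ρ r v) := hpair
  have h6 := mul_le_mul_of_nonneg_right (le_abs_self C₁) hN
  linarith

end Equivalence

end DbarNeumann

end

/-! ### Passage to global extensions and the equivalence for families -/

theorem mainTheorem4 (n q : ℕ) (hq : 1 ≤ q) (hqn : q ≤ n)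
    (Ω : Set (DbarNeumann.Cn n)) (hΩ : DbarNeumann.IsSmoothBddPseudoconvexDomain Ω)
    (ρ : DbarNeumann.Cn n → ℝ) (hρ : DbarNeumann.IsDefiningFunction Ω ρ) (C : ℝ) :
    ∃ c : ℝ, 0 < c ∧ ∀ ρfam : ℝ → DbarNeumann.Cn n → ℝ,
      (∀ ε : ℝ, 0 < ε → DbarNeumann.IsDefiningFunction Ω (ρfam ε)) →
      ((∀ ε : ℝ, 0 < ε →
          DbarNeumann.CondI Ω C (ρfam ε) ∧ DbarNeumann.CondII Ω ρ (q - 1) ε (ρfam ε)) →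
        ∀ ε : ℝ, 0 < ε →
          DbarNeumann.CondI Ω C (ρfam (c * ε)) ∧
            DbarNeumann.CondIII Ω ρ (q - 1) ε (ρfam (c * ε))) ∧
      ((∀ ε : ℝ, 0 < ε →
          DbarNeumann.CondI Ω C (ρfam ε) ∧ DbarNeumann.CondIII Ω ρ (q - 1) ε (ρfam ε)) →
        ∀ ε : ℝ, 0 < ε →
          DbarNeumann.CondI Ω C (ρfam (c * ε)) ∧
            DbarNeumann.CondII Ω ρ (q - 1) ε (ρfam (c * ε))) := by
  -- Both estimates depend on `ρ` and `ρ_ε` only through their germs at points of `Ω`, so the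
  -- defining functions may be replaced by globally smooth ones.
  have hext : ∀ f, DbarNeumann.IsDefiningFunction Ω f → ∃ r : DbarNeumann.Cn n → ℝ,
      ContDiff ℝ ∞ r ∧ ∀ z ∈ closure Ω, r =ᶠ[nhds z] f := by
    rintro f ⟨U, hU, hcU, hf, -⟩
    exact DbarNeumann.exists_contDiff_extension isClosed_closure hU hcU hf
  obtain ⟨ρ', hρ's, hρ'⟩ := hext ρ hρ
  have H := DbarNeumann.isGlobalDefining_of_eventuallyEq hΩ.isOpen hΩ.bounded hρ hρ's hρ'
  have hL := DbarNeumann.leviNonneg_of_eventuallyEq (hΩ.pseudoconvex ρ hρ) hρ'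
  have e₁ : ∀ z ∈ Ω, ρ' =ᶠ[nhds z] ρ := fun z hz => hρ' z (subset_closure hz)
  -- The estimate with factor `ε` for the member at `ε/4` is deduced from the other estimate for
  -- that same member, whose factor is `ε/4`; condition (i) for it is unchanged.
  refine ⟨1 / 4, by norm_num, fun ρfam hfam => ⟨fun h ε hε => ?_, fun h ε hε => ?_⟩⟩ <;>
    obtain ⟨h1, h2⟩ := h (1 / 4 * ε) (by positivity) <;>
    obtain ⟨r, hrs, hr⟩ := hext _ (hfam (1 / 4 * ε) (by positivity)) <;>
    have e₂ : ∀ z ∈ Ω, r =ᶠ[nhds z] ρfam (1 / 4 * ε) := fun z hz => hr z (subset_closure hz) <;>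
    refine ⟨h1, ?_⟩
  · replace h2 := h2.congr hΩ.isOpen (fun z hz => (e₁ z hz).symm) fun z hz => (e₂ z hz).symm
    rw [one_div_mul_eq_div] at h2
    exact (h2.condIII H hL hrs hε).congr hΩ.isOpen e₁ (by simpa only [one_div_mul_eq_div] using e₂)
  · replace h2 := h2.congr hΩ.isOpen (fun z hz => (e₁ z hz).symm) fun z hz => (e₂ z hz).symm
    rw [one_div_mul_eq_div] at h2
    exact (h2.condII H hL hrs hε).congr hΩ.isOpen e₁ (by simpa only [one_div_mul_eq_div] using e₂)
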